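/- Let $n\in\mathbb N$ and let $\mathbb D^n=\{z\in\mathbb C^n:|z_i|<1 \text{ for all } i\}$. Let $d\sigma$ be the normalised Lebesgue measure on $\mathbb T^n$. For $1\le p<\infty$ let $H^p=H^p(\mathbb D^n)$ be the space of holomorphic functions $f$ on $\mathbb D^n$ with $$\|f\|_{p}:=\sup_{0\le r<1}\Big(\int_{\mathbb T^n}|f(r\zeta)|^p\,d\sigma(\zeta)\Big)^{1/p}<\infty .$$ Suppose that there is a constant $C>0$ such that $H^q$ has the extended weak factorisation property with constant $C$ for every $1\le q\le 2$: every $f\in H^q$ can be written on $\mathbb D^n$ as $f=\sum_{j\in\mathbb N}g_jh_j$ with $g_j,h_j\in H^{2q}$ and $$\sum_{j\in\mathbb N}\|g_j\|_{2q}\,\|h_j\|_{2q}\le C\,\|f\|_q .$$ Let $0<\theta<1$ and let $p$ be given by $\frac1p=1-\frac\theta2$. Then Calderón's complex interpolation method gives $$(H^1,H^2)_\theta=H^p\qquad\text{with equivalent norms.}$$ Here $(H^1,H^2)_\theta$ is the space of all $F(\theta)$, where $F$ is a bounded continuous function on $\{0\le \operatorname{Re}z\le1\}$ with values in $H^1+H^2$,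 holomorphic in the open strip, such that $y\mapsto F(iy)$ and $y\mapsto F(1+iy)$ are continuous functions from $\mathbb R$ to $H^1$ and to $H^2$ respectively that tend to $0$ at infinity; the norm of $f\in (H^1,H^2)_\theta$ is the infimum of $\max\big(\sup_y\|F(iy)\|_1,\ \sup_y\|F(1+iy)\|_2\big)$ over all such $F$ with $F(\theta)=f$. -/

import Mathlib

open Set MeasureTheory
open scoped ENNReal NNReal ZeroAtInfty

noncomputable section

/-! ## The complex interpolation method -/

section ComplexMethod

variable {V X₀ X₁ : Type*} [AddCommGroup V] [Module ℂ V]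
  [NormedAddCommGroup X₀] [NormedSpace ℂ X₀] [NormedAddCommGroup X₁] [NormedSpace ℂ X₁]

/-- The map `(x₀, x₁) ↦ j₀ x₀ + j₁ x₁` attached to a couple of normed spaces that are mapped
(in the applications: embedded) linearly into a common vector space `V`. -/
def coupleSum (j₀ : X₀ →ₗ[ℂ] V) (j₁ : X₁ →ₗ[ℂ] V) : WithLp 1 (X₀ × X₁) →ₗ[ℂ] V :=
  (j₀.coprod j₁) ∘ₗ (WithLp.linearEquiv 1 ℂ (X₀ × X₁)).toLinearMap

/-- The sum space `X₀ + X₁` of the couple, as the quotient of the direct sum (with the norm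
`‖x₀‖ + ‖x₁‖`) by the kernel of `(x₀, x₁) ↦ j₀ x₀ + j₁ x₁`.
The quotient norm is `‖v‖ = inf {‖x₀‖ + ‖x₁‖ : v = j₀ x₀ + j₁ x₁}`. -/
abbrev SumSpace (j₀ : X₀ →ₗ[ℂ] V) (j₁ : X₁ →ₗ[ℂ] V) : Type _ :=
  WithLp 1 (X₀ × X₁) ⧸ LinearMap.ker (coupleSum j₀ j₁)

/-- The embedding of the sum space `X₀ + X₁` into `V`. -/
def SumSpace.val (j₀ : X₀ →ₗ[ℂ] V) (j₁ : X₁ →ₗ[ℂ] V) : SumSpace j₀ j₁ →ₗ[ℂ] V :=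
  (LinearMap.ker (coupleSum j₀ j₁)).liftQ (coupleSum j₀ j₁) le_rfl

/-- Calderón's space `𝓕(X₀, X₁)`: functions `F` with values in `X₀ + X₁`, bounded and continuous on
the closed strip `0 ≤ Re z ≤ 1`, holomorphic in the open strip, such that `y ↦ F (i y)` is a
continuous function to `X₀` and `y ↦ F (1 + i y)` a continuous function to `X₁`, both tending to
zero at infinity. -/
structure CalderonFunction (j₀ : X₀ →ₗ[ℂ] V) (j₁ : X₁ →ₗ[ℂ] V) where
  /-- The function on the strip (its values outside the closed strip are irrelevant). -/
  toFun : ℂ → SumSpace j₀ j₁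
  /-- The boundary function on `Re z = 0`. -/
  left : C₀(ℝ, X₀)
  /-- The boundary function on `Re z = 1`. -/
  right : C₀(ℝ, X₁)
  continuousOn : ContinuousOn toFun {z : ℂ | 0 ≤ z.re ∧ z.re ≤ 1}
  bounded : ∃ M : ℝ, ∀ z : ℂ, 0 ≤ z.re → z.re ≤ 1 → ‖toFun z‖ ≤ M
  holomorphic : DifferentiableOn ℂ toFun {z : ℂ | 0 < z.re ∧ z.re < 1}
  left_eq : ∀ y : ℝ, SumSpace.val j₀ j₁ (toFun (y * Complex.I)) = j₀ (left y)
  right_eq : ∀ y : ℝ, SumSpace.val j₀ j₁ (toFun (1 + y * Complex.I)) = j₁ (right y)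

/-- The norm of `𝓕(X₀, X₁)`: `max (sup_y ‖F (i y)‖_{X₀}) (sup_y ‖F (1 + i y)‖_{X₁})`. -/
def CalderonFunction.norm {j₀ : X₀ →ₗ[ℂ] V} {j₁ : X₁ →ₗ[ℂ] V} (F : CalderonFunction j₀ j₁) : ℝ≥0∞ :=
  max ‖F.left‖ₑ ‖F.right‖ₑ

/-- The complex interpolation space `(X₀, X₁)_θ = {F θ : F ∈ 𝓕(X₀, X₁)}`, as a subset of `V`. -/
def complexInterp (j₀ : X₀ →ₗ[ℂ] V) (j₁ : X₁ →ₗ[ℂ] V) (θ : ℝ) : Set V :=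
  {v | ∃ F : CalderonFunction j₀ j₁, SumSpace.val j₀ j₁ (F.toFun θ) = v}

/-- The norm of `(X₀, X₁)_θ`: the infimum of the norms of the `F ∈ 𝓕(X₀, X₁)` with `F θ = v`
(and `∞` if there is none). -/
def complexInterpNorm (j₀ : X₀ →ₗ[ℂ] V) (j₁ : X₁ →ₗ[ℂ] V) (θ : ℝ) (v : V) : ℝ≥0∞ :=
  ⨅ (F : CalderonFunction j₀ j₁) (_ : SumSpace.val j₀ j₁ (F.toFun θ) = v), F.norm

end ComplexMethod

/-! ## Hardy spaces of the polydisc -/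

/-- The unit polydisc of `ℂⁿ`. -/
def polydisc (n : ℕ) : Set (Fin n → ℂ) := {z | ∀ i, ‖z i‖ < 1}

/-- The normalised Lebesgue (Haar) measure of the torus `(ℝ/ℤ)ⁿ`. -/
def torusMeasure (n : ℕ) : Measure (UnitAddTorus (Fin n)) :=
  Measure.pi fun _ => AddCircle.haarAddCircle

/-- The point `r e^{2 π i t}` of the torus of radius `r`. -/
def torusPoint {n : ℕ} (r : ℝ) (t : UnitAddTorus (Fin n)) : Fin n → ℂ :=
  fun i => (r : ℂ) * (AddCircle.toCircle (t i) : ℂ)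

/-- `sup_{0 ≤ r < 1} (∫ |f(r e^{iθ})|^p dθ)^{1/p}`, with the sup norm for `p = ∞`. -/
def hardyNorm (n : ℕ) (p : ℝ≥0∞) (f : (Fin n → ℂ) → ℂ) : ℝ≥0∞ :=
  ⨆ r ∈ Ico (0 : ℝ) 1, eLpNorm (fun t => f (torusPoint r t)) p (torusMeasure n)

/-- Holomorphic functions on the polydisc. A function on the polydisc is represented by its
extension by zero to `ℂⁿ`, so that two such functions are equal iff they agree on the polydisc. -/
def IsHolomorphicOnPolydisc (n : ℕ) (f : (Fin n → ℂ) → ℂ) : Prop :=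
  DifferentiableOn ℂ f (polydisc n) ∧ ∀ z ∉ polydisc n, f z = 0

lemma isOpen_polydisc (n : ℕ) : IsOpen (polydisc n) := by
  simp only [polydisc, Set.ofPred_forall]
  exact isOpen_iInter_of_finite fun i => isOpen_lt (by fun_prop) continuous_const

lemma torusPoint_mem {n : ℕ} {r : ℝ} (hr : r ∈ Ico (0 : ℝ) 1) (t : UnitAddTorus (Fin n)) :
    torusPoint r t ∈ polydisc n := by
  intro i
  have h : ‖(AddCircle.toCircle (t i) : ℂ)‖ = 1 := Circle.norm_coe _
  simpa [torusPoint, abs_of_nonneg hr.1, h] using hr.2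

lemma continuous_torusPoint {n : ℕ} (r : ℝ) :
    Continuous (torusPoint r : UnitAddTorus (Fin n) → Fin n → ℂ) := by
  refine continuous_pi fun i => continuous_const.mul ?_
  exact continuous_subtype_val.comp (AddCircle.continuous_toCircle.comp (continuous_apply i))

lemma IsHolomorphicOnPolydisc.continuous_slice {n : ℕ} {f : (Fin n → ℂ) → ℂ}
    (hf : IsHolomorphicOnPolydisc n f) {r : ℝ} (hr : r ∈ Ico (0 : ℝ) 1) :
    Continuous fun t : UnitAddTorus (Fin n) => f (torusPoint r t) :=
  hf.1.continuousOn.comp_continuous (continuous_torusPoint r) (torusPoint_mem hr)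

lemma IsHolomorphicOnPolydisc.add {n : ℕ} {f g : (Fin n → ℂ) → ℂ}
    (hf : IsHolomorphicOnPolydisc n f) (hg : IsHolomorphicOnPolydisc n g) :
    IsHolomorphicOnPolydisc n (f + g) :=
  ⟨hf.1.add hg.1, fun z hz => by simp [hf.2 z hz, hg.2 z hz]⟩

lemma hardyNorm_const_smul (n : ℕ) (p : ℝ≥0∞) (c : ℂ) (f : (Fin n → ℂ) → ℂ) :
    hardyNorm n p (c • f) = ‖c‖ₑ * hardyNorm n p f := by
  simp only [hardyNorm, ENNReal.mul_iSup]
  refine iSup_congr fun r => iSup_congr fun _ => ?_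
  exact eLpNorm_const_smul c (fun t => f (torusPoint r t)) p (torusMeasure n)

lemma hardyNorm_add_le' {n : ℕ} (p : ℝ≥0∞) {f g : (Fin n → ℂ) → ℂ}
    (hf : IsHolomorphicOnPolydisc n f) (hg : IsHolomorphicOnPolydisc n g) :
    hardyNorm n p (f + g) ≤ ENNReal.LpAddConst p * (hardyNorm n p f + hardyNorm n p g) := by
  refine iSup₂_le fun r hr => ?_
  refine (eLpNorm_add_le' (hf.continuous_slice hr).aestronglyMeasurable
    (hg.continuous_slice hr).aestronglyMeasurable p).trans ?_
  refine mul_le_mul_right (add_le_add ?_ ?_) _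
  · exact le_iSup₂ (f := fun r (_ : r ∈ Ico (0 : ℝ) 1) =>
      eLpNorm (fun t => f (torusPoint r t)) p (torusMeasure n)) r hr
  · exact le_iSup₂ (f := fun r (_ : r ∈ Ico (0 : ℝ) 1) =>
      eLpNorm (fun t => g (torusPoint r t)) p (torusMeasure n)) r hr

lemma hardyNorm_add_le {n : ℕ} {p : ℝ≥0∞} (hp : 1 ≤ p) {f g : (Fin n → ℂ) → ℂ}
    (hf : IsHolomorphicOnPolydisc n f) (hg : IsHolomorphicOnPolydisc n g) :
    hardyNorm n p (f + g) ≤ hardyNorm n p f + hardyNorm n p g := by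
  simpa [ENNReal.LpAddConst_of_one_le hp] using hardyNorm_add_le' p hf hg

/-- The Hardy space `H^p(𝔻ⁿ)`, as a linear space of functions. -/
def hardySpace (n : ℕ) (p : ℝ≥0∞) : Submodule ℂ ((Fin n → ℂ) → ℂ) where
  carrier := {f | IsHolomorphicOnPolydisc n f ∧ hardyNorm n p f < ∞}
  zero_mem' := by
    refine ⟨⟨differentiableOn_const 0, fun _ _ => rfl⟩, ?_⟩
    simp [hardyNorm]
  add_mem' {f g} hf hg :=
    ⟨hf.1.add hg.1, (hardyNorm_add_le' p hf.1 hg.1).trans_lt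
      (ENNReal.mul_lt_top (ENNReal.LpAddConst_lt_top p) (ENNReal.add_lt_top.2 ⟨hf.2, hg.2⟩))⟩
  smul_mem' c f hf := by
    refine ⟨⟨hf.1.1.const_smul c, fun z hz => by simp [hf.1.2 z hz]⟩, ?_⟩
    rw [hardyNorm_const_smul]
    exact ENNReal.mul_lt_top (by simp) hf.2

lemma IsHolomorphicOnPolydisc.eq_zero_of_torus {n : ℕ} {f : (Fin n → ℂ) → ℂ}
    (hf : IsHolomorphicOnPolydisc n f) {r : ℝ} (hr0 : 0 < r) (hr1 : r < 1)
    (h : ∀ w : Fin n → ℂ, (∀ i, ‖w i‖ = r) → f w = 0) (s : Finset (Fin n)) :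
    ∀ w : Fin n → ℂ, (∀ i, ‖w i‖ ≤ r) → (∀ i ∉ s, ‖w i‖ = r) → f w = 0 := by
  induction s using Finset.induction_on with
  | empty => exact fun w _ hw => h w fun i => hw i (by simp)
  | insert a s ha ih =>
    intro w hw1 hw2
    have hmaps : ∀ ζ ∈ Metric.closedBall (0 : ℂ) r, Function.update w a ζ ∈ polydisc n := by
      intro ζ hζ i
      by_cases hi : i = a
      · subst hi
        simpa using (mem_closedBall_zero_iff.1 hζ).trans_lt hr1
      · simpa [hi] using (hw1 i).trans_lt hr1
    have hupd : Differentiable ℂ fun ζ : ℂ => Function.update w a ζ := by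
      refine differentiable_pi.2 fun i => ?_
      by_cases hi : i = a
      · subst hi
        simp
      · simp [hi]
    have hd : DifferentiableOn ℂ (fun ζ => f (Function.update w a ζ)) (Metric.closedBall 0 r) :=
      hf.1.comp hupd.differentiableOn hmaps
    have hdc : DiffContOnCl ℂ (fun ζ => f (Function.update w a ζ)) (Metric.ball 0 r) :=
      DifferentiableOn.diffContOnCl (hd.mono Metric.closure_ball_subset_closedBall)
    have hfr : ∀ ζ ∈ frontier (Metric.ball (0 : ℂ) r), ‖f (Function.update w a ζ)‖ ≤ 0 := by
      intro ζ hζ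
      rw [frontier_ball _ hr0.ne', mem_sphere_zero_iff_norm] at hζ
      rw [ih, norm_zero]
      · intro i
        by_cases hi : i = a
        · subst hi
          simp [hζ]
        · simpa [hi] using hw1 i
      · intro i his
        by_cases hi : i = a
        · subst hi
          simp [hζ]
        · simpa [hi] using hw2 i (by simp [hi, his])
    have hz := Complex.norm_le_of_forall_mem_frontier_norm_le Metric.isBounded_ball hdc hfr
      (z := w a) (by rw [closure_ball _ hr0.ne']; simpa using hw1 a)
    simpa using hz

lemma IsHolomorphicOnPolydisc.eq_zero_of_hardyNorm {n : ℕ} {p : ℝ≥0∞} (hp : p ≠ 0)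
    {f : (Fin n → ℂ) → ℂ} (hf : IsHolomorphicOnPolydisc n f) (h : hardyNorm n p f = 0) :
    f = 0 := by
  have key : ∀ r ∈ Ioo (0 : ℝ) 1, ∀ w : Fin n → ℂ, (∀ i, ‖w i‖ = r) → f w = 0 := by
    intro r hr w hw
    have hr' : r ∈ Ico (0 : ℝ) 1 := ⟨hr.1.le, hr.2⟩
    have h0 : eLpNorm (fun t => f (torusPoint r t)) p (torusMeasure n) = 0 := by
      simp only [hardyNorm, ENNReal.iSup_eq_zero] at h
      exact h r hr'
    have hc := hf.continuous_slice hr'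
    rw [eLpNorm_eq_zero_iff hc.aestronglyMeasurable hp] at h0
    have : Measure.IsOpenPosMeasure (torusMeasure n) := by
      unfold torusMeasure
      infer_instance
    have h1 := (hc.ae_eq_iff_eq (torusMeasure n) (g := 0) continuous_zero).1 h0
    have hex : ∀ i, ∃ t : UnitAddCircle, (r : ℂ) * (AddCircle.toCircle t : ℂ) = w i := by
      intro i
      have hmem : ‖w i / r‖ = 1 := by
        rw [norm_div, hw i, Complex.norm_real, Real.norm_of_nonneg hr.1.le, div_self hr.1.ne']
      obtain ⟨t, ht⟩ := (AddCircle.homeomorphCircle (one_ne_zero : (1 : ℝ) ≠ 0)).surjective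
        ⟨w i / r, by simpa [Submonoid.unitSphere] using hmem⟩
      refine ⟨t, ?_⟩
      rw [AddCircle.homeomorphCircle_apply] at ht
      rw [ht]
      have : (r : ℂ) ≠ 0 := by exact_mod_cast hr.1.ne'
      field_simp
    choose t ht using hex
    have := congrFun h1 t
    have hwt : torusPoint r t = w := funext ht
    simpa [hwt] using this
  funext z
  by_cases hz : z ∈ polydisc n
  · obtain ⟨r, hr, hzr⟩ : ∃ r ∈ Ioo (0 : ℝ) 1, ∀ i, ‖z i‖ ≤ r := by
      have hz1 : ‖z‖ < 1 := (pi_norm_lt_iff one_pos).2 hz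
      obtain ⟨r, h1, h2⟩ := exists_between hz1
      exact ⟨r, ⟨(norm_nonneg z).trans_lt h1, h2⟩, fun i => (norm_le_pi_norm z i).trans h1.le⟩
    exact hf.eq_zero_of_torus hr.1 hr.2 (key r hr) Finset.univ z hzr (by simp)
  · exact hf.2 z hz

/-- The normed space `H^p(𝔻ⁿ)`, `1 ≤ p ≤ ∞`: a copy of the type of elements of `hardySpace n p`
that carries the Hardy norm (and not the topology of pointwise convergence). -/
def HardyType (n : ℕ) (p : ℝ≥0∞) : Type := ↥(hardySpace n p)

instance (n : ℕ) (p : ℝ≥0∞) : AddCommGroup (HardyType n p) :=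
  inferInstanceAs (AddCommGroup ↥(hardySpace n p))

instance (n : ℕ) (p : ℝ≥0∞) : Module ℂ (HardyType n p) :=
  inferInstanceAs (Module ℂ ↥(hardySpace n p))

/-- The inclusion of `H^p(𝔻ⁿ)` into the space of functions. -/
def hardyIncl (n : ℕ) (p : ℝ≥0∞) : HardyType n p →ₗ[ℂ] ((Fin n → ℂ) → ℂ) :=
  (hardySpace n p).subtype

instance (n : ℕ) (p : ℝ≥0∞) : Norm (HardyType n p) :=
  ⟨fun f => (hardyNorm n p (hardyIncl n p f)).toReal⟩

lemma hardyType_core (n : ℕ) (p : ℝ≥0∞) [hp : Fact (1 ≤ p)] :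
    NormedSpace.Core ℂ (HardyType n p) where
  norm_nonneg _ := ENNReal.toReal_nonneg
  norm_smul c f := by
    change (hardyNorm n p (c • hardyIncl n p f)).toReal = _
    rw [hardyNorm_const_smul, ENNReal.toReal_mul, toReal_enorm]
    rfl
  norm_triangle f g := by
    change (hardyNorm n p (hardyIncl n p f + hardyIncl n p g)).toReal ≤ _
    refine (ENNReal.toReal_mono (ENNReal.add_ne_top.2 ⟨f.2.2.ne, g.2.2.ne⟩)
      (hardyNorm_add_le hp.out f.2.1 g.2.1)).trans ?_
    exact ENNReal.toReal_add_le
  norm_eq_zero_iff f := by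
    constructor
    · intro h
      have h0 : hardyNorm n p (hardyIncl n p f) = 0 :=
        ((ENNReal.toReal_eq_zero_iff _).1 h).resolve_right f.2.2.ne
      exact Subtype.ext
        (f.2.1.eq_zero_of_hardyNorm (zero_lt_one.trans_le hp.out).ne' h0)
    · rintro rfl
      change (hardyNorm n p 0).toReal = 0
      simp [hardyNorm]

instance (n : ℕ) (p : ℝ≥0∞) [Fact (1 ≤ p)] : NormedAddCommGroup (HardyType n p) :=
  NormedAddCommGroup.ofCore (hardyType_core n p)

instance (n : ℕ) (p : ℝ≥0∞) [Fact (1 ≤ p)] : NormedSpace ℂ (HardyType n p) :=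
  NormedSpace.ofCore (hardyType_core n p)

/-- `H^p(𝔻ⁿ)` has the extended weak factorisation property with constant `C`: each `f ∈ H^p` is a
sum `∑ g_j h_j` with `g_j, h_j ∈ H^{2p}` and `∑ ‖g_j‖_{2p} ‖h_j‖_{2p} ≤ C ‖f‖_p`. -/
def HasEWF (n : ℕ) (p : ℝ) (C : ℝ≥0) : Prop :=
  ∀ f ∈ hardySpace n (ENNReal.ofReal p), ∃ g h : ℕ → (Fin n → ℂ) → ℂ,
    (∀ j, g j ∈ hardySpace n (ENNReal.ofReal (2 * p))) ∧
    (∀ j, h j ∈ hardySpace n (ENNReal.ofReal (2 * p))) ∧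
    (∀ z ∈ polydisc n, HasSum (fun j => g j z * h j z) (f z)) ∧
    ∑' j, hardyNorm n (ENNReal.ofReal (2 * p)) (g j) * hardyNorm n (ENNReal.ofReal (2 * p)) (h j)
      ≤ C * hardyNorm n (ENNReal.ofReal p) f

end

noncomputable section

/-! The inclusion of $(H^1,H^2)_\theta$ in $H^p$ needs no factorisation. Restriction to the torus of
radius $r<1$ turns a Calderón function into a bounded analytic function on the strip with values in
$C(\mathbb T^n)$, bounded in $L^1$ on the left edge and in $L^2$ on the right edge. Testing it
against an analytic family of powers and applying the three lines theorem bounds the $L^p$ norm of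
the slice at $\theta$ by the Calderón norm, with constant one and uniformly in $r$
(`integral_rpow_le_of_strip`, `CalderonFunction.hardyNorm_le`).

The converse cannot be had by projecting the interpolation of $L^1$ and $L^2$, because for $n\ge1$
the Szegő projection $P$ is unbounded on $L^1$. Weak factorisation doubles the exponents: $f=\sum
g_jh_j$ with factors in $H^{2p}$, where $2p$ lies between $2$ and $4$, and $P$ is bounded at both of
these endpoints. A function in $H^{2p}$ is $P\varphi$ with $\varphi\in L^{2p}$ of no larger norm
(`exists_eq_szegoProj`). A simple function $\psi$ in the unit ball of $L^{2p}$ lies on the family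
$\psi_z=\frac{\psi}{|\psi|}|\psi|^{p(1-z/2)}$, with $\psi_\theta=\psi$, $|\psi_z|^2=|\psi|^{2p}$ for
$\operatorname{Re}z=0$ and $|\psi_z|^4=|\psi|^{2p}$ for $\operatorname{Re}z=1$. By Hölder,
$e^{z^2-\theta^2}\,P\psi_z\,P\chi_z$ is bounded in $H^1$ on the left edge and in $H^2$ on the right
edge, and its value at $\theta$ is $P\psi\,P\chi$ (`exists_hasRep_szegoProj_mul_of_le_one`). Such
representations may be summed when their bounds are summable (`HasRep.of_hasSum`). This passes first
from simple functions to $L^{2p}$, by geometric series, and then from products to $f$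
(`exists_hasRep_of_hasEWF`).

The boundedness of $P$ on $L^2$ and $L^4$ is M. Riesz's argument for even exponents in one variable
(`exists_integral_herglotz_pow_le`), iterated over the coordinates by Fubini
(`exists_integral_partialSzego_pow_le`). -/

instance (n : ℕ) : IsProbabilityMeasure (torusMeasure n) := by
  unfold torusMeasure; infer_instance

/-! ## Integrals over the circle -/

lemma integral_haarAddCircle_eq_circleAverage (f : ℂ → ℂ) (r : ℝ) :
    ∫ s, f (r * (AddCircle.toCircle s : ℂ)) ∂(AddCircle.haarAddCircle (T := 1))
      = Real.circleAverage f 0 r := by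
  -- The zeroth Fourier coefficient is the Haar integral; its interval formula unrolls the circle to
  -- $[0,1]$.
  have h := fourierCoeff_eq_intervalIntegral (T := (1 : ℝ))
    (fun s : AddCircle (1 : ℝ) => f (r * (AddCircle.toCircle s : ℂ))) 0 0
  simp only [fourierCoeff, neg_zero, fourier_zero, one_smul, div_one, zero_add] at h
  rw [h, Real.circleAverage_def]
  have h2 := intervalIntegral.smul_integral_comp_mul_left (a := 0) (b := 1)
    (fun θ : ℝ => f (circleMap 0 r θ)) (2 * Real.pi)
  rw [mul_zero, mul_one] at h2
  rw [← h2, smul_smul, inv_mul_cancel₀ (by positivity), one_smul]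
  refine intervalIntegral.integral_congr fun x _ => ?_
  simp only [circleMap, zero_add, AddCircle.toCircle_apply_mk, Circle.coe_exp]
  norm_num

lemma diffContOnCl_ball {F : ℂ → ℂ} (hF : DifferentiableOn ℂ F (Metric.ball 0 1)) {r : ℝ}
    (hr0 : 0 ≤ r) (hr : r < 1) : DiffContOnCl ℂ F (Metric.ball 0 |r|) := by
  refine DifferentiableOn.diffContOnCl (hF.mono ?_)
  refine Metric.closure_ball_subset_closedBall.trans (Metric.closedBall_subset_ball ?_)
  rwa [abs_of_nonneg hr0]

lemma toCircle_neg_coe (s : UnitAddCircle) :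
    (AddCircle.toCircle (-s) : ℂ) = (AddCircle.toCircle s : ℂ)⁻¹ := by
  rw [AddCircle.toCircle_neg, Circle.coe_inv]

/-- Cauchy's integral formula on a circle around the origin. -/
lemma integral_circle_mul_cauchyKernel {F : ℂ → ℂ} (hF : DifferentiableOn ℂ F (Metric.ball 0 1))
    {r : ℝ} (hr0 : 0 < r) (hr : r < 1) {w : ℂ} (hw : ‖w‖ < 1) :
    ∫ s, F (r * (AddCircle.toCircle s : ℂ)) * (1 - w * (AddCircle.toCircle (-s) : ℂ))⁻¹
      ∂(AddCircle.haarAddCircle (T := 1)) = F (r * w) := by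
  have hw' : (r * w : ℂ) ∈ Metric.ball (0 : ℂ) |r| := by
    simp only [mem_ball_zero_iff, norm_mul, Complex.norm_real, Real.norm_eq_abs]
    exact mul_lt_of_lt_one_right (abs_pos.2 hr0.ne') hw
  have h := (diffContOnCl_ball hF hr0.le hr).circleAverage_smul_div hw'
  rw [← integral_haarAddCircle_eq_circleAverage] at h
  rw [← h]
  refine integral_congr_ae (Filter.Eventually.of_forall fun s => ?_)
  have hr' : (r : ℂ) ≠ 0 := by exact_mod_cast hr0.ne'
  have he : (AddCircle.toCircle s : ℂ) ≠ 0 := Circle.coe_ne_zero _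
  have hne : (AddCircle.toCircle s : ℂ) - w ≠ 0 := by
    intro h0
    have := Circle.norm_coe (AddCircle.toCircle s)
    rw [sub_eq_zero.1 h0] at this
    exact hw.ne this
  simp only [toCircle_neg_coe, sub_zero, smul_eq_mul]
  rw [← mul_sub, mul_div_mul_left _ _ hr', mul_comm, ← div_eq_mul_inv]
  field_simp

/-- The mean value property on a circle around the origin. -/
lemma integral_circle_eq_center {F : ℂ → ℂ} (hF : DifferentiableOn ℂ F (Metric.ball 0 1))
    {r : ℝ} (hr0 : 0 ≤ r) (hr : r < 1) :
    ∫ s, F (r * (AddCircle.toCircle s : ℂ)) ∂(AddCircle.haarAddCircle (T := 1)) = F 0 := by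
  rw [integral_haarAddCircle_eq_circleAverage, (diffContOnCl_ball hF hr0 hr).circleAverage]

/-! ## Integrating one coordinate of the torus at a time -/

/-- A product of probability measures does not change when one coordinate is resampled
independently. This gives Fubini in a single coordinate without splitting the index set. -/
lemma measurePreserving_update (n : ℕ) (a : Fin n) :
    MeasurePreserving (fun q : UnitAddTorus (Fin n) × UnitAddCircle => Function.update q.1 a q.2)
      ((torusMeasure n).prod AddCircle.haarAddCircle) (torusMeasure n) := by
  have hmeas : Measurable
      (fun q : UnitAddTorus (Fin n) × UnitAddCircle => Function.update q.1 a q.2) := by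
    refine measurable_pi_iff.2 fun i => ?_
    by_cases hi : i = a
    · subst hi
      simpa using measurable_snd
    · simp only [Function.update_of_ne hi]
      exact (measurable_pi_apply i).comp measurable_fst
  refine ⟨hmeas, ?_⟩
  unfold torusMeasure
  symm
  refine Measure.pi_eq fun S hS => ?_
  rw [Measure.map_apply hmeas (MeasurableSet.univ_pi hS)]
  have hpre : (fun q : UnitAddTorus (Fin n) × UnitAddCircle => Function.update q.1 a q.2) ⁻¹'
      (univ.pi S) = (univ.pi (Function.update S a univ)) ×ˢ (S a) := by
    ext ⟨t, s⟩
    simp only [mem_preimage, mem_pi, mem_univ, true_implies, mem_prod]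
    constructor
    · intro h
      refine ⟨fun i => ?_, by simpa using h a⟩
      by_cases hi : i = a
      · subst hi; simp
      · simpa [hi] using h i
    · rintro ⟨h1, h2⟩ i
      by_cases hi : i = a
      · subst hi; simpa using h2
      · simpa [hi] using h1 i
  rw [hpre, Measure.prod_prod, Measure.pi_pi, ← Finset.prod_erase_mul _ _ (Finset.mem_univ a),
    ← Finset.prod_erase_mul (a := a) _ (fun i => AddCircle.haarAddCircle (S i)) (Finset.mem_univ a)]
  simp only [Function.update_self, measure_univ, mul_one]
  congr 1
  refine Finset.prod_congr rfl fun i hi => ?_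
  rw [Function.update_of_ne (Finset.ne_of_mem_erase hi)]

lemma integral_torus_eq_integral_update {n : ℕ} {E : Type*} [NormedAddCommGroup E]
    [NormedSpace ℝ E] (a : Fin n) {Φ : UnitAddTorus (Fin n) → E}
    (hΦ : Integrable Φ (torusMeasure n)) :
    ∫ t, Φ t ∂(torusMeasure n)
      = ∫ t, ∫ s, Φ (Function.update t a s) ∂(AddCircle.haarAddCircle (T := 1))
          ∂(torusMeasure n) := by
  have hmp := measurePreserving_update n a
  have hi : Integrable (fun q : UnitAddTorus (Fin n) × UnitAddCircle =>
      Φ (Function.update q.1 a q.2)) ((torusMeasure n).prod AddCircle.haarAddCircle) :=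
    hmp.integrable_comp_of_integrable hΦ
  rw [← integral_prod _ hi]
  have := integral_map (μ := (torusMeasure n).prod AddCircle.haarAddCircle)
    hmp.measurable.aemeasurable (f := Φ) (by rw [hmp.map_eq]; exact hΦ.aestronglyMeasurable)
  rw [hmp.map_eq] at this
  exact this

lemma ContinuousMap.integrable_of_compact {X : Type*} [TopologicalSpace X] [CompactSpace X]
    [MeasurableSpace X] [BorelSpace X] (μ : Measure X) [IsFiniteMeasure μ] {f : X → ℂ}
    (hf : Continuous f) : Integrable f μ :=
  hf.integrable_of_hasCompactSupport (HasCompactSupport.of_compactSpace f)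

/-! ## The Szegő kernel and Cauchy's formula on the polydisc -/

lemma one_sub_mul_toCircle_ne_zero {w : ℂ} (hw : ‖w‖ < 1) (s : UnitAddCircle) :
    1 - w * (AddCircle.toCircle s : ℂ) ≠ 0 := by
  intro h
  have h1 : ‖w * (AddCircle.toCircle s : ℂ)‖ = 1 := by rw [← sub_eq_zero.1 h, norm_one]
  rw [norm_mul, Circle.norm_coe, mul_one] at h1
  exact hw.ne h1

lemma continuous_toCircle_coe : Continuous fun s : UnitAddCircle => (AddCircle.toCircle s : ℂ) :=
  continuous_subtype_val.comp AddCircle.continuous_toCircle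

/-- The function `t ↦ e^{-2 π i t_i}` on the torus. -/
def conjCoord {n : ℕ} (i : Fin n) : C(UnitAddTorus (Fin n), ℂ) :=
  ⟨fun t => (AddCircle.toCircle (-(t i)) : ℂ),
    continuous_toCircle_coe.comp (continuous_apply i).neg⟩

lemma norm_conjCoord_le {n : ℕ} (i : Fin n) : ‖conjCoord i‖ ≤ 1 :=
  (ContinuousMap.norm_le _ zero_le_one).2 fun _ => (Circle.norm_coe _).le

/-- The Szegő kernel `∏ i, (1 - w_i e^{-2 π i t_i})⁻¹`, as a continuous function of `t`. -/
def szegoKernel (n : ℕ) (w : Fin n → ℂ) : C(UnitAddTorus (Fin n), ℂ) :=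
  ∏ i, Ring.inverse (1 - w i • conjCoord i)

lemma isUnit_one_sub_smul_conjCoord {n : ℕ} (i : Fin n) {w : ℂ} (hw : ‖w‖ < 1) :
    IsUnit (1 - w • conjCoord i) := by
  refine isUnit_one_sub_of_norm_lt_one ?_
  rw [norm_smul]
  exact (mul_le_of_le_one_right (norm_nonneg _) (norm_conjCoord_le i)).trans_lt hw

lemma ContinuousMap.ringInverse_apply {X : Type*} [TopologicalSpace X] {f : C(X, ℂ)}
    (hf : IsUnit f) (x : X) : Ring.inverse f x = (f x)⁻¹ := by
  have h : Ring.inverse f x * f x = 1 := by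
    rw [← ContinuousMap.mul_apply, Ring.inverse_mul_cancel f hf, ContinuousMap.one_apply]
  exact eq_inv_of_mul_eq_one_left h

lemma szegoKernel_apply {n : ℕ} {w : Fin n → ℂ} (hw : w ∈ polydisc n) (t : UnitAddTorus (Fin n)) :
    szegoKernel n w t = ∏ i, (1 - w i * (AddCircle.toCircle (-(t i)) : ℂ))⁻¹ := by
  simp only [szegoKernel, ContinuousMap.prod_apply]
  refine Finset.prod_congr rfl fun i _ => ?_
  rw [ContinuousMap.ringInverse_apply (isUnit_one_sub_smul_conjCoord i (hw i))]
  rfl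

/-- Inversion is holomorphic on the units of the Banach algebra $C(\mathbb T^n)$, so the kernel
depends holomorphically on $w$ in the sup norm. Every continuous functional of it is then
holomorphic in $w$, and differentiation under the integral sign is avoided. -/
lemma differentiableOn_szegoKernel (n : ℕ) : DifferentiableOn ℂ (szegoKernel n) (polydisc n) := by
  unfold szegoKernel
  intro w hw
  refine (HasFDerivWithinAt.finsetProd fun i _ =>
    DifferentiableWithinAt.hasFDerivWithinAt ?_).differentiableWithinAt
  refine DifferentiableWithinAt.inverse ?_ (isUnit_one_sub_smul_conjCoord i (hw i))
  exact (differentiableWithinAt_const _).sub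
    ((differentiableAt_apply i w).differentiableWithinAt.smul_const _)

/-- Cauchy's integral formula on the polydisc, for the coordinates in `s`. -/
lemma integral_mul_prod_cauchyKernel {n : ℕ} {f : (Fin n → ℂ) → ℂ}
    (hf : DifferentiableOn ℂ f (polydisc n)) {r : ℝ} (hr0 : 0 < r) (hr1 : r < 1) {w : Fin n → ℂ}
    (hw : w ∈ polydisc n) (s : Finset (Fin n)) :
    ∫ t : UnitAddTorus (Fin n),
      f (fun i => (r : ℂ) * if i ∈ s then (AddCircle.toCircle (t i) : ℂ) else w i) *
        ∏ i ∈ s, (1 - w i * (AddCircle.toCircle (-(t i)) : ℂ))⁻¹ ∂(torusMeasure n)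
      = f (fun i => r * w i) := by
  have hle : ∀ (s : Finset (Fin n)) (t : UnitAddTorus (Fin n)) (i : Fin n),
      ‖if i ∈ s then (AddCircle.toCircle (t i) : ℂ) else w i‖ ≤ 1 := by
    intro s t i
    split_ifs
    · exact (Circle.norm_coe _).le
    · exact (hw i).le
  have hmem : ∀ (z : ℂ), ‖z‖ ≤ 1 → ‖(r : ℂ) * z‖ < 1 := by
    intro z hz
    rw [norm_mul, Complex.norm_real, Real.norm_of_nonneg hr0.le]
    exact (mul_le_of_le_one_right hr0.le hz).trans_lt hr1
  induction s using Finset.induction_on with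
  | empty => simp
  | insert a s ha ih =>
    -- Cauchy's formula in the variable $t_a$ freezes that coordinate at $r w_a$; the kernel factors
    -- from `s` do not involve it.
    rw [integral_torus_eq_integral_update a, ← ih]
    · refine integral_congr_ae (Filter.Eventually.of_forall fun t => ?_)
      set v : Fin n → ℂ := fun i => (r : ℂ) * if i ∈ s then (AddCircle.toCircle (t i) : ℂ) else w i
        with hv
      have hF : DifferentiableOn ℂ (fun ζ => f (Function.update v a ζ)) (Metric.ball 0 1) := by
        have hupd : Differentiable ℂ fun ζ : ℂ => Function.update v a ζ := by
          refine differentiable_pi.2 fun i => ?_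
          by_cases hi : i = a
          · subst hi; simp
          · simp [hi]
        refine hf.comp hupd.differentiableOn fun ζ hζ i => ?_
        by_cases hi : i = a
        · subst hi; simpa using hζ
        · simpa [hi, hv] using hmem _ (hle s t i)
      have hc := integral_circle_mul_cauchyKernel hF hr0 hr1 (hw a)
      have hva : Function.update v a (r * w a) = v := by
        rw [Function.update_eq_self_iff]
        simp [hv, ha]
      simp only [hva] at hc
      refine Eq.trans ?_ (congrArg
        (· * ∏ i ∈ s, (1 - w i * (AddCircle.toCircle (-(t i)) : ℂ))⁻¹) hc)
      refine Eq.trans ?_ (integral_mul_const _ _)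
      refine integral_congr_ae (Filter.Eventually.of_forall fun x => ?_)
      simp only [Finset.prod_insert ha, Function.update_self]
      rw [← mul_assoc]
      congr 1
      · congr 2
        funext i
        by_cases hi : i = a
        · subst hi; simp
        · simp [hi, hv]
      · refine Finset.prod_congr rfl fun i hi => ?_
        rw [Function.update_of_ne (ne_of_mem_of_not_mem hi ha)]
    · refine ContinuousMap.integrable_of_compact _ (Continuous.mul ?_ ?_)
      · refine hf.continuousOn.comp_continuous (continuous_pi fun i => continuous_const.mul ?_)
          fun t i => hmem _ (hle _ t i)
        split_ifs
        · exact continuous_toCircle_coe.comp (continuous_apply i)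
        · exact continuous_const
      · refine continuous_finsetProd _ fun i _ => Continuous.inv₀ ?_
          fun t => one_sub_mul_toCircle_ne_zero (hw i) _
        exact continuous_const.sub (continuous_const.mul
          (continuous_toCircle_coe.comp (continuous_apply i).neg))

/-- Cauchy's integral formula on the polydisc. -/
lemma integral_torus_mul_szegoKernel {n : ℕ} {f : (Fin n → ℂ) → ℂ}
    (hf : DifferentiableOn ℂ f (polydisc n)) {r : ℝ} (hr0 : 0 < r) (hr1 : r < 1) {w : Fin n → ℂ}
    (hw : w ∈ polydisc n) :
    ∫ t, f (torusPoint r t) * szegoKernel n w t ∂(torusMeasure n) = f (fun i => r * w i) := by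
  rw [← integral_mul_prod_cauchyKernel hf hr0 hr1 hw Finset.univ]
  refine integral_congr_ae (Filter.Eventually.of_forall fun t => ?_)
  simp only [szegoKernel_apply hw, Finset.mem_univ, if_true]
  rfl

/-! ## The Szegő projection -/

section IntegralMul

variable {X : Type*} [TopologicalSpace X] [CompactSpace X] [MeasurableSpace X] [BorelSpace X]
  {μ : Measure X}

lemma integrable_mul_continuousMap {u : X → ℂ} (hu : Integrable u μ) (φ : C(X, ℂ)) :
    Integrable (fun t => u t * φ t) μ :=
  hu.mul_bdd (c := ‖φ‖) φ.continuous.aestronglyMeasurable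
    (Filter.Eventually.of_forall φ.norm_coe_le_norm)

/-- Integration against an integrable function, as a functional on the continuous functions. -/
def integralMulCLM (u : X → ℂ) (hu : Integrable u μ) : C(X, ℂ) →L[ℂ] ℂ :=
  LinearMap.mkContinuous
    { toFun := fun φ => ∫ t, u t * φ t ∂μ
      map_add' := fun φ χ => by
        simp only [ContinuousMap.add_apply, mul_add]
        exact integral_add (integrable_mul_continuousMap hu φ) (integrable_mul_continuousMap hu χ)
      map_smul' := fun c φ => by
        simp only [ContinuousMap.smul_apply, smul_eq_mul, RingHom.id_apply]
        rw [← integral_const_mul]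
        congr 1; ext t; ring }
    (∫ t, ‖u t‖ ∂μ) fun φ => by
      refine (norm_integral_le_integral_norm _).trans ?_
      rw [← integral_mul_const]
      refine integral_mono_of_nonneg (Filter.Eventually.of_forall fun t => norm_nonneg _)
        (hu.norm.mul_const _) (Filter.Eventually.of_forall fun t => ?_)
      simp only [norm_mul]
      exact mul_le_mul_of_nonneg_left (φ.norm_coe_le_norm t) (norm_nonneg _)

lemma integralMulCLM_apply {u : X → ℂ} (hu : Integrable u μ) (φ : C(X, ℂ)) :
    integralMulCLM u hu φ = ∫ t, u t * φ t ∂μ := rfl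

end IntegralMul

/-- The Szegő projection of a function on the torus, as a function on the polydisc. -/
def szegoProj (n : ℕ) (u : UnitAddTorus (Fin n) → ℂ) : (Fin n → ℂ) → ℂ :=
  (polydisc n).indicator fun w => ∫ t, u t * szegoKernel n w t ∂(torusMeasure n)

lemma szegoProj_apply {n : ℕ} (u : UnitAddTorus (Fin n) → ℂ) {w : Fin n → ℂ}
    (hw : w ∈ polydisc n) :
    szegoProj n u w = ∫ t, u t * szegoKernel n w t ∂(torusMeasure n) :=
  indicator_of_mem hw _

lemma szegoProj_isHolomorphic {n : ℕ} {u : UnitAddTorus (Fin n) → ℂ}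
    (hu : Integrable u (torusMeasure n)) : IsHolomorphicOnPolydisc n (szegoProj n u) := by
  refine ⟨?_, fun z hz => indicator_of_notMem hz _⟩
  have h : DifferentiableOn ℂ (fun w => integralMulCLM u hu (szegoKernel n w)) (polydisc n) :=
    (integralMulCLM u hu).differentiable.comp_differentiableOn (differentiableOn_szegoKernel n)
  exact h.congr fun w hw => szegoProj_apply u hw

lemma szegoProj_sum {n : ℕ} {ι : Type*} (s : Finset ι) {u : ι → UnitAddTorus (Fin n) → ℂ}
    (hu : ∀ i, Integrable (u i) (torusMeasure n)) (c : ι → ℂ) (w : Fin n → ℂ) :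
    szegoProj n (fun t => ∑ i ∈ s, c i * u i t) w = ∑ i ∈ s, c i * szegoProj n (u i) w := by
  by_cases hw : w ∈ polydisc n
  · simp only [szegoProj_apply _ hw, Finset.sum_mul, mul_assoc]
    rw [integral_finsetSum _ fun i _ => (integrable_mul_continuousMap (hu i) _).const_mul _]
    simp only [integral_const_mul]
  · simp [szegoProj, hw]

lemma szegoProj_congr_ae {n : ℕ} {u v : UnitAddTorus (Fin n) → ℂ}
    (h : u =ᵐ[torusMeasure n] v) : szegoProj n u = szegoProj n v := by
  funext w
  by_cases hw : w ∈ polydisc n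
  · rw [szegoProj_apply _ hw, szegoProj_apply _ hw]
    exact integral_congr_ae (h.mono fun t ht => by simp only [ht])
  · simp [szegoProj, hw]

/-! ## Point evaluations on Hardy spaces -/

lemma hardyNorm_mono_exponent {n : ℕ} {p q : ℝ≥0∞} (hpq : p ≤ q) {f : (Fin n → ℂ) → ℂ}
    (hf : IsHolomorphicOnPolydisc n f) : hardyNorm n p f ≤ hardyNorm n q f :=
  iSup₂_mono fun _ hr => eLpNorm_le_eLpNorm_of_exponent_le hpq
    (hf.continuous_slice hr).aestronglyMeasurable

lemma eLpNorm_slice_le_hardyNorm {n : ℕ} (p : ℝ≥0∞) (f : (Fin n → ℂ) → ℂ) {r : ℝ}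
    (hr : r ∈ Ico (0 : ℝ) 1) :
    eLpNorm (fun t => f (torusPoint r t)) p (torusMeasure n) ≤ hardyNorm n p f :=
  le_iSup₂ (f := fun r (_ : r ∈ Ico (0 : ℝ) 1) =>
      eLpNorm (fun t => f (torusPoint r t)) p (torusMeasure n)) r hr

lemma integral_norm_slice_le {n : ℕ} {f : (Fin n → ℂ) → ℂ} (hf : IsHolomorphicOnPolydisc n f)
    (hfin : hardyNorm n 1 f < ∞) {r : ℝ} (hr : r ∈ Ico (0 : ℝ) 1) :
    ∫ t, ‖f (torusPoint r t)‖ ∂(torusMeasure n) ≤ (hardyNorm n 1 f).toReal := by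
  rw [integral_norm_eq_lintegral_enorm (hf.continuous_slice hr).aestronglyMeasurable,
    ← eLpNorm_one_eq_lintegral_enorm]
  exact ENNReal.toReal_mono hfin.ne (eLpNorm_slice_le_hardyNorm 1 f hr)

/-- Cauchy's formula is an integral of the slice against a bounded kernel. Since any point of the
polydisc is $r w$ for suitable $r<1$ and $w$ in the polydisc, this controls point evaluations by the
$H^1$ norm. -/
lemma IsHolomorphicOnPolydisc.norm_le_szegoKernel_mul {n : ℕ} {f : (Fin n → ℂ) → ℂ}
    (hf : IsHolomorphicOnPolydisc n f) (hfin : hardyNorm n 1 f < ∞) {r : ℝ} (hr0 : 0 < r)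
    (hr1 : r < 1) {w : Fin n → ℂ} (hw : w ∈ polydisc n) :
    ‖f (fun i => r * w i)‖ ≤ ‖szegoKernel n w‖ * (hardyNorm n 1 f).toReal := by
  have hr : r ∈ Ico (0 : ℝ) 1 := ⟨hr0.le, hr1⟩
  rw [← integral_torus_mul_szegoKernel hf.1 hr0 hr1 hw]
  refine (norm_integral_le_integral_norm _).trans ?_
  refine le_trans ?_ (mul_le_mul_of_nonneg_left (integral_norm_slice_le hf hfin hr)
    (norm_nonneg _))
  rw [← integral_const_mul]
  refine integral_mono_of_nonneg (Filter.Eventually.of_forall fun t => norm_nonneg _)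
    ((ContinuousMap.integrable_of_compact _ (hf.continuous_slice hr)).norm.const_mul _)
    (Filter.Eventually.of_forall fun t => ?_)
  simp only [norm_mul]
  rw [mul_comm]
  exact mul_le_mul_of_nonneg_right ((szegoKernel n w).norm_coe_le_norm t) (norm_nonneg _)

lemma exists_radius {n : ℕ} {w : Fin n → ℂ} (hw : w ∈ polydisc n) :
    ∃ r : ℝ, 0 < r ∧ r < 1 ∧ ∀ i, ‖w i‖ < r := by
  have hz1 : ‖w‖ < 1 := (pi_norm_lt_iff one_pos).2 hw
  obtain ⟨r, h1, h2⟩ := exists_between hz1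
  exact ⟨r, (norm_nonneg w).trans_lt h1, h2, fun i => (norm_le_pi_norm w i).trans_lt h1⟩

lemma inv_mul_mem_polydisc {n : ℕ} {w : Fin n → ℂ} {r : ℝ} (hr0 : 0 < r)
    (hw : ∀ i, ‖w i‖ < r) : (fun i => (r : ℂ)⁻¹ * w i) ∈ polydisc n := by
  intro i
  rw [norm_mul, norm_inv, Complex.norm_real, Real.norm_of_nonneg hr0.le, inv_mul_lt_one₀ hr0]
  exact hw i

lemma mul_inv_mul_eq {n : ℕ} (w : Fin n → ℂ) {r : ℝ} (hr0 : 0 < r) :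
    (fun i => (r : ℂ) * ((r : ℂ)⁻¹ * w i)) = w := by
  have : (r : ℂ) ≠ 0 := by exact_mod_cast hr0.ne'
  funext i
  field_simp

lemma exists_norm_apply_le {n : ℕ} (w : Fin n → ℂ) :
    ∃ C : ℝ, ∀ f : (Fin n → ℂ) → ℂ, IsHolomorphicOnPolydisc n f → hardyNorm n 1 f < ∞ →
      ‖f w‖ ≤ C * (hardyNorm n 1 f).toReal := by
  by_cases hw : w ∈ polydisc n
  · obtain ⟨r, hr0, hr1, hr⟩ := exists_radius hw
    refine ⟨‖szegoKernel n fun i => (r : ℂ)⁻¹ * w i‖, fun f hf hfin => ?_⟩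
    have := hf.norm_le_szegoKernel_mul hfin hr0 hr1 (inv_mul_mem_polydisc hr0 hr)
    rwa [mul_inv_mul_eq w hr0] at this
  · exact ⟨0, fun f hf _ => by simp [hf.2 w hw]⟩

/-- With $r<\rho<1$ the points $\rho^{-1}re^{2\pi it}$ stay in a compact part of the polydisc, where
the kernel is bounded uniformly. This makes restriction to the torus of radius $r$ bounded from
$H^p$ to $C(\mathbb T^n)$. -/
lemma exists_norm_slice_le (n : ℕ) {r : ℝ} (hr : r ∈ Ico (0 : ℝ) 1) :
    ∃ C : ℝ, 0 ≤ C ∧ ∀ f : (Fin n → ℂ) → ℂ, IsHolomorphicOnPolydisc n f → hardyNorm n 1 f < ∞ →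
      ∀ t, ‖f (torusPoint r t)‖ ≤ C * (hardyNorm n 1 f).toReal := by
  obtain ⟨ρ, hρ, hρ1⟩ := exists_between hr.2
  have hρ0 : 0 < ρ := hr.1.trans_lt hρ
  have hmem : ∀ t : UnitAddTorus (Fin n), (fun i => (ρ : ℂ)⁻¹ * torusPoint r t i) ∈ polydisc n := by
    refine fun t => inv_mul_mem_polydisc hρ0 fun i => ?_
    rw [torusPoint, norm_mul, Circle.norm_coe, mul_one, Complex.norm_real,
      Real.norm_of_nonneg hr.1]
    exact hρ
  have hc : Continuous fun t : UnitAddTorus (Fin n) =>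
      szegoKernel n (fun i => (ρ : ℂ)⁻¹ * torusPoint r t i) := by
    refine (differentiableOn_szegoKernel n).continuousOn.comp_continuous ?_ hmem
    exact continuous_pi fun i => continuous_const.mul
      ((continuous_apply i).comp (continuous_torusPoint r))
  obtain ⟨C, hC⟩ := isCompact_univ.exists_bound_of_continuousOn hc.continuousOn
  refine ⟨max C 0, le_max_right _ _, fun f hf hfin t => ?_⟩
  have := hf.norm_le_szegoKernel_mul hfin hρ0 hρ1 (hmem t)
  rw [mul_inv_mul_eq _ hρ0] at this
  exact this.trans (mul_le_mul_of_nonneg_right ((hC t (mem_univ t)).trans (le_max_left _ _))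
    ENNReal.toReal_nonneg)

/-! ## The normed spaces `HardyType` -/

/-- A member of `hardySpace n p`, as an element of the normed space `HardyType n p`. -/
def HardyType.mk {n : ℕ} {p : ℝ≥0∞} (f : (Fin n → ℂ) → ℂ) (hf : f ∈ hardySpace n p) :
    HardyType n p := ⟨f, hf⟩

lemma hardyIncl_mk {n : ℕ} {p : ℝ≥0∞} (f : (Fin n → ℂ) → ℂ) (hf : f ∈ hardySpace n p) :
    hardyIncl n p (HardyType.mk f hf) = f := rfl

lemma hardyIncl_mem {n : ℕ} {p : ℝ≥0∞} (f : HardyType n p) : hardyIncl n p f ∈ hardySpace n p :=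
  f.2

lemma hardyIncl_injective {n : ℕ} {p : ℝ≥0∞} : Function.Injective (hardyIncl n p) :=
  Subtype.val_injective

lemma HardyType.norm_def {n : ℕ} {p : ℝ≥0∞} [Fact (1 ≤ p)] (f : HardyType n p) :
    ‖f‖ = (hardyNorm n p (hardyIncl n p f)).toReal := rfl

lemma HardyType.enorm_eq {n : ℕ} {p : ℝ≥0∞} [Fact (1 ≤ p)] (f : HardyType n p) :
    ‖f‖ₑ = hardyNorm n p (hardyIncl n p f) := by
  rw [← ofReal_norm, HardyType.norm_def, ENNReal.ofReal_toReal (hardyIncl_mem f).2.ne]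

lemma HardyType.norm_le {n : ℕ} {p : ℝ≥0∞} [Fact (1 ≤ p)] {f : HardyType n p} {A : ℝ}
    (hA : 0 ≤ A) (h : hardyNorm n p (hardyIncl n p f) ≤ ENNReal.ofReal A) : ‖f‖ ≤ A :=
  ENNReal.toReal_le_of_le_ofReal hA h

lemma hardyNorm_one_toReal_le {n : ℕ} {p : ℝ≥0∞} [hp : Fact (1 ≤ p)] (f : HardyType n p) :
    hardyNorm n 1 (hardyIncl n p f) < ∞ ∧ (hardyNorm n 1 (hardyIncl n p f)).toReal ≤ ‖f‖ := by
  have h := hardyNorm_mono_exponent hp.out (hardyIncl_mem f).1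
  exact ⟨h.trans_lt (hardyIncl_mem f).2, ENNReal.toReal_mono (hardyIncl_mem f).2.ne h⟩

/-- Evaluation at a point is a continuous functional on `H^p`. -/
def HardyType.evalCLM (n : ℕ) (p : ℝ≥0∞) [hp : Fact (1 ≤ p)] (w : Fin n → ℂ) :
    HardyType n p →L[ℂ] ℂ :=
  LinearMap.mkContinuous (LinearMap.proj w ∘ₗ hardyIncl n p)
    (max (exists_norm_apply_le w).choose 0) fun f => by
      have h := hardyNorm_one_toReal_le f
      refine ((exists_norm_apply_le w).choose_spec _ (hardyIncl_mem f).1 h.1).trans ?_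
      exact mul_le_mul (le_max_left _ _) h.2 ENNReal.toReal_nonneg (le_max_right _ _)

lemma HardyType.evalCLM_apply {n : ℕ} {p : ℝ≥0∞} [Fact (1 ≤ p)] (w : Fin n → ℂ)
    (f : HardyType n p) : HardyType.evalCLM n p w f = hardyIncl n p f w := rfl

/-- Restriction to the torus of radius `r`, as a map from `H^p` to the continuous functions. -/
def HardyType.sliceCLM (n : ℕ) (p : ℝ≥0∞) [hp : Fact (1 ≤ p)] {r : ℝ} (hr : r ∈ Ico (0 : ℝ) 1) :
    HardyType n p →L[ℂ] C(UnitAddTorus (Fin n), ℂ) :=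
  LinearMap.mkContinuous
    { toFun := fun f => ⟨fun t => hardyIncl n p f (torusPoint r t),
        (hardyIncl_mem f).1.continuous_slice hr⟩
      map_add' := fun f g => by ext t; simp
      map_smul' := fun c f => by ext t; simp }
    (exists_norm_slice_le n hr).choose fun f => by
      have h := hardyNorm_one_toReal_le f
      have hC := (exists_norm_slice_le n hr).choose_spec
      refine (ContinuousMap.norm_le _ (mul_nonneg hC.1 (norm_nonneg _))).2 fun t => ?_
      exact (hC.2 _ (hardyIncl_mem f).1 h.1 t).trans (mul_le_mul_of_nonneg_left h.2 hC.1)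

lemma HardyType.sliceCLM_apply {n : ℕ} {p : ℝ≥0∞} [Fact (1 ≤ p)] {r : ℝ}
    (hr : r ∈ Ico (0 : ℝ) 1) (f : HardyType n p) (t : UnitAddTorus (Fin n)) :
    HardyType.sliceCLM n p hr f t = hardyIncl n p f (torusPoint r t) := rfl

/-- Cauchy's formula on a torus of radius $r<1$ gives access only to the dilations of a function;
each point has room for one of them. -/
lemma isHolomorphicOnPolydisc_of_dilations {n : ℕ} {f : (Fin n → ℂ) → ℂ}
    (hf : ∀ z ∉ polydisc n, f z = 0)
    (h : ∀ r : ℝ, 0 < r → r < 1 → DifferentiableOn ℂ (fun w => f (fun i => r * w i)) (polydisc n)) :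
    IsHolomorphicOnPolydisc n f := by
  refine ⟨fun z hz => ?_, hf⟩
  obtain ⟨r, hr0, hr1, hr⟩ := exists_radius hz
  have hmem := inv_mul_mem_polydisc hr0 hr
  have h1 : DifferentiableAt ℂ (fun w : Fin n → ℂ => f (fun i => r * w i))
      (fun i => (r : ℂ)⁻¹ * z i) :=
    (h r hr0 hr1).differentiableAt ((isOpen_polydisc n).mem_nhds hmem)
  have h2 : DifferentiableAt ℂ (fun z : Fin n → ℂ => fun i => (r : ℂ)⁻¹ * z i) z := by fun_prop
  have h3 := DifferentiableAt.comp z h1 h2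
  have h4 : ((fun w : Fin n → ℂ => f (fun i => r * w i)) ∘
      fun z : Fin n → ℂ => fun i => (r : ℂ)⁻¹ * z i) = f := by
    funext z
    simp only [Function.comp_apply, mul_inv_mul_eq z hr0]
  rw [h4] at h3
  exact h3.differentiableWithinAt

/-- Point evaluations give a pointwise limit, the Szegő integral of uniform limits on smaller tori
makes it holomorphic, and Fatou gives convergence in norm. Completeness is what allows series of
strip functions to be summed. -/
instance (n : ℕ) (p : ℝ≥0∞) [hp : Fact (1 ≤ p)] : CompleteSpace (HardyType n p) := by
  refine Metric.complete_of_cauchySeq_tendsto fun u hu => ?_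
  have hlim : ∀ w, ∃ a, Filter.Tendsto (fun k => hardyIncl n p (u k) w) Filter.atTop (nhds a) :=
    fun w => cauchySeq_tendsto_of_complete
      (hu.map (HardyType.evalCLM n p w).uniformContinuous)
  choose f hf using hlim
  have hfhol : IsHolomorphicOnPolydisc n f := by
    refine isHolomorphicOnPolydisc_of_dilations (fun z hz => ?_) fun r hr0 hr1 => ?_
    · refine tendsto_nhds_unique (hf z) (tendsto_const_nhds.congr fun k => ?_)
      exact ((hardyIncl_mem (u k)).1.2 z hz).symm
    · have hr : r ∈ Ico (0 : ℝ) 1 := ⟨hr0.le, hr1⟩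
      have hcs : CauchySeq fun k => HardyType.sliceCLM n p hr (u k) :=
        hu.map (HardyType.sliceCLM n p hr).uniformContinuous
      obtain ⟨U, hU⟩ := cauchySeq_tendsto_of_complete hcs
      have hUi : Integrable U (torusMeasure n) := ContinuousMap.integrable_of_compact _ U.continuous
      refine ((integralMulCLM U hUi).differentiable.comp_differentiableOn
        (differentiableOn_szegoKernel n)).congr fun w hw => ?_
      refine tendsto_nhds_unique (hf _) ?_
      have hS := ContinuousMap.integrable_of_compact (torusMeasure n) (szegoKernel n w).continuous
      have h1 := ((integralMulCLM _ hS).continuous.tendsto U).comp hU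
      have h2 : integralMulCLM _ hS U = integralMulCLM U hUi (szegoKernel n w) := by
        simp only [integralMulCLM_apply, mul_comm]
      rw [h2] at h1
      refine h1.congr fun k => ?_
      simp only [Function.comp_apply, integralMulCLM_apply]
      rw [← integral_torus_mul_szegoKernel (hardyIncl_mem (u k)).1.1 hr0 hr1 hw]
      simp only [mul_comm, HardyType.sliceCLM_apply]
  have hbound : ∀ ε : ℝ, 0 < ε → ∃ N, ∀ k ≥ N,
      hardyNorm n p (f - hardyIncl n p (u k)) ≤ ENNReal.ofReal ε := by
    intro ε hε
    obtain ⟨N, hN⟩ := Metric.cauchySeq_iff.1 hu ε hε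
    refine ⟨N, fun k hk => iSup₂_le fun r hr => ?_⟩
    -- Fatou's lemma on each slice, with `k` fixed and `l` tending to infinity in the Cauchy
    -- condition.
    refine (Lp.eLpNorm_lim_le_liminf_eLpNorm
      (f := fun l t => hardyIncl n p (u l - u k) (torusPoint r t))
      (fun l => ((hardyIncl_mem (u l - u k)).1.continuous_slice hr).aestronglyMeasurable) _
      (Filter.Eventually.of_forall fun t => ?_)).trans ?_
    · simp only [map_sub, Pi.sub_apply]
      exact (hf _).sub_const _
    · refine Filter.liminf_le_of_frequently_le' (Filter.Eventually.frequently ?_)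
      filter_upwards [Filter.eventually_ge_atTop N] with l hl
      refine (eLpNorm_slice_le_hardyNorm p _ hr).trans ?_
      rw [← HardyType.enorm_eq, ← ofReal_norm, ← dist_eq_norm]
      exact ENNReal.ofReal_le_ofReal (hN l hl k hk).le
  have hfmem : f ∈ hardySpace n p := by
    obtain ⟨N, hN⟩ := hbound 1 one_pos
    have hd : f - hardyIncl n p (u N) ∈ hardySpace n p := by
      refine ⟨⟨hfhol.1.sub (hardyIncl_mem (u N)).1.1, fun z hz => ?_⟩,
        (hN N le_rfl).trans_lt ENNReal.ofReal_lt_top⟩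
      simp [hfhol.2 z hz, (hardyIncl_mem (u N)).1.2 z hz]
    simpa using add_mem hd (hardyIncl_mem (u N))
  refine ⟨HardyType.mk f hfmem, Metric.tendsto_atTop.2 fun ε hε => ?_⟩
  obtain ⟨N, hN⟩ := hbound (ε / 2) (half_pos hε)
  refine ⟨N, fun k hk => ?_⟩
  rw [dist_comm, dist_eq_norm]
  refine (HardyType.norm_le (half_pos hε).le ?_).trans_lt (half_lt_self hε)
  rw [map_sub, hardyIncl_mk]
  exact hN k hk

/-! ## The Szegő projection in one variable -/

local notation "σ₁" => AddCircle.haarAddCircle (T := (1 : ℝ))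

/-- The Cauchy kernel `x ↦ (1 - w e^{-2 π i x})⁻¹` of the circle. -/
def circleKernel (w : ℂ) : C(UnitAddCircle, ℂ) := Ring.inverse (1 - w • fourier (-1))

lemma isUnit_one_sub_smul_fourier {w : ℂ} (hw : ‖w‖ < 1) :
    IsUnit (1 - w • (fourier (-1) : C(UnitAddCircle, ℂ))) := by
  refine isUnit_one_sub_of_norm_lt_one ?_
  rw [norm_smul, fourier_norm, mul_one]
  exact hw

lemma circleKernel_apply {w : ℂ} (hw : ‖w‖ < 1) (x : UnitAddCircle) :
    circleKernel w x = (1 - w * (AddCircle.toCircle (-x) : ℂ))⁻¹ := by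
  rw [circleKernel, ContinuousMap.ringInverse_apply (isUnit_one_sub_smul_fourier hw)]
  simp only [ContinuousMap.sub_apply, ContinuousMap.one_apply, ContinuousMap.smul_apply,
    fourier_apply, smul_eq_mul, neg_smul, one_smul]

lemma differentiableOn_circleKernel : DifferentiableOn ℂ circleKernel (Metric.ball 0 1) := by
  intro w hw
  refine DifferentiableWithinAt.inverse ?_ (isUnit_one_sub_smul_fourier (by simpa using hw))
  fun_prop

/-- The Cauchy kernel `(1 - r e^{2 π i s})⁻¹` as a function of `s`. -/
def cauchyKernel (r : ℝ) (s : UnitAddCircle) : ℂ := (1 - r * (AddCircle.toCircle s : ℂ))⁻¹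

lemma norm_ofReal_lt_one {r : ℝ} (hr : r ∈ Ico (0 : ℝ) 1) : ‖(r : ℂ)‖ < 1 := by
  rw [Complex.norm_real, Real.norm_of_nonneg hr.1]
  exact hr.2

lemma continuous_cauchyKernel {r : ℝ} (hr : r ∈ Ico (0 : ℝ) 1) : Continuous (cauchyKernel r) :=
  (continuous_const.sub (continuous_const.mul continuous_toCircle_coe)).inv₀
    (one_sub_mul_toCircle_ne_zero (norm_ofReal_lt_one hr))

lemma norm_cauchyKernel_le {r : ℝ} (hr : r ∈ Ico (0 : ℝ) 1) (s : UnitAddCircle) :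
    ‖cauchyKernel r s‖ ≤ (1 - r)⁻¹ := by
  rw [cauchyKernel, norm_inv]
  refine inv_anti₀ (sub_pos.2 hr.2) ?_
  have := norm_sub_norm_le (1 : ℂ) (r * (AddCircle.toCircle s : ℂ))
  rwa [norm_one, norm_mul, Circle.norm_coe, mul_one, Complex.norm_real,
    Real.norm_of_nonneg hr.1] at this

lemma integral_cauchyKernel {r : ℝ} (hr : r ∈ Ico (0 : ℝ) 1) : ∫ s, cauchyKernel r s ∂σ₁ = 1 := by
  have hF : DifferentiableOn ℂ (fun z : ℂ => (1 - z)⁻¹) (Metric.ball 0 1) := by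
    intro z hz
    refine DifferentiableWithinAt.inv (by fun_prop) ?_
    intro h
    rw [← sub_eq_zero.1 h] at hz
    simp at hz
  have := integral_circle_eq_center hF hr.1 hr.2
  simpa [cauchyKernel] using this

/-- The Poisson kernel of the disc. -/
def poissonDensity (r : ℝ) (s : UnitAddCircle) : ℝ := (2 * cauchyKernel r s - 1).re

lemma continuous_poissonDensity {r : ℝ} (hr : r ∈ Ico (0 : ℝ) 1) :
    Continuous (poissonDensity r) :=
  Complex.continuous_re.comp ((continuous_const.mul (continuous_cauchyKernel hr)).sub
    continuous_const)

/-- With $z=re^{2\pi is}$ the density is $(1-|z|^2)/|1-z|^2$. -/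
lemma poissonDensity_nonneg {r : ℝ} (hr : r ∈ Ico (0 : ℝ) 1) (s : UnitAddCircle) :
    0 ≤ poissonDensity r s := by
  have hne := one_sub_mul_toCircle_ne_zero (norm_ofReal_lt_one hr) s
  have hn : ‖(r : ℂ) * (AddCircle.toCircle s : ℂ)‖ < 1 := by
    rw [norm_mul, Circle.norm_coe, mul_one]
    exact norm_ofReal_lt_one hr
  rw [poissonDensity, cauchyKernel]
  generalize (r : ℂ) * (AddCircle.toCircle s : ℂ) = z at hne hn
  have hpos := Complex.normSq_pos.2 hne
  have hz : Complex.normSq z < 1 := by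
    rw [Complex.normSq_eq_norm_sq]
    exact pow_lt_one₀ (norm_nonneg z) hn two_ne_zero
  simp only [Complex.sub_re, Complex.mul_re, Complex.re_ofNat, Complex.im_ofNat, zero_mul,
    sub_zero, Complex.one_re, Complex.inv_re, sub_nonneg]
  rw [← mul_div_assoc, le_div_iff₀ hpos]
  simp only [Complex.normSq_apply, Complex.sub_re, Complex.sub_im, Complex.one_re,
    Complex.one_im] at hz ⊢
  nlinarith

lemma integral_poissonDensity {r : ℝ} (hr : r ∈ Ico (0 : ℝ) 1) :
    ∫ s, poissonDensity r s ∂σ₁ = 1 := by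
  have hi := ContinuousMap.integrable_of_compact σ₁ (continuous_cauchyKernel hr)
  have hi2 : Integrable (fun s => 2 * cauchyKernel r s - 1) σ₁ :=
    (hi.const_mul 2).sub (integrable_const _)
  have h : ∫ s, (2 * cauchyKernel r s - 1) ∂σ₁ = 1 := by
    rw [integral_sub (hi.const_mul 2) (integrable_const _), integral_const_mul,
      integral_cauchyKernel hr]
    simp
    norm_num
  have h2 := integral_re hi2
  simp only [h] at h2
  simpa [poissonDensity] using h2

/-! ### Jensen's inequality and Riesz's pointwise inequality for the exponents 2 and 4. -/

/-- The variance of `v` under the probability density `ρ` is nonnegative. -/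
lemma integral_mul_pow_two_le {X : Type*} [MeasurableSpace X] {μ : Measure X} {v ρ : X → ℝ}
    (hρ0 : ∀ x, 0 ≤ ρ x) (hρ : Integrable ρ μ) (hρ1 : ∫ x, ρ x ∂μ = 1)
    (h1 : Integrable (fun x => v x * ρ x) μ) (h2 : Integrable (fun x => v x ^ 2 * ρ x) μ) :
    (∫ x, v x * ρ x ∂μ) ^ 2 ≤ ∫ x, v x ^ 2 * ρ x ∂μ := by
  set m := ∫ x, v x * ρ x ∂μ with hm
  have h : 0 ≤ ∫ x, (v x - m) ^ 2 * ρ x ∂μ :=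
    integral_nonneg fun x => mul_nonneg (sq_nonneg _) (hρ0 x)
  have he : ∀ x, (v x - m) ^ 2 * ρ x = v x ^ 2 * ρ x - 2 * m * (v x * ρ x) + m ^ 2 * ρ x :=
    fun x => by ring
  simp only [he] at h
  have hs : Integrable (fun x => v x ^ 2 * ρ x - 2 * m * (v x * ρ x)) μ := h2.sub (h1.const_mul _)
  rw [integral_add hs (hρ.const_mul _), integral_sub h2 (h1.const_mul _),
    integral_const_mul, integral_const_mul, hρ1, ← hm] at h
  nlinarith

/-- The exponent 4 follows from applying the square twice. -/
lemma integral_mul_pow_le {X : Type*} [MeasurableSpace X] {μ : Measure X} {v ρ : X → ℝ}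
    (hρ0 : ∀ x, 0 ≤ ρ x) (hρ : Integrable ρ μ) (hρ1 : ∫ x, ρ x ∂μ = 1) (hv : Measurable v)
    {M : ℝ} (hM : ∀ x, |v x| ≤ M) {k : ℕ} (hk : k = 2 ∨ k = 4) :
    (∫ x, v x * ρ x ∂μ) ^ k ≤ ∫ x, v x ^ k * ρ x ∂μ := by
  have hi : ∀ j : ℕ, Integrable (fun x => v x ^ j * ρ x) μ := fun j =>
    hρ.bdd_mul (c := M ^ j) (hv.pow_const j).aestronglyMeasurable
      (Filter.Eventually.of_forall fun x => by
        rw [norm_pow, Real.norm_eq_abs]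
        exact pow_le_pow_left₀ (abs_nonneg _) (hM x) j)
  have h1 := integral_mul_pow_two_le hρ0 hρ hρ1 (by simpa using hi 1) (hi 2)
  rcases hk with rfl | rfl
  · exact h1
  · have h2 := integral_mul_pow_two_le (v := fun x => v x ^ 2) hρ0 hρ hρ1 (hi 2)
      (by simpa only [← pow_mul] using hi 4)
    calc (∫ x, v x * ρ x ∂μ) ^ 4 = ((∫ x, v x * ρ x ∂μ) ^ 2) ^ 2 := by ring
      _ ≤ (∫ x, v x ^ 2 * ρ x ∂μ) ^ 2 := pow_le_pow_left₀ (sq_nonneg _) h1 2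
      _ ≤ _ := h2
      _ = _ := by simp only [← pow_mul]

/-- The pointwise core of Riesz's theorem. For a Herglotz integral, the real part is a Poisson
integral, and the mean of $\operatorname{Re}(z^k)$ over a circle is known from the value at the
centre; together they control the full modulus. -/
lemma exists_norm_pow_le_re_pow {k : ℕ} (hk : k = 2 ∨ k = 4) :
    ∃ K L : ℝ, 0 ≤ K ∧ ∀ z : ℂ, ‖z‖ ^ k ≤ K * z.re ^ k + L * (z ^ k).re := by
  rcases hk with rfl | rfl
  -- With $z=x+iy$ this is the identity $x^2+y^2=2x^2-(x^2-y^2)$.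
  · refine ⟨2, -1, by norm_num, fun z => ?_⟩
    rw [← Complex.normSq_eq_norm_sq, Complex.normSq_apply, pow_two z, Complex.mul_re]
    nlinarith
  -- With these constants the right side minus the left side is exactly $(7x^2-y^2)^2$.
  · refine ⟨48, 2, by norm_num, fun z => ?_⟩
    have h1 : ‖z‖ ^ 4 = (z.re * z.re + z.im * z.im) ^ 2 := by
      rw [← Complex.normSq_apply, Complex.normSq_eq_norm_sq]; ring
    have h2 : (z ^ 4).re = (z.re * z.re - z.im * z.im) ^ 2 - (2 * z.re * z.im) ^ 2 := by
      have : z ^ 4 = (z * z) * (z * z) := by ring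
      rw [this, Complex.mul_re, Complex.mul_re, Complex.mul_im]; ring
    rw [h1, h2]
    nlinarith [sq_nonneg (7 * z.re ^ 2 - z.im ^ 2)]

lemma integrable_of_bdd {X : Type*} [MeasurableSpace X] {μ : Measure X} [IsFiniteMeasure μ]
    {E : Type*} [NormedAddCommGroup E] {u : X → E} (hu : AEStronglyMeasurable u μ) {M : ℝ}
    (hM : ∀ x, ‖u x‖ ≤ M) : Integrable u μ :=
  Integrable.of_bound hu M (Filter.Eventually.of_forall hM)

lemma toCircle_mul_toCircle_neg (y x : UnitAddCircle) :
    (AddCircle.toCircle y : ℂ) * (AddCircle.toCircle (-x) : ℂ) = AddCircle.toCircle (y - x) := by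
  rw [sub_eq_add_neg, AddCircle.toCircle_add, Circle.coe_mul]

/-- The Herglotz transform of a bounded function is bounded on `L^2` and on `L^4`. -/
lemma exists_integral_herglotz_pow_le {k : ℕ} (hk : k = 2 ∨ k = 4) :
    ∃ B : ℝ, 0 ≤ B ∧ ∀ r ∈ Ico (0 : ℝ) 1, ∀ v : UnitAddCircle → ℝ, Measurable v →
      (∃ M, ∀ x, |v x| ≤ M) →
      ∫ y, ‖∫ x, (v x : ℂ) * (2 * cauchyKernel r (y - x) - 1) ∂σ₁‖ ^ k ∂σ₁
        ≤ B * ∫ x, v x ^ k ∂σ₁ := by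
  obtain ⟨K, L, hK, hKL⟩ := exists_norm_pow_le_re_pow hk
  have hkev : Even k := by rcases hk with rfl | rfl <;> decide
  refine ⟨K + |L|, by positivity, fun r hr v hv ⟨M, hM⟩ => ?_⟩
  have hvi : Integrable (fun x => (v x : ℂ)) σ₁ :=
    integrable_of_bdd (Complex.measurable_ofReal.comp hv).aestronglyMeasurable (M := M)
      fun x => by simpa using hM x
  -- The Herglotz integral of `v`: holomorphic in the disc, with the mean of `v` as its value at the
  -- centre.
  set c : ℂ → ℂ := fun w => integralMulCLM _ hvi (2 • circleKernel w - 1) with hcdef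
  have hcdiff : DifferentiableOn ℂ c (Metric.ball 0 1) :=
    (integralMulCLM _ hvi).differentiable.comp_differentiableOn
      ((differentiableOn_circleKernel.const_smul 2).sub_const 1)
  have hmem : ∀ y : UnitAddCircle, (r * (AddCircle.toCircle y : ℂ)) ∈ Metric.ball (0 : ℂ) 1 := by
    intro y
    rw [mem_ball_zero_iff, norm_mul, Circle.norm_coe, mul_one]
    exact norm_ofReal_lt_one hr
  have hcy : ∀ y, c (r * (AddCircle.toCircle y : ℂ))
      = ∫ x, (v x : ℂ) * (2 * cauchyKernel r (y - x) - 1) ∂σ₁ := by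
    intro y
    rw [hcdef]
    simp only [integralMulCLM_apply]
    refine integral_congr_ae (Filter.Eventually.of_forall fun x => ?_)
    simp only [ContinuousMap.sub_apply, ContinuousMap.smul_apply, ContinuousMap.one_apply]
    rw [circleKernel_apply (by simpa using hmem y), mul_assoc, toCircle_mul_toCircle_neg]
    simp [cauchyKernel]
  have hc0 : c 0 = ((∫ x, v x ∂σ₁ : ℝ) : ℂ) := by
    rw [← integral_complex_ofReal, hcdef]
    simp only [integralMulCLM_apply]
    refine integral_congr_ae (Filter.Eventually.of_forall fun x => ?_)
    simp only [ContinuousMap.sub_apply, ContinuousMap.smul_apply, ContinuousMap.one_apply]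
    rw [circleKernel_apply (by simp)]
    norm_num
  have hccont : Continuous fun y : UnitAddCircle => c (r * (AddCircle.toCircle y : ℂ)) :=
    hcdiff.continuousOn.comp_continuous (continuous_const.mul continuous_toCircle_coe) hmem
  -- The mean value property is applied to the holomorphic function $c^k$, not to $c$.
  have hmean : ∫ y, c (r * (AddCircle.toCircle y : ℂ)) ^ k ∂σ₁ = ((∫ x, v x ∂σ₁ : ℝ) : ℂ) ^ k := by
    rw [← hc0]
    exact integral_circle_eq_center (F := fun z => c z ^ k) (hcdiff.pow k) hr.1 hr.2
  have hm : (∫ x, v x ∂σ₁) ^ k ≤ ∫ x, v x ^ k ∂σ₁ := by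
    simpa using integral_mul_pow_le (μ := σ₁) (ρ := fun _ => 1) (fun _ => zero_le_one)
      (integrable_const _) (by simp) hv hM hk
  -- the real part is the Poisson integral of `v`
  have hpc : ∀ y, Continuous fun x => poissonDensity r (y - x) := fun y =>
    (continuous_poissonDensity hr).comp (continuous_const.sub continuous_id)
  have hre : ∀ y, (c (r * (AddCircle.toCircle y : ℂ))).re
      = ∫ x, v x * poissonDensity r (y - x) ∂σ₁ := by
    intro y
    have hint : Integrable (fun x => (v x : ℂ) * (2 * cauchyKernel r (y - x) - 1)) σ₁ :=
      integrable_mul_continuousMap hvi ⟨fun x => 2 * cauchyKernel r (y - x) - 1,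
        (continuous_const.mul ((continuous_cauchyKernel hr).comp
          (continuous_const.sub continuous_id))).sub continuous_const⟩
    rw [hcy, ← RCLike.re_eq_complex_re, ← integral_re hint]
    refine integral_congr_ae (Filter.Eventually.of_forall fun x => ?_)
    simp only [RCLike.re_eq_complex_re, Complex.re_ofReal_mul, poissonDensity]
  have hpint : ∀ y, Integrable (fun x => poissonDensity r (y - x)) σ₁ := fun y =>
    (hpc y).integrable_of_hasCompactSupport (HasCompactSupport.of_compactSpace _)
  -- Jensen's inequality: the translated Poisson kernel is a probability density.
  have hJ : ∀ y, (c (r * (AddCircle.toCircle y : ℂ))).re ^ k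
      ≤ ∫ x, v x ^ k * poissonDensity r (y - x) ∂σ₁ := by
    intro y
    rw [hre]
    refine integral_mul_pow_le (fun x => poissonDensity_nonneg hr _) (hpint y) ?_ hv hM hk
    rw [integral_sub_left_eq_self (poissonDensity r) σ₁ y, integral_poissonDensity hr]
  obtain ⟨Q, hQ⟩ := isCompact_univ.exists_bound_of_continuousOn
    (continuous_poissonDensity hr).continuousOn
  have hprod : Integrable (fun q : UnitAddCircle × UnitAddCircle =>
      v q.2 ^ k * poissonDensity r (q.1 - q.2)) (AddCircle.haarAddCircle.prod σ₁) := by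
    refine integrable_of_bdd (M := M ^ k * Q) ?_ fun q => ?_
    · exact (((hv.comp measurable_snd).pow_const k).mul
        ((continuous_poissonDensity hr).measurable.comp
          (measurable_fst.sub measurable_snd))).aestronglyMeasurable
    · rw [norm_mul, norm_pow, Real.norm_eq_abs]
      exact mul_le_mul (pow_le_pow_left₀ (abs_nonneg _) (hM _) k) (hQ _ (mem_univ _))
        (norm_nonneg _) (pow_nonneg ((abs_nonneg _).trans (hM 0)) k)
  -- By translation invariance the Poisson kernel also has mass one in the other variable.
  have hFub : ∫ y, ∫ x, v x ^ k * poissonDensity r (y - x) ∂σ₁ ∂σ₁ = ∫ x, v x ^ k ∂σ₁ := by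
    rw [integral_integral_swap hprod]
    refine integral_congr_ae (Filter.Eventually.of_forall fun x => ?_)
    simp only
    rw [integral_const_mul, integral_sub_right_eq_self (poissonDensity r) x,
      integral_poissonDensity hr, mul_one]
  have hcre : Integrable (fun y => (c (r * (AddCircle.toCircle y : ℂ))).re ^ k) σ₁ :=
    ((Complex.continuous_re.comp hccont).pow k).integrable_of_hasCompactSupport
      (HasCompactSupport.of_compactSpace _)
  have hcpow : Integrable (fun y => c (r * (AddCircle.toCircle y : ℂ)) ^ k) σ₁ :=
    ContinuousMap.integrable_of_compact _ (hccont.pow k)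
  have hcpre : Integrable (fun y => (c (r * (AddCircle.toCircle y : ℂ)) ^ k).re) σ₁ := hcpow.re
  calc ∫ y, ‖∫ x, (v x : ℂ) * (2 * cauchyKernel r (y - x) - 1) ∂σ₁‖ ^ k ∂σ₁
      = ∫ y, ‖c (r * (AddCircle.toCircle y : ℂ))‖ ^ k ∂σ₁ := by simp only [hcy]
    _ ≤ ∫ y, (K * (c (r * (AddCircle.toCircle y : ℂ))).re ^ k
          + L * (c (r * (AddCircle.toCircle y : ℂ)) ^ k).re) ∂σ₁ :=
        integral_mono_of_nonneg (Filter.Eventually.of_forall fun y => by positivity)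
          ((hcre.const_mul K).add (hcpre.const_mul L))
          (Filter.Eventually.of_forall fun y => hKL _)
    _ = K * ∫ y, (c (r * (AddCircle.toCircle y : ℂ))).re ^ k ∂σ₁
          + L * (∫ x, v x ∂σ₁) ^ k := by
        rw [integral_add (hcre.const_mul K) (hcpre.const_mul L), integral_const_mul,
          integral_const_mul]
        congr 2
        have h := integral_re hcpow
        simp only [RCLike.re_eq_complex_re] at h
        rw [h, hmean, ← Complex.ofReal_pow, Complex.ofReal_re]
    _ ≤ K * ∫ x, v x ^ k ∂σ₁ + |L| * ∫ x, v x ^ k ∂σ₁ := by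
        refine add_le_add (mul_le_mul_of_nonneg_left ?_ hK)
          (mul_le_mul (le_abs_self L) hm (hkev.pow_nonneg _) (abs_nonneg L))
        rw [← hFub]
        exact integral_mono hcre hprod.integral_prod_left hJ
    _ = (K + |L|) * ∫ x, v x ^ k ∂σ₁ := by ring

/-- The Szegő projection in one variable is bounded on `L^2` and on `L^4`. -/
lemma exists_integral_cauchy_pow_le {k : ℕ} (hk : k = 2 ∨ k = 4) :
    ∃ B : ℝ, 0 ≤ B ∧ ∀ r ∈ Ico (0 : ℝ) 1, ∀ v : UnitAddCircle → ℂ, Measurable v →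
      (∃ M, ∀ x, ‖v x‖ ≤ M) →
      ∫ y, ‖∫ x, v x * cauchyKernel r (y - x) ∂σ₁‖ ^ k ∂σ₁ ≤ B * ∫ x, ‖v x‖ ^ k ∂σ₁ := by
  obtain ⟨B, hB, h⟩ := exists_integral_herglotz_pow_le hk
  have hkev : Even k := by rcases hk with rfl | rfl <;> decide
  -- the real case
  have hreal : ∀ r ∈ Ico (0 : ℝ) 1, ∀ v : UnitAddCircle → ℝ, Measurable v →
      (∃ M, ∀ x, |v x| ≤ M) →
      Continuous (fun y => ∫ x, (v x : ℂ) * cauchyKernel r (y - x) ∂σ₁) ∧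
      ∫ y, ‖∫ x, (v x : ℂ) * cauchyKernel r (y - x) ∂σ₁‖ ^ k ∂σ₁
        ≤ (B + 1) * ∫ x, v x ^ k ∂σ₁ := by
    intro r hr v hv ⟨M, hM⟩
    have hvi : Integrable (fun x => (v x : ℂ)) σ₁ :=
      integrable_of_bdd (Complex.measurable_ofReal.comp hv).aestronglyMeasurable (M := M)
        fun x => by simpa using hM x
    have hint : ∀ y, Integrable (fun x => (v x : ℂ) * cauchyKernel r (y - x)) σ₁ := fun y =>
      integrable_mul_continuousMap hvi ⟨fun x => cauchyKernel r (y - x),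
        (continuous_cauchyKernel hr).comp (continuous_const.sub continuous_id)⟩
    have hcont : Continuous (fun y => ∫ x, (v x : ℂ) * cauchyKernel r (y - x) ∂σ₁) := by
      refine continuous_of_dominated (fun y => (hint y).aestronglyMeasurable)
        (bound := fun x => ‖(v x : ℂ)‖ * (1 - r)⁻¹)
        (fun y => Filter.Eventually.of_forall fun x => ?_) (hvi.norm.mul_const _)
        (Filter.Eventually.of_forall fun x => ?_)
      · rw [norm_mul]
        exact mul_le_mul_of_nonneg_left (norm_cauchyKernel_le hr _) (norm_nonneg _)
      · exact continuous_const.mul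
          ((continuous_cauchyKernel hr).comp (continuous_id.sub continuous_const))
    refine ⟨hcont, ?_⟩
    set m := ∫ x, v x ∂σ₁ with hm
    -- The Cauchy integral is half the sum of the Herglotz integral and the mean of `v`.
    have heq : ∀ y, ∫ x, (v x : ℂ) * (2 * cauchyKernel r (y - x) - 1) ∂σ₁
        = 2 * (∫ x, (v x : ℂ) * cauchyKernel r (y - x) ∂σ₁) - m := by
      intro y
      rw [hm, ← integral_complex_ofReal, ← integral_const_mul,
        ← integral_sub ((hint y).const_mul 2) hvi]
      congr 1; ext x; ring
    have hmk : m ^ k ≤ ∫ x, v x ^ k ∂σ₁ := by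
      simpa using integral_mul_pow_le (μ := σ₁) (ρ := fun _ => 1) (fun _ => zero_le_one)
        (integrable_const _) (by simp) hv hM hk
    have h1 := h r hr v hv ⟨M, hM⟩
    simp only [heq] at h1
    set a : UnitAddCircle → ℂ := fun y => ∫ x, (v x : ℂ) * cauchyKernel r (y - x) ∂σ₁ with ha
    -- Since $2a=(2a-m)+m$, the modulus of $a$ is at most the average of two moduli, hence at most
    -- their maximum; no power of 2 is lost.
    have hpt : ∀ y, ‖a y‖ ^ k ≤ ‖2 * a y - m‖ ^ k + m ^ k := by
      intro y
      have h2 : ‖a y‖ ≤ max ‖2 * a y - m‖ |m| := by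
        have h3 : 2 * ‖a y‖ ≤ ‖2 * a y - m‖ + |m| := by
          have := norm_add_le (2 * a y - m) (m : ℂ)
          rwa [sub_add_cancel, norm_mul, Complex.norm_ofNat, Complex.norm_real,
            Real.norm_eq_abs] at this
        rcases le_total ‖2 * a y - m‖ |m| with h4 | h4
        · rw [max_eq_right h4]; linarith
        · rw [max_eq_left h4]; linarith
      rw [← hkev.pow_abs m]
      refine (pow_le_pow_left₀ (norm_nonneg _) h2 k).trans ?_
      rcases le_total ‖2 * a y - m‖ |m| with h4 | h4
      · rw [max_eq_right h4]; exact le_add_of_nonneg_left (by positivity)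
      · rw [max_eq_left h4]; exact le_add_of_nonneg_right (by positivity)
    have hci : Integrable (fun y => ‖2 * a y - m‖ ^ k) σ₁ :=
      (((continuous_const.mul hcont).sub continuous_const).norm.pow
        k).integrable_of_hasCompactSupport (HasCompactSupport.of_compactSpace _)
    calc ∫ y, ‖a y‖ ^ k ∂σ₁ ≤ ∫ y, (‖2 * a y - m‖ ^ k + m ^ k) ∂σ₁ :=
          integral_mono_of_nonneg (Filter.Eventually.of_forall fun y => by positivity)
            (hci.add (integrable_const _)) (Filter.Eventually.of_forall hpt)
      _ = ∫ y, ‖2 * a y - m‖ ^ k ∂σ₁ + m ^ k := by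
          rw [integral_add hci (integrable_const _)]; simp
      _ ≤ (B + 1) * ∫ x, v x ^ k ∂σ₁ := by linarith
  -- The power comes from $(x+y)^k\le2^{k-1}(x^k+y^k)$, and the factor $2(B+1)$ from adding the
  -- bounds for the real and imaginary parts.
  refine ⟨2 ^ (k - 1) * (2 * (B + 1)), by positivity, fun r hr v hv ⟨M, hM⟩ => ?_⟩
  obtain ⟨c1, h1⟩ := hreal r hr (fun x => (v x).re) (Complex.measurable_re.comp hv)
    ⟨M, fun x => (Complex.abs_re_le_norm _).trans (hM x)⟩
  obtain ⟨c2, h2⟩ := hreal r hr (fun x => (v x).im) (Complex.measurable_im.comp hv)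
    ⟨M, fun x => (Complex.abs_im_le_norm _).trans (hM x)⟩
  have hvi : ∀ g : ℂ → ℝ, Measurable g → (∀ z, |g z| ≤ ‖z‖) →
      (∀ y, Integrable (fun x => (g (v x) : ℂ) * cauchyKernel r (y - x)) σ₁) ∧
      ∫ x, g (v x) ^ k ∂σ₁ ≤ ∫ x, ‖v x‖ ^ k ∂σ₁ := by
    intro g hg hgz
    refine ⟨fun y => integrable_mul_continuousMap (integrable_of_bdd (M := M)
      (Complex.measurable_ofReal.comp (hg.comp hv)).aestronglyMeasurable
        fun x => by simpa using (hgz _).trans (hM x))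
        ⟨fun x => cauchyKernel r (y - x),
        (continuous_cauchyKernel hr).comp (continuous_const.sub continuous_id)⟩, ?_⟩
    refine integral_mono_of_nonneg (Filter.Eventually.of_forall fun y => hkev.pow_nonneg _)
      (integrable_of_bdd (hv.norm.pow_const k).aestronglyMeasurable (M := M ^ k) fun x => ?_)
      (Filter.Eventually.of_forall fun x => ?_)
    · rw [norm_pow, norm_norm]
      exact pow_le_pow_left₀ (norm_nonneg _) (hM x) k
    · beta_reduce
      rw [← hkev.pow_abs]
      exact pow_le_pow_left₀ (abs_nonneg _) (hgz _) k
  obtain ⟨i1, l1⟩ := hvi Complex.re Complex.measurable_re Complex.abs_re_le_norm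
  obtain ⟨i2, l2⟩ := hvi Complex.im Complex.measurable_im Complex.abs_im_le_norm
  set a1 : UnitAddCircle → ℂ := fun y => ∫ x, ((v x).re : ℂ) * cauchyKernel r (y - x) ∂σ₁
  set a2 : UnitAddCircle → ℂ := fun y => ∫ x, ((v x).im : ℂ) * cauchyKernel r (y - x) ∂σ₁
  have hsplit : ∀ y, ∫ x, v x * cauchyKernel r (y - x) ∂σ₁ = a1 y + Complex.I * a2 y := by
    intro y
    simp only [a1, a2]
    rw [← integral_const_mul, ← integral_add (i1 y) ((i2 y).const_mul _)]
    refine integral_congr_ae (Filter.Eventually.of_forall fun x => ?_)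
    simp only
    rw [← mul_assoc, ← add_mul, mul_comm Complex.I, Complex.re_add_im]
  have j1 : Integrable (fun y => ‖a1 y‖ ^ k) σ₁ :=
    (c1.norm.pow k).integrable_of_hasCompactSupport (HasCompactSupport.of_compactSpace _)
  have j2 : Integrable (fun y => ‖a2 y‖ ^ k) σ₁ :=
    (c2.norm.pow k).integrable_of_hasCompactSupport (HasCompactSupport.of_compactSpace _)
  calc ∫ y, ‖∫ x, v x * cauchyKernel r (y - x) ∂σ₁‖ ^ k ∂σ₁
      ≤ ∫ y, 2 ^ (k - 1) * (‖a1 y‖ ^ k + ‖a2 y‖ ^ k) ∂σ₁ := by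
        refine integral_mono_of_nonneg (Filter.Eventually.of_forall fun y => by positivity)
          ((j1.add j2).const_mul _) (Filter.Eventually.of_forall fun y => ?_)
        simp only [hsplit]
        refine le_trans (pow_le_pow_left₀ (norm_nonneg _) ?_ k)
          (add_pow_le (norm_nonneg _) (norm_nonneg _) k)
        refine (norm_add_le _ _).trans ?_
        rw [norm_mul, Complex.norm_I, one_mul]
    _ = 2 ^ (k - 1) * (∫ y, ‖a1 y‖ ^ k ∂σ₁ + ∫ y, ‖a2 y‖ ^ k ∂σ₁) := by
        rw [integral_const_mul, integral_add j1 j2]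
    _ ≤ 2 ^ (k - 1) * ((B + 1) * ∫ x, ‖v x‖ ^ k ∂σ₁ + (B + 1) * ∫ x, ‖v x‖ ^ k ∂σ₁) := by
        have hB1 : 0 ≤ B + 1 := by linarith
        exact mul_le_mul_of_nonneg_left (add_le_add
          (h1.trans (mul_le_mul_of_nonneg_left l1 hB1))
          (h2.trans (mul_le_mul_of_nonneg_left l2 hB1))) (by positivity)
    _ = _ := by ring

/-! ## The Szegő projection on the polydisc -/

/-- The Szegő projection in the coordinates from `s`, evaluated on the torus of radius `r`. -/
def partialSzego {n : ℕ} (r : ℝ) (u : UnitAddTorus (Fin n) → ℂ) (s : Finset (Fin n))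
    (t : UnitAddTorus (Fin n)) : ℂ :=
  ∫ t' : UnitAddTorus (Fin n), u (fun i => if i ∈ s then t' i else t i) *
    ∏ i ∈ s, cauchyKernel r (t i - t' i) ∂(torusMeasure n)

section PartialSzego

variable {n : ℕ} {r : ℝ} {u : UnitAddTorus (Fin n) → ℂ} {M : ℝ}

lemma measurable_mix (s : Finset (Fin n)) :
    Measurable fun q : UnitAddTorus (Fin n) × UnitAddTorus (Fin n) =>
      (fun i => if i ∈ s then q.2 i else q.1 i : UnitAddTorus (Fin n)) := by
  refine measurable_pi_iff.2 fun i => ?_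
  by_cases hi : i ∈ s
  · simp only [hi, if_true]
    exact (measurable_pi_apply i).comp measurable_snd
  · simp only [hi, if_false]
    exact (measurable_pi_apply i).comp measurable_fst

lemma measurable_partialSzego_integrand (hr : r ∈ Ico (0 : ℝ) 1) (hu : Measurable u)
    (s : Finset (Fin n)) :
    Measurable fun q : UnitAddTorus (Fin n) × UnitAddTorus (Fin n) =>
      u (fun i => if i ∈ s then q.2 i else q.1 i) * ∏ i ∈ s, cauchyKernel r (q.1 i - q.2 i) := by
  refine (hu.comp (measurable_mix s)).mul (Finset.measurable_fun_prod _ fun i _ => ?_)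
  exact (continuous_cauchyKernel hr).measurable.comp
    (((measurable_pi_apply i).comp measurable_fst).sub
      ((measurable_pi_apply i).comp measurable_snd))

lemma norm_partialSzego_integrand_le (hr : r ∈ Ico (0 : ℝ) 1) (hM : ∀ t, ‖u t‖ ≤ M)
    (s : Finset (Fin n)) (t t' : UnitAddTorus (Fin n)) :
    ‖u (fun i => if i ∈ s then t' i else t i) * ∏ i ∈ s, cauchyKernel r (t i - t' i)‖
      ≤ M * ((1 - r)⁻¹) ^ s.card := by
  rw [norm_mul, norm_prod]
  refine mul_le_mul (hM _) ?_ (Finset.prod_nonneg fun i _ => norm_nonneg _)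
    ((norm_nonneg _).trans (hM t))
  rw [← Finset.prod_const]
  exact Finset.prod_le_prod (fun i _ => norm_nonneg _) fun i _ => norm_cauchyKernel_le hr _

lemma measurable_partialSzego (hr : r ∈ Ico (0 : ℝ) 1) (hu : Measurable u)
    (s : Finset (Fin n)) : Measurable (partialSzego r u s) :=
  (measurable_partialSzego_integrand hr hu s).stronglyMeasurable.integral_prod_right.measurable

lemma norm_partialSzego_le (hr : r ∈ Ico (0 : ℝ) 1) (hM : ∀ t, ‖u t‖ ≤ M)
    (s : Finset (Fin n)) (t : UnitAddTorus (Fin n)) :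
    ‖partialSzego r u s t‖ ≤ M * ((1 - r)⁻¹) ^ s.card := by
  have := norm_integral_le_of_norm_le_const (μ := torusMeasure n)
    (Filter.Eventually.of_forall (norm_partialSzego_integrand_le hr hM s t))
  simpa [partialSzego] using this

/-- The kernel is a product, so including one more coordinate means applying the one-variable Cauchy
integral to the slices of the previous partial projection. Boundedness of `u` and of the kernels for
fixed $r<1$ justifies Fubini. -/
lemma partialSzego_insert (hr : r ∈ Ico (0 : ℝ) 1) (hu : Measurable u) (hM : ∀ t, ‖u t‖ ≤ M)
    {s : Finset (Fin n)} {a : Fin n} (ha : a ∉ s) (t : UnitAddTorus (Fin n)) :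
    partialSzego r u (insert a s) t = ∫ x, partialSzego r u s (Function.update t a x) *
      cauchyKernel r (t a - x) ∂(AddCircle.haarAddCircle (T := 1)) := by
  set Ψ : UnitAddTorus (Fin n) → UnitAddCircle → ℂ := fun t' x =>
    (u (fun i => if i ∈ s then t' i else Function.update t a x i) *
      ∏ i ∈ s, cauchyKernel r (Function.update t a x i - t' i)) * cauchyKernel r (t a - x) with hΨ
  have hΨi : Integrable (Function.uncurry Ψ)
      ((torusMeasure n).prod (AddCircle.haarAddCircle (T := 1))) := by
    refine integrable_of_bdd (M := M * ((1 - r)⁻¹) ^ s.card * (1 - r)⁻¹) ?_ fun q => ?_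
    · have hupd : Measurable fun x : UnitAddCircle => Function.update t a x :=
        measurable_update t
      have h1 : Measurable fun q : UnitAddTorus (Fin n) × UnitAddCircle =>
          (Function.update t a q.2, q.1) := (hupd.comp measurable_snd).prodMk measurable_fst
      refine (((measurable_partialSzego_integrand hr hu s).comp h1).mul
        ((continuous_cauchyKernel hr).measurable.comp ?_)).aestronglyMeasurable
      exact measurable_const.sub measurable_snd
    · simp only [Function.uncurry, hΨ]
      rw [norm_mul]
      exact mul_le_mul (norm_partialSzego_integrand_le hr hM s _ _) (norm_cauchyKernel_le hr _)
        (norm_nonneg _) ((norm_nonneg _).trans (norm_partialSzego_integrand_le hr hM s t t))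
  have hL : partialSzego r u (insert a s) t
      = ∫ t', ∫ x, Ψ t' x ∂(AddCircle.haarAddCircle (T := 1)) ∂(torusMeasure n) := by
    have hint : Integrable (fun t' : UnitAddTorus (Fin n) =>
        u (fun i => if i ∈ insert a s then t' i else t i) *
          ∏ i ∈ insert a s, cauchyKernel r (t i - t' i)) (torusMeasure n) :=
      integrable_of_bdd ((measurable_partialSzego_integrand hr hu (insert a s)).comp
        measurable_prodMk_left).aestronglyMeasurable
          (norm_partialSzego_integrand_le hr hM (insert a s) t)
    rw [partialSzego, integral_torus_eq_integral_update a hint]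
    refine integral_congr_ae (Filter.Eventually.of_forall fun t' =>
      integral_congr_ae (Filter.Eventually.of_forall fun x => ?_))
    simp only [hΨ, Finset.prod_insert ha, Function.update_self]
    rw [mul_comm (cauchyKernel r (t a - x)), ← mul_assoc]
    congr 2
    · congr 1
      funext i
      by_cases hi : i = a
      · subst hi; simp [ha]
      · simp [hi]
    · refine Finset.prod_congr rfl fun i hi => ?_
      rw [Function.update_of_ne (ne_of_mem_of_not_mem hi ha),
        Function.update_of_ne (ne_of_mem_of_not_mem hi ha)]
  rw [hL, integral_integral_swap hΨi]
  refine integral_congr_ae (Filter.Eventually.of_forall fun x => ?_)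
  simp only [hΨ, partialSzego]
  rw [integral_mul_const]

/-- On each slice in the new coordinate the one-variable bound applies; integrating over the other
coordinates costs one factor $B$ per coordinate, independent of $r$. -/
lemma exists_integral_partialSzego_pow_le {k : ℕ} (hk : k = 2 ∨ k = 4) :
    ∃ B : ℝ, 0 ≤ B ∧ ∀ (n : ℕ) (r : ℝ), r ∈ Ico (0 : ℝ) 1 → ∀ u : UnitAddTorus (Fin n) → ℂ,
      Measurable u → (∃ M, ∀ t, ‖u t‖ ≤ M) → ∀ s : Finset (Fin n),
      ∫ t, ‖partialSzego r u s t‖ ^ k ∂(torusMeasure n)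
        ≤ B ^ s.card * ∫ t, ‖u t‖ ^ k ∂(torusMeasure n) := by
  obtain ⟨B, hB, h⟩ := exists_integral_cauchy_pow_le hk
  refine ⟨B, hB, fun n r hr u hu ⟨M, hM⟩ s => ?_⟩
  have hpow : ∀ s : Finset (Fin n), Integrable (fun t => ‖partialSzego r u s t‖ ^ k)
      (torusMeasure n) := fun s =>
    integrable_of_bdd (M := (M * ((1 - r)⁻¹) ^ s.card) ^ k)
      ((measurable_partialSzego hr hu s).norm.pow_const k).aestronglyMeasurable fun t => by
        rw [norm_pow, norm_norm]
        exact pow_le_pow_left₀ (norm_nonneg _) (norm_partialSzego_le hr hM s t) k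
  induction s using Finset.induction_on with
  | empty => simp [partialSzego]
  | insert a s ha ih =>
    have hs : ∫ t, ‖partialSzego r u (insert a s) t‖ ^ k ∂(torusMeasure n)
        ≤ B * ∫ t, ‖partialSzego r u s t‖ ^ k ∂(torusMeasure n) := by
      have hmp := measurePreserving_update n a
      rw [integral_torus_eq_integral_update a (hpow (insert a s)),
        integral_torus_eq_integral_update a (hpow s), ← integral_const_mul]
      have hint : ∀ s, Integrable (fun t => ∫ x, ‖partialSzego r u s (Function.update t a x)‖ ^ k
          ∂(AddCircle.haarAddCircle (T := 1))) (torusMeasure n) := fun s =>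
        (hmp.integrable_comp_of_integrable (hpow s)).integral_prod_left
      refine integral_mono (hint _) ((hint _).const_mul B) fun t => ?_
      have hupd : Measurable fun x : UnitAddCircle => Function.update t a x := measurable_update t
      have := h r hr (fun x => partialSzego r u s (Function.update t a x))
        ((measurable_partialSzego hr hu s).comp hupd)
        ⟨_, fun x => norm_partialSzego_le hr hM s _⟩
      simp only [partialSzego_insert hr hu hM ha, Function.update_idem, Function.update_self]
      exact this
    rw [Finset.card_insert_of_notMem ha, pow_succ']
    refine hs.trans ?_
    rw [mul_assoc]
    exact mul_le_mul_of_nonneg_left ih hB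

lemma partialSzego_univ (hr : r ∈ Ico (0 : ℝ) 1) (u : UnitAddTorus (Fin n) → ℂ)
    (t : UnitAddTorus (Fin n)) :
    partialSzego r u Finset.univ t = szegoProj n u (torusPoint r t) := by
  rw [szegoProj_apply u (torusPoint_mem hr t), partialSzego]
  refine integral_congr_ae (Filter.Eventually.of_forall fun t' => ?_)
  simp only [szegoKernel_apply (torusPoint_mem hr t), Finset.mem_univ, if_true]
  congr 1
  refine Finset.prod_congr rfl fun i _ => ?_
  rw [torusPoint, mul_assoc, toCircle_mul_toCircle_neg, cauchyKernel]

end PartialSzego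

/-- The Szegő projection is bounded from `L^2` to `H^2` and from `L^4` to `H^4`. -/
lemma exists_hardyNorm_szegoProj_le (n : ℕ) {k : ℕ} (hk : k = 2 ∨ k = 4) (A : ℝ) :
    ∃ D : ℝ, 0 ≤ D ∧ ∀ u : UnitAddTorus (Fin n) → ℂ, Measurable u → (∃ M, ∀ t, ‖u t‖ ≤ M) →
      ∫ t, ‖u t‖ ^ k ∂(torusMeasure n) ≤ A →
      hardyNorm n k (szegoProj n u) ≤ ENNReal.ofReal D := by
  obtain ⟨B, hB, h⟩ := exists_integral_partialSzego_pow_le hk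
  have hk0 : k ≠ 0 := by rcases hk with rfl | rfl <;> decide
  refine ⟨(B ^ n * max A 0) ^ ((k : ℝ)⁻¹), by positivity, fun u hu ⟨M, hM⟩ hA => ?_⟩
  refine iSup₂_le fun r hr => ?_
  have hui : Integrable u (torusMeasure n) := integrable_of_bdd hu.aestronglyMeasurable hM
  have hc := (szegoProj_isHolomorphic hui).continuous_slice hr
  have hmem : MemLp (fun t => szegoProj n u (torusPoint r t)) k (torusMeasure n) := by
    obtain ⟨C, hC⟩ := isCompact_univ.exists_bound_of_continuousOn hc.continuousOn
    exact MemLp.of_bound hc.aestronglyMeasurable C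
      (Filter.Eventually.of_forall fun t => hC t (mem_univ t))
  rw [hmem.eLpNorm_eq_integral_rpow_norm (by exact_mod_cast hk0) (ENNReal.natCast_ne_top k)]
  simp only [ENNReal.toReal_natCast, Real.rpow_natCast]
  refine ENNReal.ofReal_le_ofReal (Real.rpow_le_rpow (by positivity) ?_ (by positivity))
  have := h n r hr u hu ⟨M, hM⟩ Finset.univ
  simp only [partialSzego_univ hr, Finset.card_univ, Fintype.card_fin] at this
  exact this.trans (mul_le_mul_of_nonneg_left (hA.trans (le_max_left _ _)) (by positivity))

/-! ## Boundary values -/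

/-- Fatou's lemma along an almost everywhere convergent subsequence. Together with convexity it
makes this set weakly closed in $L^2$, so an $L^q$ bound survives a weak $L^2$ limit. -/
lemma isClosed_setOf_eLpNorm_le {X : Type*} [MeasurableSpace X] (μ : Measure X) (q N : ℝ≥0∞) :
    IsClosed {x : Lp ℂ 2 μ | eLpNorm x q μ ≤ N} := by
  refine IsSeqClosed.isClosed fun x y hx hxy => ?_
  obtain ⟨ns, -, hns⟩ := (tendstoInMeasure_of_tendsto_Lp hxy).exists_seq_tendsto_ae
  refine (Lp.eLpNorm_lim_le_liminf_eLpNorm (f := fun i => x (ns i))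
    (fun i => (Lp.aestronglyMeasurable _)) _ hns).trans ?_
  exact Filter.liminf_le_of_frequently_le' (Filter.Eventually.of_forall fun i => hx _).frequently

lemma convex_setOf_eLpNorm_le {X : Type*} [MeasurableSpace X] (μ : Measure X) {q : ℝ≥0∞}
    (hq : 1 ≤ q) (N : ℝ≥0∞) : Convex ℝ {x : Lp ℂ 2 μ | eLpNorm x q μ ≤ N} := by
  intro x hx y hy a b ha hb hab
  simp only [mem_ofPred_eq] at hx hy ⊢
  have h : (a • x + b • y : Lp ℂ 2 μ) =ᵐ[μ] a • (x : X → ℂ) + b • (y : X → ℂ) :=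
    (Lp.coeFn_add _ _).trans ((Lp.coeFn_smul a x).add (Lp.coeFn_smul b y))
  rw [eLpNorm_congr_ae h]
  refine (eLpNorm_add_le ((Lp.aestronglyMeasurable x).const_smul a)
    ((Lp.aestronglyMeasurable y).const_smul b) hq).trans ?_
  rw [eLpNorm_const_smul, eLpNorm_const_smul]
  calc ‖a‖ₑ * eLpNorm x q μ + ‖b‖ₑ * eLpNorm y q μ ≤ ‖a‖ₑ * N + ‖b‖ₑ * N := by gcongr
    _ = N := by
      rw [← add_mul, Real.enorm_of_nonneg ha, Real.enorm_of_nonneg hb, ← ENNReal.ofReal_add ha hb,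
        hab, ENNReal.ofReal_one, one_mul]

/-- A function in `H^q`, `q ≥ 2`, is the Szegő projection of a function in `L^q` with at most the
same norm. -/
lemma exists_eq_szegoProj {n : ℕ} {q : ℝ≥0∞} (hq : 2 ≤ q) {f : (Fin n → ℂ) → ℂ}
    (hf : f ∈ hardySpace n q) :
    ∃ φ : UnitAddTorus (Fin n) → ℂ, AEStronglyMeasurable φ (torusMeasure n) ∧
      eLpNorm φ q (torusMeasure n) ≤ hardyNorm n q f ∧
      Integrable φ (torusMeasure n) ∧ f = szegoProj n φ := by
  set μ := torusMeasure n with hμ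
  have hmem : ∀ r ∈ Ico (0 : ℝ) 1, MemLp (fun t => f (torusPoint r t)) 2 μ := fun r hr =>
    ⟨(hf.1.continuous_slice hr).aestronglyMeasurable,
      ((eLpNorm_le_eLpNorm_of_exponent_le hq
        (hf.1.continuous_slice hr).aestronglyMeasurable).trans
        (eLpNorm_slice_le_hardyNorm q f hr)).trans_lt hf.2⟩
  classical
  set g : ℝ → Lp ℂ 2 μ := fun r => if hr : r ∈ Ico (0 : ℝ) 1 then (hmem r hr).toLp _ else 0 with hg
  have hgae : ∀ r ∈ Ico (0 : ℝ) 1, g r =ᵐ[μ] fun t => f (torusPoint r t) := by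
    intro r hr
    simp only [hg, dif_pos hr]
    exact (hmem r hr).coeFn_toLp
  set S : Set (Lp ℂ 2 μ) := {x | eLpNorm x q μ ≤ hardyNorm n q f} with hS
  have hgS : ∀ r ∈ Ico (0 : ℝ) 1, g r ∈ S := by
    intro r hr
    rw [hS, mem_ofPred_eq, eLpNorm_congr_ae (hgae r hr)]
    exact eLpNorm_slice_le_hardyNorm q f hr
  have hgn : ∀ r ∈ Ico (0 : ℝ) 1, ‖g r‖ ≤ (hardyNorm n q f).toReal := by
    intro r hr
    rw [Lp.norm_def]
    refine ENNReal.toReal_mono hf.2.ne ?_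
    exact (eLpNorm_le_eLpNorm_of_exponent_le hq (Lp.aestronglyMeasurable _)).trans (hgS r hr)
  -- a weak limit point of the dilations
  set 𝒰 : Ultrafilter ℝ := Ultrafilter.of (nhdsWithin 1 (Iio 1))
  have h𝒰 : (𝒰 : Filter ℝ) ≤ nhdsWithin 1 (Iio 1) := Ultrafilter.of_le _
  have hev : ∀ᶠ r in (𝒰 : Filter ℝ), r ∈ Ioo (0 : ℝ) 1 :=
    h𝒰 (Ioo_mem_nhdsLT zero_lt_one)
  -- Banach–Alaoglu in the dual of the Hilbert space $L^2$, carried back by the Riesz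
  -- representation. Because $q\ge2$, the slices are bounded in $L^2$, and the Hilbert space setting
  -- is enough.
  obtain ⟨x, hx⟩ : ∃ x : Lp ℂ 2 μ, ∀ y : Lp ℂ 2 μ,
      Filter.Tendsto (fun r => inner ℂ y (g r)) 𝒰 (nhds (inner ℂ y x)) := by
    set G : ℝ → WeakDual ℂ (Lp ℂ 2 μ) := fun r =>
      StrongDual.toWeakDual (InnerProductSpace.toDual ℂ (Lp ℂ 2 μ) (g r))
    obtain ⟨ℓ, -, hℓ⟩ := (WeakDual.isCompact_closedBall (𝕜 := ℂ) (E := Lp ℂ 2 μ) 0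
      (hardyNorm n q f).toReal).ultrafilter_le_nhds (𝒰.map G) (by
        rw [Filter.le_principal_iff, Ultrafilter.mem_coe, Ultrafilter.mem_map]
        filter_upwards [hev] with r hr
        simp only [mem_preimage, mem_closedBall_zero_iff, G]
        change ‖InnerProductSpace.toDual ℂ (Lp ℂ 2 μ) (g r)‖ ≤ _
        rw [LinearIsometryEquiv.norm_map]
        exact hgn r ⟨hr.1.le, hr.2⟩)
    obtain ⟨x, hx⟩ := (InnerProductSpace.toDual ℂ (Lp ℂ 2 μ)).surjective (WeakDual.toStrongDual ℓ)
    refine ⟨x, fun y => ?_⟩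
    have h1 : Filter.Tendsto (fun r => G r y) 𝒰 (nhds (ℓ y)) :=
      ((WeakDual.eval_continuous y).tendsto ℓ).comp hℓ
    have h2 : ℓ y = inner ℂ x y := by
      rw [← InnerProductSpace.toDual_apply_apply, hx]; rfl
    rw [h2] at h1
    have h3 := (Complex.continuous_conj.tendsto _).comp h1
    rw [inner_conj_symm] at h3
    refine h3.congr fun r => ?_
    rw [Function.comp_apply, ← inner_conj_symm y (g r)]
    rfl
  -- A closed convex set is weakly closed: otherwise Hahn–Banach separates `x` strictly from `S`,
  -- against the convergence of the pairings.
  have hxS : x ∈ S := by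
    by_contra hxS
    obtain ⟨ℓ, c, h1, h2⟩ := RCLike.geometric_hahn_banach_closed_point (𝕜 := ℂ)
      (convex_setOf_eLpNorm_le μ (one_le_two.trans hq) _) (isClosed_setOf_eLpNorm_le μ _ _) hxS
    obtain ⟨y, rfl⟩ := (InnerProductSpace.toDual ℂ (Lp ℂ 2 μ)).surjective ℓ
    simp only [InnerProductSpace.toDual_apply_apply] at h1 h2
    have h3 := (Complex.continuous_re.tendsto _).comp (hx y)
    have h4 := le_of_tendsto h3 (b := c) (by
      filter_upwards [hev] with r hr
      exact (h1 _ (hgS r ⟨hr.1.le, hr.2⟩)).le)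
    exact absurd h2 (not_lt.2 h4)
  have hxi : Integrable x μ := (Lp.memLp x).integrable one_le_two
  refine ⟨x, Lp.aestronglyMeasurable x, hxS, hxi, ?_⟩
  funext w
  by_cases hw : w ∈ polydisc n
  swap
  · rw [hf.1.2 w hw, (szegoProj_isHolomorphic hxi).2 w hw]
  -- The inner product is conjugate linear in the first slot, so pairing with the conjugated kernel
  -- is the Szegő integral.
  set K : Lp ℂ 2 μ := ContinuousMap.toLp 2 μ ℂ (star (szegoKernel n w)) with hK
  have hinner : ∀ z : Lp ℂ 2 μ, inner ℂ K z = ∫ t, z t * szegoKernel n w t ∂μ := by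
    intro z
    rw [L2.inner_def]
    refine integral_congr_ae ?_
    filter_upwards [ContinuousMap.coeFn_toLp (p := 2) μ (𝕜 := ℂ) (star (szegoKernel n w))] with t ht
    rw [hK, ht]
    simp
  have h1 := hx K
  rw [hinner, ← szegoProj_apply _ hw] at h1
  -- As $r\to1$, $f(rw)$ tends to $f(w)$ by continuity and, through Cauchy's formula, to the Szegő
  -- integral of the weak limit.
  refine tendsto_nhds_unique (f := fun r : ℝ => f (fun i => r * w i)) (l := (𝒰 : Filter ℝ)) ?_
    (h1.congr' ?_)
  · have hcont : ContinuousAt (fun r : ℝ => f (fun i => r * w i)) 1 := by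
      refine ContinuousAt.comp (g := f) (f := fun r : ℝ => fun i => (r : ℂ) * w i) ?_
        (by fun_prop)
      have : (fun i => ((1 : ℝ) : ℂ) * w i) = w := by simp
      rw [this]
      exact (hf.1.1.differentiableAt ((isOpen_polydisc n).mem_nhds hw)).continuousAt
    have h2 := hcont.tendsto
    simp only [Complex.ofReal_one, one_mul] at h2
    exact h2.mono_left (h𝒰.trans nhdsWithin_le_nhds)
  · filter_upwards [hev] with r hr
    rw [hinner, ← integral_torus_mul_szegoKernel hf.1.1 hr.1 hr.2 hw]
    exact integral_congr_ae ((hgae r ⟨hr.1.le, hr.2⟩).mono fun t ht => by simp only [ht])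

/-! ## Bounded strip functions with values in `H^1` -/

/-- An element of Calderón's space for the couple `(H^1, H^2)` that takes values in `H^1` and has
norm at most `A` there, and whose boundary functions have norm at most `A`. -/
structure StripFunction (n : ℕ) (A : ℝ) where
  /-- The function on the strip. -/
  toFun : ℂ → HardyType n 1
  /-- The boundary function on `Re z = 0`. -/
  left : C₀(ℝ, HardyType n 1)
  /-- The boundary function on `Re z = 1`. -/
  right : C₀(ℝ, HardyType n 2)
  continuousOn : ContinuousOn toFun {z : ℂ | 0 ≤ z.re ∧ z.re ≤ 1}
  holomorphic : DifferentiableOn ℂ toFun {z : ℂ | 0 < z.re ∧ z.re < 1}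
  norm_le : ∀ z : ℂ, 0 ≤ z.re → z.re ≤ 1 → ‖toFun z‖ ≤ A
  norm_left_le : ‖left‖ ≤ A
  norm_right_le : ‖right‖ ≤ A
  left_eq : ∀ y : ℝ, toFun (y * Complex.I) = left y
  right_eq : ∀ y : ℝ, hardyIncl n 1 (toFun (1 + y * Complex.I)) = hardyIncl n 2 (right y)

/-- The function `v` on the polydisc is the value at `θ` of a strip function bounded by `A`. -/
def HasRep (n : ℕ) (θ A : ℝ) (v : (Fin n → ℂ) → ℂ) : Prop :=
  ∃ G : StripFunction n A, hardyIncl n 1 (G.toFun θ) = v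

/-- Multiplication of a strip function by a constant. -/
def StripFunction.smul {n : ℕ} {A : ℝ} (c : ℂ) (G : StripFunction n A) :
    StripFunction n (‖c‖ * A) where
  toFun z := c • G.toFun z
  left := c • G.left
  right := c • G.right
  continuousOn := G.continuousOn.const_smul c
  holomorphic := G.holomorphic.const_smul c
  norm_le z h0 h1 := by
    rw [norm_smul]
    exact mul_le_mul_of_nonneg_left (G.norm_le z h0 h1) (norm_nonneg c)
  norm_left_le := by
    rw [norm_smul]
    exact mul_le_mul_of_nonneg_left G.norm_left_le (norm_nonneg c)
  norm_right_le := by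
    rw [norm_smul]
    exact mul_le_mul_of_nonneg_left G.norm_right_le (norm_nonneg c)
  left_eq y := by rw [G.left_eq]; rfl
  right_eq y := by rw [map_smul, G.right_eq, ← map_smul]; rfl

lemma HasRep.smul {n : ℕ} {θ A : ℝ} {v : (Fin n → ℂ) → ℂ} (h : HasRep n θ A v) (c : ℂ) :
    HasRep n θ (‖c‖ * A) (c • v) := by
  obtain ⟨G, rfl⟩ := h
  exact ⟨G.smul c, map_smul _ _ _⟩

/-- Evaluation at a point, as a continuous linear map on `C₀(ℝ, E)`. -/
def zeroAtInftyEvalCLM (E : Type*) [NormedAddCommGroup E] [NormedSpace ℂ E] (y : ℝ) :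
    C₀(ℝ, E) →L[ℂ] E :=
  LinearMap.mkContinuous
    { toFun := fun f => f y
      map_add' := fun _ _ => rfl
      map_smul' := fun _ _ => rfl } 1 fun f => by
        rw [one_mul]
        exact f.toBCF.norm_coe_le_norm y

/-- The sum of a series of strip functions with summable bounds. -/
def StripFunction.tsum {n : ℕ} {ι : Type*} {A : ι → ℝ} (hA : Summable A)
    (G : ∀ i, StripFunction n (A i)) : StripFunction n (∑' i, A i) where
  toFun z := ∑' i, (G i).toFun z
  left := ∑' i, (G i).left
  right := ∑' i, (G i).right
  -- The bounds `A i` hold on the whole closed strip, so the series converges uniformly there.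
  continuousOn := continuousOn_tsum (fun i => (G i).continuousOn) hA
    fun i z hz => (G i).norm_le z hz.1 hz.2
  holomorphic := by
    refine Complex.differentiableOn_tsum_of_summable_norm hA (fun i => (G i).holomorphic) ?_
      fun i z hz => (G i).norm_le z hz.1.le hz.2.le
    exact (isOpen_lt continuous_const Complex.continuous_re).inter
      (isOpen_lt Complex.continuous_re continuous_const)
  norm_le z h0 h1 := tsum_of_norm_bounded hA.hasSum fun i => (G i).norm_le z h0 h1
  norm_left_le := tsum_of_norm_bounded hA.hasSum fun i => (G i).norm_left_le
  norm_right_le := tsum_of_norm_bounded hA.hasSum fun i => (G i).norm_right_le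
  left_eq y := by
    have hs : Summable fun i => (G i).left := .of_norm_bounded hA fun i => (G i).norm_left_le
    have h := (zeroAtInftyEvalCLM (HardyType n 1) y).map_tsum hs
    simp only [(G _).left_eq]
    exact h.symm
  right_eq y := by
    have hs : Summable fun i => (G i).right := .of_norm_bounded hA fun i => (G i).norm_right_le
    have h := (zeroAtInftyEvalCLM (HardyType n 2) y).map_tsum hs
    have hs1 : Summable fun i => (G i).toFun (1 + y * Complex.I) :=
      .of_norm_bounded hA fun i => (G i).norm_le _ (by simp) (by simp)
    have hs2 : Summable fun i => zeroAtInftyEvalCLM (HardyType n 2) y (G i).right :=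
      hs.map _ (zeroAtInftyEvalCLM (HardyType n 2) y).continuous
    change _ = hardyIncl n 2 (zeroAtInftyEvalCLM (HardyType n 2) y (∑' i, (G i).right))
    rw [h]
    -- The sums in $H^1$ and in $H^2$ are compared pointwise, evaluation being continuous on both
    -- spaces.
    funext w
    have e1 := (HardyType.evalCLM n 1 w).map_tsum hs1
    have e2 := (HardyType.evalCLM n 2 w).map_tsum hs2
    simp only [HardyType.evalCLM_apply] at e1 e2
    rw [e1, e2]
    exact tsum_congr fun i => congrFun ((G i).right_eq y) w

lemma HasRep.of_hasSum {n : ℕ} {θ : ℝ} (hθ0 : 0 ≤ θ) (hθ1 : θ ≤ 1) {ι : Type*} {A : ι → ℝ}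
    {S : ℝ} (hA : HasSum A S) {v : ι → (Fin n → ℂ) → ℂ} (hv : ∀ i, HasRep n θ (A i) (v i))
    {f : (Fin n → ℂ) → ℂ} (hf : ∀ w, HasSum (fun i => v i w) (f w)) :
    HasRep n θ S f := by
  choose G hG using hv
  rw [← hA.tsum_eq]
  refine ⟨StripFunction.tsum hA.summable G, ?_⟩
  funext w
  have hs : Summable fun i => (G i).toFun θ :=
    .of_norm_bounded hA.summable fun i => (G i).norm_le _ (by simpa using hθ0) (by simpa using hθ1)
  have e := (HardyType.evalCLM n 1 w).map_tsum hs
  simp only [HardyType.evalCLM_apply, hG] at e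
  rw [← (hf w).tsum_eq, ← e]
  rfl

/-- The sum map `(x₀, x₁) ↦ x₀ + x₁`, evaluated at a point. -/
def coupleEvalCLM (n : ℕ) (w : Fin n → ℂ) : WithLp 1 (HardyType n 1 × HardyType n 2) →L[ℂ] ℂ :=
  ((HardyType.evalCLM n 1 w).coprod (HardyType.evalCLM n 2 w)) ∘L
    (WithLp.prodContinuousLinearEquiv 1 ℂ (HardyType n 1) (HardyType n 2)).toContinuousLinearMap

lemma coupleEvalCLM_apply {n : ℕ} (w : Fin n → ℂ)
    (x : WithLp 1 (HardyType n 1 × HardyType n 2)) :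
    coupleEvalCLM n w x = coupleSum (hardyIncl n 1) (hardyIncl n 2) x w := rfl

/-- The kernel is cut out by the continuous evaluation functionals. Closedness makes the quotient
seminorm of the sum space a norm. -/
instance isClosed_ker_coupleSum (n : ℕ) :
    IsClosed (LinearMap.ker (coupleSum (hardyIncl n 1) (hardyIncl n 2)) :
      Set (WithLp 1 (HardyType n 1 × HardyType n 2))) := by
  have h : (LinearMap.ker (coupleSum (hardyIncl n 1) (hardyIncl n 2)) :
      Set (WithLp 1 (HardyType n 1 × HardyType n 2))) = ⋂ w, {x | coupleEvalCLM n w x = 0} := by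
    ext x
    simp only [SetLike.mem_coe, LinearMap.mem_ker, mem_iInter, mem_ofPred_eq, coupleEvalCLM_apply]
    exact funext_iff
  rw [h]
  exact isClosed_iInter fun w => isClosed_eq (coupleEvalCLM n w).continuous continuous_const

/-- The embedding of `H^1` into the sum space. -/
def sumSpaceInl (n : ℕ) :
    HardyType n 1 →L[ℂ] SumSpace (hardyIncl n 1) (hardyIncl n 2) :=
  LinearMap.mkContinuous
    ((LinearMap.ker (coupleSum (hardyIncl n 1) (hardyIncl n 2))).mkQ ∘ₗ
      (WithLp.linearEquiv 1 ℂ (HardyType n 1 × HardyType n 2)).symm.toLinearMap ∘ₗ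
        LinearMap.inl ℂ (HardyType n 1) (HardyType n 2)) 1 fun f => by
      refine (Submodule.Quotient.norm_mk_le _ _).trans ?_
      simp

lemma val_sumSpaceInl {n : ℕ} (f : HardyType n 1) :
    SumSpace.val (hardyIncl n 1) (hardyIncl n 2) (sumSpaceInl n f) = hardyIncl n 1 f := by
  change coupleSum (hardyIncl n 1) (hardyIncl n 2) (WithLp.toLp 1 (f, 0)) = _
  simp [coupleSum]

/-- A strip function, as an element of Calderón's space. -/
def StripFunction.toCalderon {n : ℕ} {A : ℝ} (G : StripFunction n A) :
    CalderonFunction (hardyIncl n 1) (hardyIncl n 2) where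
  toFun z := sumSpaceInl n (G.toFun z)
  left := G.left
  right := G.right
  continuousOn := (sumSpaceInl n).continuous.comp_continuousOn G.continuousOn
  bounded := ⟨‖sumSpaceInl n‖ * A, fun z h0 h1 => ((sumSpaceInl n).le_opNorm _).trans
    (mul_le_mul_of_nonneg_left (G.norm_le z h0 h1) (norm_nonneg _))⟩
  holomorphic := (sumSpaceInl n).differentiable.comp_differentiableOn G.holomorphic
  left_eq y := by rw [val_sumSpaceInl, G.left_eq]
  right_eq y := by rw [val_sumSpaceInl, G.right_eq]

lemma HasRep.mem_complexInterp {n : ℕ} {θ A : ℝ} {v : (Fin n → ℂ) → ℂ} (h : HasRep n θ A v) :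
    v ∈ complexInterp (hardyIncl n 1) (hardyIncl n 2) θ := by
  obtain ⟨G, rfl⟩ := h
  exact ⟨G.toCalderon, val_sumSpaceInl (G.toFun θ)⟩

lemma HasRep.complexInterpNorm_le {n : ℕ} {θ A : ℝ} {v : (Fin n → ℂ) → ℂ} (h : HasRep n θ A v) :
    complexInterpNorm (hardyIncl n 1) (hardyIncl n 2) θ v ≤ ENNReal.ofReal A := by
  obtain ⟨G, rfl⟩ := h
  refine (iInf₂_le G.toCalderon (val_sumSpaceInl (G.toFun θ))).trans (max_le ?_ ?_)
  · rw [← ofReal_norm]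
    exact ENNReal.ofReal_le_ofReal G.norm_left_le
  · rw [← ofReal_norm]
    exact ENNReal.ofReal_le_ofReal G.norm_right_le

/-! ## Products of Szegő projections of simple functions -/

lemma hardyNorm_mul_le {n : ℕ} {p q r : ℝ≥0∞} [ENNReal.HolderTriple p q r]
    {f g : (Fin n → ℂ) → ℂ} (hf : IsHolomorphicOnPolydisc n f)
    (hg : IsHolomorphicOnPolydisc n g) :
    hardyNorm n r (f * g) ≤ hardyNorm n p f * hardyNorm n q g := by
  refine iSup₂_le fun s hs => ?_
  refine le_trans ?_ (mul_le_mul' (eLpNorm_slice_le_hardyNorm p f hs)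
    (eLpNorm_slice_le_hardyNorm q g hs))
  have h := eLpNorm_smul_le_mul_eLpNorm (p := p) (q := q) (r := r)
    (hg.continuous_slice hs).aestronglyMeasurable (μ := torusMeasure n)
    (hf.continuous_slice hs).aestronglyMeasurable
  exact h

lemma IsHolomorphicOnPolydisc.mul {n : ℕ} {f g : (Fin n → ℂ) → ℂ}
    (hf : IsHolomorphicOnPolydisc n f) (hg : IsHolomorphicOnPolydisc n g) :
    IsHolomorphicOnPolydisc n (f * g) :=
  ⟨hf.1.mul hg.1, fun z hz => by simp [hf.2 z hz]⟩

instance holderTriple_four_four_two : ENNReal.HolderTriple 4 4 2 where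
  inv_add_inv_eq_inv := by
    rw [show (4 : ℝ≥0∞) = 2 * 2 by norm_num, ENNReal.mul_inv (by simp) (by simp), ← mul_add,
      ENNReal.inv_two_add_inv_two, mul_one]

lemma hardyNorm_toReal_mono {n : ℕ} {p q : ℝ≥0∞} [Fact (1 ≤ q)] (h : p ≤ q)
    (f : HardyType n q) :
    hardyNorm n p (hardyIncl n q f) < ∞ ∧ (hardyNorm n p (hardyIncl n q f)).toReal ≤ ‖f‖ := by
  have h := hardyNorm_mono_exponent h (hardyIncl_mem f).1
  exact ⟨h.trans_lt (hardyIncl_mem f).2, ENNReal.toReal_mono (hardyIncl_mem f).2.ne h⟩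

/-- The inclusion of `H^q` into `H^p`, for `p ≤ q`. -/
def HardyType.inclCLM (n : ℕ) {p q : ℝ≥0∞} [Fact (1 ≤ p)] [Fact (1 ≤ q)] (h : p ≤ q) :
    HardyType n q →L[ℂ] HardyType n p :=
  LinearMap.mkContinuous
    { toFun := fun f => HardyType.mk (hardyIncl n q f)
        ⟨(hardyIncl_mem f).1, (hardyNorm_toReal_mono h f).1⟩
      map_add' := fun _ _ => rfl
      map_smul' := fun _ _ => rfl } 1 fun f => by
        rw [one_mul, HardyType.norm_def]
        exact (hardyNorm_toReal_mono h f).2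

lemma HardyType.hardyIncl_inclCLM {n : ℕ} {p q : ℝ≥0∞} [Fact (1 ≤ p)] [Fact (1 ≤ q)] (h : p ≤ q)
    (f : HardyType n q) : hardyIncl n p (HardyType.inclCLM n h f) = hardyIncl n q f := rfl

/-- The entire function `z ↦ (c / |c|) |c| ^ (p (1 - z / 2))`, and `0` for `c = 0`. -/
def powerFamily (p : ℝ) (c z : ℂ) : ℂ :=
  if c = 0 then 0 else (c / ‖c‖) * Complex.exp (p * (1 - z / 2) * Real.log ‖c‖)

lemma differentiable_powerFamily (p : ℝ) (c : ℂ) : Differentiable ℂ (powerFamily p c) := by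
  unfold powerFamily
  split_ifs
  · exact differentiable_const 0
  · fun_prop

lemma norm_powerFamily {p : ℝ} {c : ℂ} (hc : c ≠ 0) (z : ℂ) :
    ‖powerFamily p c z‖ = ‖c‖ ^ (p * (1 - z.re / 2)) := by
  have hpos : 0 < ‖c‖ := norm_pos_iff.2 hc
  rw [powerFamily, if_neg hc, norm_mul, norm_div, Complex.norm_real, norm_norm, div_self hpos.ne',
    one_mul, Complex.norm_exp, Real.rpow_def_of_pos hpos]
  congr 1
  rw [Complex.re_mul_ofReal, Complex.re_ofReal_mul]
  simp
  ring

lemma powerFamily_eq_self {p θ : ℝ} (hp : p * (1 - θ / 2) = 1) (c : ℂ) :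
    powerFamily p c θ = c := by
  by_cases hc : c = 0
  · simp [powerFamily, hc]
  have hpos : 0 < ‖c‖ := norm_pos_iff.2 hc
  have h1 : (p : ℂ) * (1 - θ / 2) = 1 := by exact_mod_cast hp
  rw [powerFamily, if_neg hc, h1, one_mul, ← Complex.ofReal_exp, Real.exp_log hpos]
  have : (‖c‖ : ℂ) ≠ 0 := by exact_mod_cast hpos.ne'
  field_simp

/-- The exponent $a=kp(1-\operatorname{Re}z/2)$ lies in $[0,2p]$, where $x^a\le1+x^{2p}$. The
condition on `k` allows $k=2$ throughout the strip and $k=4$ on its right edge. -/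
lemma norm_powerFamily_pow_le {p : ℝ} (hp : 0 < p) (c : ℂ) {z : ℂ} (hz : z.re ≤ 1) {k : ℕ}
    (hk : k * (1 - z.re / 2) ≤ 2) :
    ‖powerFamily p c z‖ ^ k ≤ 1 + ‖c‖ ^ (2 * p) := by
  by_cases hc : c = 0
  · have h0 : (0 : ℝ) ≤ ‖c‖ ^ (2 * p) := by positivity
    have : ‖powerFamily p c z‖ ^ k ≤ 1 := by
      simp only [powerFamily, if_pos hc, norm_zero]
      exact pow_le_one₀ le_rfl zero_le_one
    linarith
  have hpos : 0 < ‖c‖ := norm_pos_iff.2 hc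
  rw [norm_powerFamily hc, ← Real.rpow_natCast, ← Real.rpow_mul hpos.le]
  have he : p * (1 - z.re / 2) * k ≤ 2 * p := by nlinarith
  have he0 : 0 ≤ p * (1 - z.re / 2) * k := by
    have : 0 ≤ 1 - z.re / 2 := by linarith
    positivity
  rcases le_total ‖c‖ 1 with h | h
  · have := Real.rpow_le_one hpos.le h he0
    have h0 : (0 : ℝ) ≤ ‖c‖ ^ (2 * p) := by positivity
    linarith
  · have := Real.rpow_le_rpow_of_exponent_le h he
    linarith

/-- The family of simple functions obtained by applying `powerFamily` to the values of `ψ`. -/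
def simplePower {n : ℕ} (p : ℝ) (ψ : SimpleFunc (UnitAddTorus (Fin n)) ℂ) (z : ℂ) :
    SimpleFunc (UnitAddTorus (Fin n)) ℂ := ψ.map fun c => powerFamily p c z

lemma SimpleFunc.integrable_of_isFiniteMeasure {n : ℕ}
    (ψ : SimpleFunc (UnitAddTorus (Fin n)) ℂ) : Integrable ψ (torusMeasure n) := by
  obtain ⟨M, hM⟩ := ψ.exists_forall_norm_le
  exact integrable_of_bdd ψ.aestronglyMeasurable hM

lemma integral_simplePower_pow_le {n : ℕ} {p : ℝ} (hp : 0 < p)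
    {ψ : SimpleFunc (UnitAddTorus (Fin n)) ℂ}
    (hψ : ∫ t, ‖ψ t‖ ^ (2 * p) ∂(torusMeasure n) ≤ 1) {z : ℂ} (hz : z.re ≤ 1) {k : ℕ}
    (hk : k * (1 - z.re / 2) ≤ 2) :
    ∫ t, ‖simplePower p ψ z t‖ ^ k ∂(torusMeasure n) ≤ 2 := by
  obtain ⟨M, hM⟩ := ψ.exists_forall_norm_le
  have hi : Integrable (fun t => ‖ψ t‖ ^ (2 * p)) (torusMeasure n) :=
    integrable_of_bdd (M := M ^ (2 * p)) (ψ.measurable.norm.pow_const _).aestronglyMeasurable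
      fun t => by
        rw [Real.norm_of_nonneg (by positivity)]
        exact Real.rpow_le_rpow (norm_nonneg _) (hM t) (by positivity)
  calc ∫ t, ‖simplePower p ψ z t‖ ^ k ∂(torusMeasure n)
      ≤ ∫ t, (1 + ‖ψ t‖ ^ (2 * p)) ∂(torusMeasure n) :=
        integral_mono_of_nonneg (Filter.Eventually.of_forall fun t => by positivity)
          ((integrable_const _).add hi) (Filter.Eventually.of_forall fun t =>
            norm_powerFamily_pow_le hp (ψ t) hz hk)
    _ = 1 + ∫ t, ‖ψ t‖ ^ (2 * p) ∂(torusMeasure n) := by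
        rw [integral_add (integrable_const _) hi]; simp
    _ ≤ 2 := by linarith

/-- The Szegő projection of the indicator function of a level set of `ψ`. -/
def szegoLevel {n : ℕ} (ψ : SimpleFunc (UnitAddTorus (Fin n)) ℂ) (c : ℂ) : (Fin n → ℂ) → ℂ :=
  szegoProj n ((ψ ⁻¹' {c}).indicator fun _ => 1)

lemma szegoLevel_mem {n : ℕ} (ψ : SimpleFunc (UnitAddTorus (Fin n)) ℂ) (c : ℂ) :
    IsHolomorphicOnPolydisc n (szegoLevel ψ c) ∧ hardyNorm n 4 (szegoLevel ψ c) < ∞ := by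
  have hmeas : Measurable ((ψ ⁻¹' {c}).indicator fun _ => (1 : ℂ)) :=
    measurable_const.indicator (ψ.measurableSet_preimage _)
  have hb : ∀ t, ‖(ψ ⁻¹' {c}).indicator (fun _ => (1 : ℂ)) t‖ ≤ 1 := fun t =>
    (norm_indicator_le_norm_self _ t).trans (by simp)
  refine ⟨szegoProj_isHolomorphic (integrable_of_bdd hmeas.aestronglyMeasurable hb), ?_⟩
  obtain ⟨D, -, hD⟩ := exists_hardyNorm_szegoProj_le n (k := 4) (Or.inr rfl)
    (∫ t, ‖(ψ ⁻¹' {c}).indicator (fun _ => (1 : ℂ)) t‖ ^ 4 ∂(torusMeasure n))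
  exact (hD _ hmeas ⟨1, hb⟩ le_rfl).trans_lt ENNReal.ofReal_lt_top

/-- Simple functions make the dependence on $z$ elementary: finitely many fixed functions with
entire scalar coefficients. -/
lemma szegoProj_simplePower {n : ℕ} (p : ℝ) (ψ : SimpleFunc (UnitAddTorus (Fin n)) ℂ) (z : ℂ)
    (w : Fin n → ℂ) :
    szegoProj n (simplePower p ψ z) w = ∑ c ∈ ψ.range, powerFamily p c z * szegoLevel ψ c w := by
  have hi : ∀ c, Integrable ((ψ ⁻¹' {c}).indicator fun _ => (1 : ℂ)) (torusMeasure n) := fun c =>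
    (integrable_const _).indicator (ψ.measurableSet_preimage _)
  simp only [szegoLevel]
  rw [← szegoProj_sum ψ.range hi]
  congr 1
  funext t
  rw [Finset.sum_eq_single (ψ t)]
  · simp [simplePower]
  · intro c _ hc
    rw [indicator_of_notMem, mul_zero]
    exact fun h => hc h.symm
  · intro h
    exact absurd (ψ.mem_range_self t) h

/-- The product of two level functions, as an element of `H^2`. -/
def levelProduct {n : ℕ} (ψ χ : SimpleFunc (UnitAddTorus (Fin n)) ℂ) (c d : ℂ) : HardyType n 2 :=
  HardyType.mk (szegoLevel ψ c * szegoLevel χ d)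
    ⟨(szegoLevel_mem ψ c).1.mul (szegoLevel_mem χ d).1,
      (hardyNorm_mul_le (p := 4) (q := 4) (szegoLevel_mem ψ c).1 (szegoLevel_mem χ d).1).trans_lt
        (ENNReal.mul_lt_top (szegoLevel_mem ψ c).2 (szegoLevel_mem χ d).2)⟩

lemma hardyIncl_levelProduct {n : ℕ} (ψ χ : SimpleFunc (UnitAddTorus (Fin n)) ℂ) (c d : ℂ)
    (w : Fin n → ℂ) :
    hardyIncl n 2 (levelProduct ψ χ c d) w = szegoLevel ψ c w * szegoLevel χ d w := rfl

/-- The scalar coefficients of `productFamily`. -/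
def productCoeff (θ p : ℝ) (c d z : ℂ) : ℂ :=
  Complex.exp (z ^ 2 - θ ^ 2) * (powerFamily p c z * powerFamily p d z)

/-- The entire `H^2`-valued function
`z ↦ exp (z ^ 2 - θ ^ 2) • (szegoProj (simplePower p ψ z) * szegoProj (simplePower p χ z))`. -/
def productFamily {n : ℕ} (θ p : ℝ) (ψ χ : SimpleFunc (UnitAddTorus (Fin n)) ℂ) (z : ℂ) :
    HardyType n 2 :=
  ∑ c ∈ ψ.range, ∑ d ∈ χ.range, productCoeff θ p c d z • levelProduct ψ χ c d

lemma hardyIncl_productFamily {n : ℕ} (θ p : ℝ) (ψ χ : SimpleFunc (UnitAddTorus (Fin n)) ℂ)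
    (z : ℂ) :
    hardyIncl n 2 (productFamily θ p ψ χ z) = Complex.exp (z ^ 2 - θ ^ 2) •
      (szegoProj n (simplePower p ψ z) * szegoProj n (simplePower p χ z)) := by
  funext w
  simp only [productFamily, map_sum, map_smul, Finset.sum_apply, Pi.smul_apply, Pi.mul_apply,
    szegoProj_simplePower, smul_eq_mul]
  rw [Finset.sum_mul_sum, Finset.mul_sum]
  refine Finset.sum_congr rfl fun c _ => ?_
  rw [Finset.mul_sum]
  refine Finset.sum_congr rfl fun d _ => ?_
  refine (congrArg (productCoeff θ p c d z * ·) (hardyIncl_levelProduct ψ χ c d w)).trans ?_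
  rw [productCoeff]
  ring

lemma differentiable_productFamily {n : ℕ} (θ p : ℝ)
    (ψ χ : SimpleFunc (UnitAddTorus (Fin n)) ℂ) : Differentiable ℂ (productFamily θ p ψ χ) := by
  refine Differentiable.fun_sum fun c _ => Differentiable.fun_sum fun d _ => ?_
  refine Differentiable.smul_const ?_ _
  have h1 := differentiable_powerFamily p c
  have h2 := differentiable_powerFamily p d
  unfold productCoeff
  fun_prop

/-- This factor supplies the decay at infinity required of the boundary functions, and it equals 1
at $\theta$. -/
lemma norm_exp_sq_sub_le (θ : ℝ) {s : ℝ} (hs0 : 0 ≤ s) (hs1 : s ≤ 1) (z : ℂ) (hz : z.re = s) :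
    ‖Complex.exp (z ^ 2 - θ ^ 2)‖ ≤ Real.exp 1 * Real.exp (-z.im ^ 2) := by
  rw [Complex.norm_exp, ← Real.exp_add]
  refine Real.exp_le_exp.2 ?_
  have h1 : (z ^ 2 - (θ : ℂ) ^ 2).re = z.re ^ 2 - z.im ^ 2 - θ ^ 2 := by
    rw [← Complex.ofReal_pow, Complex.sub_re, Complex.ofReal_re, pow_two z, Complex.mul_re]
    ring
  rw [h1, hz]
  nlinarith [sq_nonneg θ]

lemma tendsto_productFamily {n : ℕ} (θ : ℝ) {p : ℝ} (hp : 0 < p)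
    (ψ χ : SimpleFunc (UnitAddTorus (Fin n)) ℂ) {s : ℝ} (hs0 : 0 ≤ s) (hs1 : s ≤ 1) :
    Filter.Tendsto (fun y : ℝ => productFamily θ p ψ χ (s + y * Complex.I)) (Filter.cocompact ℝ)
      (nhds 0) := by
  have hgauss : Filter.Tendsto (fun y : ℝ => Real.exp (-y ^ 2)) (Filter.cocompact ℝ)
      (nhds 0) := by
    refine Real.tendsto_exp_atBot.comp (Filter.tendsto_neg_atTop_atBot.comp ?_)
    have := (Filter.tendsto_pow_atTop (α := ℝ) two_ne_zero).comp
      (tendsto_norm_cocompact_atTop (E := ℝ))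
    refine this.congr fun y => ?_
    simp
  suffices hterm : ∀ c d : ℂ, Filter.Tendsto (fun y : ℝ => productCoeff θ p c d
      (s + y * Complex.I) • levelProduct ψ χ c d) (Filter.cocompact ℝ) (nhds 0) by
    have := tendsto_finsetSum ψ.range fun c _ => tendsto_finsetSum χ.range fun d _ => hterm c d
    simp only [Finset.sum_const_zero] at this
    exact this
  intro c d
  rw [← zero_smul ℂ (levelProduct ψ χ c d)]
  refine Filter.Tendsto.smul_const ?_ _
  refine squeeze_zero_norm (a := fun y : ℝ => Real.exp 1 * Real.exp (-y ^ 2) *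
    ((1 + ‖c‖ ^ (2 * p)) * (1 + ‖d‖ ^ (2 * p)))) (fun y => ?_) ?_
  · have hre : ((s : ℂ) + y * Complex.I).re = s := by simp
    have him : ((s : ℂ) + y * Complex.I).im = y := by simp
    have hb : ∀ c, ‖powerFamily p c (s + y * Complex.I)‖ ≤ 1 + ‖c‖ ^ (2 * p) := fun c => by
      have := norm_powerFamily_pow_le hp c (z := s + y * Complex.I) (k := 1) (by rw [hre]; exact hs1)
        (by rw [hre]; push_cast; linarith)
      simpa using this
    rw [productCoeff, norm_mul, norm_mul]
    have h1 := norm_exp_sq_sub_le θ hs0 hs1 _ hre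
    rw [him] at h1
    exact mul_le_mul h1 (mul_le_mul (hb c) (hb d) (norm_nonneg _) (by positivity))
      (by positivity) (by positivity)
  · have := (hgauss.const_mul (Real.exp 1)).mul_const ((1 + ‖c‖ ^ (2 * p)) * (1 + ‖d‖ ^ (2 * p)))
    simpa using this

/-- Hölder's inequality: two $H^2$ bounds give an $H^1$ bound on the whole strip, and two $H^4$
bounds give an $H^2$ bound on the right edge. The constant comes only from the bounds of the Szegő
projection on $L^2$ and $L^4$, so it does not depend on the simple functions. -/
lemma exists_hardyNorm_productFamily_le (n : ℕ) (θ : ℝ) {p : ℝ} (hp : 0 < p) :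
    ∃ K : ℝ, 0 ≤ K ∧ ∀ ψ χ : SimpleFunc (UnitAddTorus (Fin n)) ℂ,
      ∫ t, ‖ψ t‖ ^ (2 * p) ∂(torusMeasure n) ≤ 1 → ∫ t, ‖χ t‖ ^ (2 * p) ∂(torusMeasure n) ≤ 1 →
      (∀ z : ℂ, 0 ≤ z.re → z.re ≤ 1 →
        hardyNorm n 1 (hardyIncl n 2 (productFamily θ p ψ χ z)) ≤ ENNReal.ofReal K) ∧
      ∀ z : ℂ, z.re = 1 →
        hardyNorm n 2 (hardyIncl n 2 (productFamily θ p ψ χ z)) ≤ ENNReal.ofReal K := by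
  obtain ⟨D, hD0, hD⟩ := exists_hardyNorm_szegoProj_le n (k := 2) (Or.inl rfl) 2
  obtain ⟨D', hD'0, hD'⟩ := exists_hardyNorm_szegoProj_le n (k := 4) (Or.inr rfl) 2
  have hexp : ∀ z : ℂ, 0 ≤ z.re → z.re ≤ 1 →
      ‖Complex.exp (z ^ 2 - θ ^ 2)‖ₑ ≤ ENNReal.ofReal (Real.exp 1) := by
    intro z h0 h1
    rw [← ofReal_norm]
    refine ENNReal.ofReal_le_ofReal ((norm_exp_sq_sub_le θ h0 h1 z rfl).trans ?_)
    refine mul_le_of_le_one_right (by positivity) (Real.exp_le_one_iff.2 ?_)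
    nlinarith [sq_nonneg z.im]
  have hhol : ∀ ψ : SimpleFunc (UnitAddTorus (Fin n)) ℂ,
      IsHolomorphicOnPolydisc n (szegoProj n ψ) := fun ψ =>
    szegoProj_isHolomorphic (SimpleFunc.integrable_of_isFiniteMeasure ψ)
  refine ⟨Real.exp 1 * (max D D' * max D D'), by positivity, fun ψ χ hψ hχ =>
    ⟨fun z h0 h1 => ?_, fun z h1 => ?_⟩⟩ <;>
  rw [hardyIncl_productFamily, hardyNorm_const_smul, ENNReal.ofReal_mul (by positivity),
    ENNReal.ofReal_mul (by positivity)]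
  · have hk : ((2 : ℕ) : ℝ) * (1 - z.re / 2) ≤ 2 := by push_cast; linarith
    have hb : ∀ ψ : SimpleFunc (UnitAddTorus (Fin n)) ℂ,
        ∫ t, ‖ψ t‖ ^ (2 * p) ∂(torusMeasure n) ≤ 1 →
        hardyNorm n 2 (szegoProj n (simplePower p ψ z)) ≤ ENNReal.ofReal (max D D') := by
      intro ψ hψ
      refine le_trans ?_ (ENNReal.ofReal_le_ofReal (le_max_left _ _))
      exact_mod_cast hD _ (simplePower p ψ z).measurable (simplePower p ψ z).exists_forall_norm_le
        (integral_simplePower_pow_le hp hψ h1 hk)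
    exact mul_le_mul' (hexp z h0 h1) ((hardyNorm_mul_le (p := 2) (q := 2) (hhol _) (hhol _)).trans
      (mul_le_mul' (hb ψ hψ) (hb χ hχ)))
  · have hk : ((4 : ℕ) : ℝ) * (1 - z.re / 2) ≤ 2 := by rw [h1]; norm_num
    have hb : ∀ ψ : SimpleFunc (UnitAddTorus (Fin n)) ℂ,
        ∫ t, ‖ψ t‖ ^ (2 * p) ∂(torusMeasure n) ≤ 1 →
        hardyNorm n 4 (szegoProj n (simplePower p ψ z)) ≤ ENNReal.ofReal (max D D') := by
      intro ψ hψ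
      refine le_trans ?_ (ENNReal.ofReal_le_ofReal (le_max_right _ _))
      exact_mod_cast hD' _ (simplePower p ψ z).measurable (simplePower p ψ z).exists_forall_norm_le
        (integral_simplePower_pow_le hp hψ h1.le hk)
    exact mul_le_mul' (hexp z (by rw [h1]; exact zero_le_one) h1.le)
      ((hardyNorm_mul_le (p := 4) (q := 4) (hhol _) (hhol _)).trans
      (mul_le_mul' (hb ψ hψ) (hb χ hχ)))

/-- The product of the Szegő projections of two simple functions in the unit ball of `L^{2p}`
is represented by a strip function with a uniform bound. -/
lemma exists_hasRep_szegoProj_mul_of_le_one (n : ℕ) {θ p : ℝ} (hp : 0 < p)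
    (hpθ : p * (1 - θ / 2) = 1) :
    ∃ K : ℝ, 0 ≤ K ∧ ∀ ψ χ : SimpleFunc (UnitAddTorus (Fin n)) ℂ,
      ∫ t, ‖ψ t‖ ^ (2 * p) ∂(torusMeasure n) ≤ 1 → ∫ t, ‖χ t‖ ^ (2 * p) ∂(torusMeasure n) ≤ 1 →
      HasRep n θ K (szegoProj n ψ * szegoProj n χ) := by
  obtain ⟨K, hK, h⟩ := exists_hardyNorm_productFamily_le n θ hp
  refine ⟨K, hK, fun ψ χ hψ hχ => ?_⟩
  obtain ⟨h1, h2⟩ := h ψ χ hψ hχ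
  have hdiff := differentiable_productFamily θ p ψ χ
  have hline : ∀ s : ℝ, Continuous fun y : ℝ => productFamily θ p ψ χ (s + y * Complex.I) :=
    fun s => hdiff.continuous.comp (by fun_prop)
  have h12 : (1 : ℝ≥0∞) ≤ 2 := one_le_two
  have hJ := (HardyType.inclCLM n h12).continuous
  have hnorm : ∀ z : ℂ, 0 ≤ z.re → z.re ≤ 1 →
      ‖HardyType.inclCLM n h12 (productFamily θ p ψ χ z)‖ ≤ K := fun z hz0 hz1 =>
    HardyType.norm_le hK (by rw [HardyType.hardyIncl_inclCLM]; exact h1 z hz0 hz1)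
  let L : C₀(ℝ, HardyType n 1) :=
    { toFun := fun y => HardyType.inclCLM n h12 (productFamily θ p ψ χ ((0 : ℝ) + y * Complex.I))
      continuous_toFun := hJ.comp (hline 0)
      zero_at_infty' := by
        have := (hJ.tendsto 0).comp (tendsto_productFamily θ hp ψ χ le_rfl zero_le_one)
        rwa [map_zero] at this }
  let R : C₀(ℝ, HardyType n 2) :=
    { toFun := fun y => productFamily θ p ψ χ ((1 : ℝ) + y * Complex.I)
      continuous_toFun := hline 1
      zero_at_infty' := tendsto_productFamily θ hp ψ χ zero_le_one le_rfl }
  refine ⟨⟨fun z => HardyType.inclCLM n h12 (productFamily θ p ψ χ z), L, R,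
    (hJ.comp hdiff.continuous).continuousOn,
    ((HardyType.inclCLM n h12).differentiable.comp hdiff).differentiableOn, hnorm, ?_, ?_, fun y => ?_,
    fun y => ?_⟩, ?_⟩
  · rw [← ZeroAtInftyContinuousMap.norm_toBCF_eq_norm]
    exact (BoundedContinuousFunction.norm_le hK).2 fun y => hnorm _ (by simp) (by simp)
  · rw [← ZeroAtInftyContinuousMap.norm_toBCF_eq_norm]
    exact (BoundedContinuousFunction.norm_le hK).2 fun y => HardyType.norm_le hK (h2 _ (by simp))
  · change _ = HardyType.inclCLM n h12 (productFamily θ p ψ χ ((0 : ℝ) + y * Complex.I))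
    simp
  · change _ = hardyIncl n 2 (productFamily θ p ψ χ ((1 : ℝ) + y * Complex.I))
    rw [Complex.ofReal_one, HardyType.hardyIncl_inclCLM]
  -- At $z=\theta$ the exponential is 1 and the exponent $p(1-\theta/2)$ is 1, so the original
  -- simple functions reappear.
  · rw [HardyType.hardyIncl_inclCLM, hardyIncl_productFamily, sub_self, Complex.exp_zero, one_smul]
    have : ∀ ψ : SimpleFunc (UnitAddTorus (Fin n)) ℂ, (simplePower p ψ θ : _ → ℂ) = ψ := by
      intro ψ
      funext t
      exact powerFamily_eq_self hpθ (ψ t)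
    rw [this, this]

/-! ## Representing products and weakly factorised functions -/

lemma szegoProj_const_smul {n : ℕ} {u : UnitAddTorus (Fin n) → ℂ} (c : ℂ) :
    szegoProj n (c • u) = c • szegoProj n u := by
  funext w
  by_cases hw : w ∈ polydisc n
  · rw [Pi.smul_apply, szegoProj_apply _ hw, szegoProj_apply _ hw, smul_eq_mul,
      ← integral_const_mul]
    simp only [Pi.smul_apply, smul_eq_mul, mul_assoc]
  · simp [szegoProj, hw]

lemma integral_rpow_norm_le_one {n : ℕ} {q : ℝ} (hq : 0 < q)
    {ψ : SimpleFunc (UnitAddTorus (Fin n)) ℂ}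
    (h : eLpNorm ψ (ENNReal.ofReal q) (torusMeasure n) ≤ 1) :
    ∫ t, ‖ψ t‖ ^ q ∂(torusMeasure n) ≤ 1 := by
  have hmem : MemLp ψ (ENNReal.ofReal q) (torusMeasure n) :=
    ⟨ψ.aestronglyMeasurable, h.trans_lt ENNReal.one_lt_top⟩
  rw [hmem.eLpNorm_eq_integral_rpow_norm (by simpa using hq) ENNReal.ofReal_ne_top,
    ENNReal.toReal_ofReal hq.le, ENNReal.ofReal_le_one] at h
  have h0 : 0 ≤ ∫ t, ‖ψ t‖ ^ q ∂(torusMeasure n) := integral_nonneg fun t => by positivity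
  by_contra hlt
  exact absurd h (not_le.2 (Real.one_lt_rpow (not_le.1 hlt) (by positivity)))

lemma exists_hasRep_szegoProj_mul (n : ℕ) {θ p : ℝ} (hp : 0 < p)
    (hpθ : p * (1 - θ / 2) = 1) :
    ∃ K : ℝ, 0 ≤ K ∧ ∀ (ψ χ : SimpleFunc (UnitAddTorus (Fin n)) ℂ) (M N : ℝ), 0 < M → 0 < N →
      eLpNorm ψ (ENNReal.ofReal (2 * p)) (torusMeasure n) ≤ ENNReal.ofReal M →
      eLpNorm χ (ENNReal.ofReal (2 * p)) (torusMeasure n) ≤ ENNReal.ofReal N →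
      HasRep n θ (K * (M * N)) (szegoProj n ψ * szegoProj n χ) := by
  obtain ⟨K, hK, h⟩ := exists_hasRep_szegoProj_mul_of_le_one n hp hpθ
  refine ⟨K, hK, fun ψ χ M N hM hN hψ hχ => ?_⟩
  -- Division by the norm bound moves each factor into the unit ball; bilinearity of the product
  -- restores the factor $MN$.
  have hscale : ∀ (ψ : SimpleFunc (UnitAddTorus (Fin n)) ℂ) (M : ℝ), 0 < M →
      eLpNorm ψ (ENNReal.ofReal (2 * p)) (torusMeasure n) ≤ ENNReal.ofReal M →
      ∫ t, ‖((M : ℂ)⁻¹ • ψ) t‖ ^ (2 * p) ∂(torusMeasure n) ≤ 1 := by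
    intro ψ M hM hψ
    refine integral_rpow_norm_le_one (by positivity) ?_
    rw [SimpleFunc.coe_smul, eLpNorm_const_smul, enorm_inv (by exact_mod_cast hM.ne'),
      ← ofReal_norm, Complex.norm_real, Real.norm_of_nonneg hM.le, mul_comm]
    exact ENNReal.div_le_of_le_mul (by rwa [one_mul])
  have h1 := (h _ _ (hscale ψ M hM hψ) (hscale χ N hN hχ)).smul ((M : ℂ) * N)
  have hM' : (M : ℂ) ≠ 0 := by exact_mod_cast hM.ne'
  have hN' : (N : ℂ) ≠ 0 := by exact_mod_cast hN.ne'
  convert h1 using 1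
  · rw [norm_mul, Complex.norm_real, Complex.norm_real, Real.norm_of_nonneg hM.le,
      Real.norm_of_nonneg hN.le, mul_comm]
  · rw [SimpleFunc.coe_smul, SimpleFunc.coe_smul, szegoProj_const_smul, szegoProj_const_smul,
      smul_mul_smul_comm, smul_smul]
    rw [show (M : ℂ) * N * ((M : ℂ)⁻¹ * (N : ℂ)⁻¹) = 1 by field_simp, one_smul]

/-- The Szegő projection, evaluated at a point, is a continuous functional on `L^q`. -/
def szegoEvalCLM (n : ℕ) (q : ℝ≥0∞) [hq : Fact (1 ≤ q)] (w : Fin n → ℂ) :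
    Lp ℂ q (torusMeasure n) →L[ℂ] ℂ :=
  LinearMap.mkContinuous
    { toFun := fun f => ∫ t, f t * szegoKernel n w t ∂(torusMeasure n)
      map_add' := fun f g => by
        rw [← integral_add (integrable_mul_continuousMap ((Lp.memLp f).integrable hq.out) _)
          (integrable_mul_continuousMap ((Lp.memLp g).integrable hq.out) _)]
        refine integral_congr_ae ?_
        filter_upwards [Lp.coeFn_add f g] with t ht
        rw [ht, Pi.add_apply, add_mul]
      map_smul' := fun c f => by
        rw [RingHom.id_apply, smul_eq_mul, ← integral_const_mul]
        refine integral_congr_ae ?_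
        filter_upwards [Lp.coeFn_smul c f] with t ht
        rw [ht, Pi.smul_apply, smul_eq_mul, mul_assoc] }
    ‖szegoKernel n w‖ fun f => by
      have hfi := (Lp.memLp f).integrable hq.out
      have h1 : ∫ t, ‖f t‖ ∂(torusMeasure n) ≤ ‖f‖ := by
        rw [integral_norm_eq_lintegral_enorm hfi.aestronglyMeasurable,
          ← eLpNorm_one_eq_lintegral_enorm, Lp.norm_def]
        exact ENNReal.toReal_mono (Lp.eLpNorm_ne_top f)
          (eLpNorm_le_eLpNorm_of_exponent_le hq.out hfi.aestronglyMeasurable)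
      refine (norm_integral_le_integral_norm _).trans
        (le_trans ?_ (mul_le_mul_of_nonneg_left h1 (norm_nonneg _)))
      rw [← integral_const_mul]
      refine integral_mono_of_nonneg (Filter.Eventually.of_forall fun t => norm_nonneg _)
        (hfi.norm.const_mul _) (Filter.Eventually.of_forall fun t => ?_)
      simp only [norm_mul]
      rw [mul_comm]
      exact mul_le_mul_of_nonneg_right ((szegoKernel n w).norm_coe_le_norm t) (norm_nonneg _)

lemma szegoEvalCLM_apply {n : ℕ} {q : ℝ≥0∞} [Fact (1 ≤ q)] {w : Fin n → ℂ} (hw : w ∈ polydisc n)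
    (f : Lp ℂ q (torusMeasure n)) : szegoEvalCLM n q w f = szegoProj n f w :=
  (szegoProj_apply _ hw).symm

/-- A function in `L^q` is the sum of a geometrically convergent series of simple functions. -/
lemma exists_simpleFunc_hasSum_szegoProj {n : ℕ} {q : ℝ≥0∞} [hq : Fact (1 ≤ q)] (hq' : q ≠ ∞)
    {φ : UnitAddTorus (Fin n) → ℂ} (hφ : AEStronglyMeasurable φ (torusMeasure n)) {M : ℝ}
    (hM : 0 < M) (hφM : eLpNorm φ q (torusMeasure n) ≤ ENNReal.ofReal M) :
    ∃ ψ : ℕ → SimpleFunc (UnitAddTorus (Fin n)) ℂ,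
      (∀ k, eLpNorm (ψ k) q (torusMeasure n) ≤ ENNReal.ofReal (2 * M * (1 / 2) ^ k)) ∧
      ∀ w, Summable (fun k => ‖szegoProj n (ψ k) w‖) ∧
        HasSum (fun k => szegoProj n (ψ k) w) (szegoProj n φ w) := by
  have hmem : MemLp φ q (torusMeasure n) := ⟨hφ, hφM.trans_lt ENNReal.ofReal_lt_top⟩
  have hb : ∀ k : ℕ, 0 < M * (1 / 2 : ℝ) ^ k := fun k => by positivity
  obtain ⟨v, hv, hvs, hv0, hvk⟩ := controlled_sum_of_mem_closure
    (Lp.simpleFunc.dense (E := ℂ) (μ := torusMeasure n) hq' (hmem.toLp φ)) hb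
  -- The term of index 0 approximates the limit up to $M$, so its norm is at most $2M$; the later
  -- terms satisfy the stronger bound $M2^{-k}$.
  have hnorm : ∀ k, ‖v k‖ ≤ 2 * M * (1 / 2) ^ k := by
    intro k
    rcases Nat.eq_zero_or_pos k with rfl | hk
    · have h1 : ‖hmem.toLp φ‖ ≤ M := by
        rw [Lp.norm_toLp]
        exact ENNReal.toReal_le_of_le_ofReal hM.le hφM
      have h2 := norm_sub_le (hmem.toLp φ) (-v 0 + hmem.toLp φ)
      have h3 : hmem.toLp φ - (-v 0 + hmem.toLp φ) = v 0 := by abel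
      rw [h3] at h2
      simp only [pow_zero, mul_one] at hv0 ⊢
      linarith
    · have := hvk k hk
      have := hb k
      nlinarith
  set ψ : ℕ → SimpleFunc (UnitAddTorus (Fin n)) ℂ := fun k =>
    Lp.simpleFunc.toSimpleFunc ⟨v k, hvs k⟩ with hψ
  have hae : ∀ k, ψ k =ᵐ[torusMeasure n] v k := fun k => Lp.simpleFunc.toSimpleFunc_eq_toFun _
  refine ⟨ψ, fun k => ?_, fun w => ?_⟩
  · rw [eLpNorm_congr_ae (hae k), ← Lp.enorm_def, ← ofReal_norm]
    exact ENNReal.ofReal_le_ofReal (hnorm k)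
  · by_cases hw : w ∈ polydisc n
    swap
    · simp only [szegoProj, indicator_of_notMem hw, norm_zero]
      exact ⟨summable_zero, hasSum_zero⟩
    have heq : ∀ k, szegoProj n (ψ k) w = szegoEvalCLM n q w (v k) := fun k => by
      rw [szegoEvalCLM_apply hw, szegoProj_congr_ae (hae k)]
    have hlim : szegoProj n φ w = szegoEvalCLM n q w (hmem.toLp φ) := by
      rw [szegoEvalCLM_apply hw, szegoProj_congr_ae hmem.coeFn_toLp]
    have hsum : Summable fun k => ‖szegoProj n (ψ k) w‖ := by
      refine Summable.of_nonneg_of_le (fun k => norm_nonneg _) (fun k => ?_)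
        ((summable_geometric_two.mul_left (2 * M)).mul_left ‖szegoEvalCLM n q w‖)
      rw [heq]
      exact ((szegoEvalCLM n q w).le_opNorm _).trans
        (mul_le_mul_of_nonneg_left (hnorm k) (norm_nonneg _))
    refine ⟨hsum, ?_⟩
    have h1 := hsum.of_norm.hasSum
    -- The partial sums in `hv` include the term of index `k`, hence the shift by one.
    have h2 := (Filter.tendsto_add_atTop_iff_nat 1).2 h1.tendsto_sum_nat
    have h3 := ((szegoEvalCLM n q w).continuous.tendsto _).comp hv
    have h4 : szegoProj n φ w = ∑' k, szegoProj n (ψ k) w := by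
      rw [hlim]
      refine tendsto_nhds_unique h3 (h2.congr fun k => ?_)
      simp only [Function.comp_apply, map_sum, heq]
    rw [h4]
    exact h1

lemma hasSum_mul_of_summable_norm {f g : ℕ → ℂ} {a b : ℂ}
    (hf : Summable (fun k => ‖f k‖) ∧ HasSum f a) (hg : Summable (fun k => ‖g k‖) ∧ HasSum g b) :
    HasSum (fun i : ℕ × ℕ => f i.1 * g i.2) (a * b) :=
  hf.2.mul hg.2 (summable_mul_of_summable_norm hf.1 hg.1)

lemma HasRep.of_hasSum_mul {n : ℕ} {θ K : ℝ} (hθ0 : 0 ≤ θ) (hθ1 : θ ≤ 1) {a b : ℕ → ℝ} {A B : ℝ}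
    (hA : HasSum a A) (hB : HasSum b B) (ha : ∀ k, 0 ≤ a k) (hb : ∀ k, 0 ≤ b k)
    {g h : ℕ → (Fin n → ℂ) → ℂ} (hgh : ∀ k l, HasRep n θ (K * (a k * b l)) (g k * h l))
    {u v : (Fin n → ℂ) → ℂ}
    (hu : ∀ w, Summable (fun k => ‖g k w‖) ∧ HasSum (fun k => g k w) (u w))
    (hv : ∀ w, Summable (fun k => ‖h k w‖) ∧ HasSum (fun k => h k w) (v w)) :
    HasRep n θ (K * (A * B)) (u * v) := by
  have hs := hA.summable.mul_of_nonneg hB.summable ha hb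
  have hAB : HasSum (fun i : ℕ × ℕ => K * (a i.1 * b i.2)) (K * (A * B)) :=
    (hA.mul hB hs).mul_left K
  have hv' : ∀ i : ℕ × ℕ, HasRep n θ (K * (a i.1 * b i.2)) (g i.1 * h i.2) :=
    fun i => hgh i.1 i.2
  have hf : ∀ w, HasSum (fun i : ℕ × ℕ => (g i.1 * h i.2) w) ((u * v) w) := by
    intro w
    simp only [Pi.mul_apply]
    exact hasSum_mul_of_summable_norm (f := fun k => g k w) (g := fun k => h k w) (hu w) (hv w)
  exact HasRep.of_hasSum hθ0 hθ1 hAB hv' hf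

/-- Each factor is a geometric series of simple functions with total bound $4M$ or $4N$; the double
series of products then has total bound $16KMN$. -/
lemma hasRep_szegoProj_mul_of_simple {n : ℕ} {θ K : ℝ} (hθ0 : 0 ≤ θ) (hθ1 : θ ≤ 1) {q : ℝ≥0∞}
    [hq : Fact (1 ≤ q)] (hq' : q ≠ ∞)
    (hrep : ∀ (ψ χ : SimpleFunc (UnitAddTorus (Fin n)) ℂ) (M N : ℝ), 0 < M → 0 < N →
      eLpNorm ψ q (torusMeasure n) ≤ ENNReal.ofReal M →
      eLpNorm χ q (torusMeasure n) ≤ ENNReal.ofReal N →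
      HasRep n θ (K * (M * N)) (szegoProj n ψ * szegoProj n χ))
    {φ ξ : UnitAddTorus (Fin n) → ℂ} (hφ : AEStronglyMeasurable φ (torusMeasure n))
    (hξ : AEStronglyMeasurable ξ (torusMeasure n)) {M N : ℝ} (hM : 0 < M) (hN : 0 < N)
    (hφM : eLpNorm φ q (torusMeasure n) ≤ ENNReal.ofReal M)
    (hξN : eLpNorm ξ q (torusMeasure n) ≤ ENNReal.ofReal N) :
    HasRep n θ (16 * K * (M * N)) (szegoProj n φ * szegoProj n ξ) := by
  obtain ⟨ψ, hψ, hψs⟩ := exists_simpleFunc_hasSum_szegoProj hq' hφ hM hφM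
  obtain ⟨χ, hχ, hχs⟩ := exists_simpleFunc_hasSum_szegoProj hq' hξ hN hξN
  have hgeo : ∀ M : ℝ, HasSum (fun k : ℕ => 2 * M * (1 / 2) ^ k) (2 * M * 2) := fun M =>
    hasSum_geometric_two.mul_left _
  have h1 := HasRep.of_hasSum_mul hθ0 hθ1 (hgeo M) (hgeo N) (fun k => by positivity)
    (fun k => by positivity) (fun k l => hrep (ψ k) (χ l) (2 * M * (1 / 2) ^ k)
      (2 * N * (1 / 2) ^ l) (by positivity) (by positivity) (hψ k) (hχ l)) hψs hχs
  have h2 : K * (2 * M * 2 * (2 * N * 2)) = 16 * K * (M * N) := by ring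
  rw [h2] at h1
  exact h1

lemma exists_hasRep_mul (n : ℕ) {θ p : ℝ} (hθ0 : 0 ≤ θ) (hθ1 : θ ≤ 1) (hp : 1 ≤ p)
    (hpθ : p * (1 - θ / 2) = 1) :
    ∃ K : ℝ, 0 ≤ K ∧ ∀ g ∈ hardySpace n (ENNReal.ofReal (2 * p)),
      ∀ h ∈ hardySpace n (ENNReal.ofReal (2 * p)),
      HasRep n θ (K * (hardyNorm n (ENNReal.ofReal (2 * p)) g *
        hardyNorm n (ENNReal.ofReal (2 * p)) h).toReal) (g * h) := by
  obtain ⟨K, hK, hrep⟩ := exists_hasRep_szegoProj_mul n (by linarith) hpθ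
  have hq2 : 2 ≤ ENNReal.ofReal (2 * p) := by
    rw [← ENNReal.ofReal_ofNat]
    exact ENNReal.ofReal_le_ofReal (by linarith)
  have hq' : ENNReal.ofReal (2 * p) ≠ ∞ := ENNReal.ofReal_ne_top
  generalize ENNReal.ofReal (2 * p) = q at hrep hq2 hq'
  have hq1 : Fact (1 ≤ q) := ⟨one_le_two.trans hq2⟩
  refine ⟨16 * K, by positivity, fun g hg h hh => ?_⟩
  -- The scaling argument needs positive norms. If one of them vanishes, the product is zero and the
  -- empty sum represents it with bound 0.
  by_cases hzero : hardyNorm n q g * hardyNorm n q h = 0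
  · have hq0 : q ≠ 0 := (zero_lt_one.trans_le hq1.out).ne'
    have h0 : g * h = 0 := by
      rcases mul_eq_zero.1 hzero with h0 | h0
      · rw [hg.1.eq_zero_of_hardyNorm hq0 h0, zero_mul]
      · rw [hh.1.eq_zero_of_hardyNorm hq0 h0, mul_zero]
    rw [hzero, h0, ENNReal.toReal_zero, mul_zero]
    exact HasRep.of_hasSum hθ0 hθ1 (ι := Empty) (A := fun _ => 0) (v := fun _ => 0) hasSum_empty
      (fun i => i.elim) fun w => hasSum_empty
  rw [ENNReal.toReal_mul]
  have hM : 0 < (hardyNorm n q g).toReal :=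
    ENNReal.toReal_pos (left_ne_zero_of_mul hzero) hg.2.ne
  have hN : 0 < (hardyNorm n q h).toReal :=
    ENNReal.toReal_pos (right_ne_zero_of_mul hzero) hh.2.ne
  obtain ⟨φ, hφ, hφM, -, hgφ⟩ := exists_eq_szegoProj hq2 hg
  obtain ⟨ξ, hξ, hξN, -, hhξ⟩ := exists_eq_szegoProj hq2 hh
  have h1 := hasRep_szegoProj_mul_of_simple hθ0 hθ1 hq' hrep hφ hξ hM hN
    (hφM.trans (ENNReal.ofReal_toReal hg.2.ne).ge) (hξN.trans (ENNReal.ofReal_toReal hh.2.ne).ge)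
  rwa [← hgφ, ← hhξ] at h1

/-- Under weak factorisation each function in `H^p` has a representation by a strip function. -/
lemma exists_hasRep_of_hasEWF {n : ℕ} {C : ℝ≥0} {θ p : ℝ} (hθ0 : 0 ≤ θ) (hθ1 : θ ≤ 1)
    (hp : 1 ≤ p) (hpθ : p * (1 - θ / 2) = 1) (hEWF : HasEWF n p C) :
    ∃ K : ℝ≥0, ∀ f ∈ hardySpace n (ENNReal.ofReal p), ∃ A : ℝ, HasRep n θ A f ∧
      ENNReal.ofReal A ≤ K * hardyNorm n (ENNReal.ofReal p) f := by
  obtain ⟨K, hK, hrep⟩ := exists_hasRep_mul n hθ0 hθ1 hp hpθ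
  refine ⟨K.toNNReal * C, fun f hf => ?_⟩
  obtain ⟨g, h, hg, hh, hsum, hle⟩ := hEWF f hf
  set q := ENNReal.ofReal (2 * p)
  have hfin : ∑' j, hardyNorm n q (g j) * hardyNorm n q (h j) ≠ ∞ :=
    (hle.trans_lt (ENNReal.mul_lt_top ENNReal.coe_lt_top hf.2)).ne
  refine ⟨K * (∑' j, hardyNorm n q (g j) * hardyNorm n q (h j)).toReal, ?_, ?_⟩
  · have hA : HasSum (fun j => K * (hardyNorm n q (g j) * hardyNorm n q (h j)).toReal)
        (K * (∑' j, hardyNorm n q (g j) * hardyNorm n q (h j)).toReal) := by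
      rw [ENNReal.tsum_toReal_eq (ENNReal.ne_top_of_tsum_ne_top hfin)]
      exact (ENNReal.summable_toReal hfin).hasSum.mul_left K
    refine HasRep.of_hasSum hθ0 hθ1 hA (v := fun j => g j * h j)
      (fun j => hrep _ (hg j) _ (hh j)) fun w => ?_
    by_cases hw : w ∈ polydisc n
    · exact hsum w hw
    · simp only [Pi.mul_apply, (hg _).1.2 w hw, zero_mul, hf.1.2 w hw]
      exact hasSum_zero
  · rw [ENNReal.ofReal_mul hK, ENNReal.ofReal_toReal hfin, ENNReal.coe_mul, mul_assoc]
    exact mul_le_mul' le_rfl hle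

/-! ## Functions on the strip with values in spaces of continuous functions -/

section Strip

open Complex.HadamardThreeLines

variable {X : Type*} [TopologicalSpace X] [CompactSpace X]

lemma ContinuousMap.exp_smul_apply (W : C(X, ℂ)) (z : ℂ) (t : X) :
    NormedSpace.exp (z • W) t = Complex.exp (z * W t) := by
  have h := NormedSpace.map_exp (ContinuousMap.evalAlgHom ℂ ℂ t)
    (continuous_eval_const t) (z • W)
  rw [Complex.exp_eq_exp_ℂ]
  exact h

lemma ContinuousMap.norm_exp_smul_apply (W : C(X, ℝ)) (z : ℂ) (t : X) :
    ‖NormedSpace.exp (z • ((⟨(↑), Complex.continuous_ofReal⟩ : C(ℝ, ℂ)).comp W)) t‖ =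
      Real.exp (z.re * W t) := by
  rw [ContinuousMap.exp_smul_apply, Complex.norm_exp]
  simp

lemma closure_verticalStrip : closure (verticalStrip 0 1) = verticalClosedStrip 0 1 := by
  rw [verticalStrip, verticalClosedStrip, Complex.closure_preimage_re, closure_Ioo zero_ne_one]

variable [MeasurableSpace X] [BorelSpace X] {μ : Measure X} [IsProbabilityMeasure μ]

lemma integral_mul_le_sqrt_mul_sqrt {f g : C(X, ℝ)} (hf : 0 ≤ f) (hg : 0 ≤ g) :
    ∫ t, f t * g t ∂μ ≤ √(∫ t, f t ^ 2 ∂μ) * √(∫ t, g t ^ 2 ∂μ) := by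
  have hmem : ∀ f : C(X, ℝ), MemLp f (ENNReal.ofReal 2) μ := fun f =>
    MemLp.of_bound f.continuous.aestronglyMeasurable ‖f‖
      (Filter.Eventually.of_forall f.norm_coe_le_norm)
  have h := integral_mul_le_Lp_mul_Lq_of_nonneg Real.HolderConjugate.two_two
    (Filter.Eventually.of_forall hf) (Filter.Eventually.of_forall hg) (hmem f) (hmem g)
  simp only [Real.rpow_ofNat, ← Real.sqrt_eq_rpow] at h
  exact h

/-- The three lines theorem, tested against an analytic family built from `m`. -/
lemma integral_rpow_sub_le_of_strip {F : ℂ → C(X, ℂ)}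
    (hd : DiffContOnCl ℂ F (verticalStrip 0 1))
    (hB : BddAbove ((norm ∘ F) '' verticalClosedStrip 0 1)) {θ p M : ℝ} (hθ0 : 0 < θ)
    (hθ1 : θ < 1) (hp2 : p ≤ 2) (hpθ : p * (1 - θ / 2) = 1) (hM : 0 ≤ M)
    (h0 : ∀ z : ℂ, z.re = 0 → ∫ t, ‖F z t‖ ∂μ ≤ M)
    (h1 : ∀ z : ℂ, z.re = 1 → √(∫ t, ‖F z t‖ ^ 2 ∂μ) ≤ M) {m : C(X, ℝ)} {s : ℝ} (hs : 0 < s)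
    (hm : ∀ t, m t ^ 2 = ‖F θ t‖ ^ 2 + s ^ 2) (hms : ∀ t, s ≤ m t) :
    ∫ t, m t ^ p ∂μ - s ^ p ≤ M * (∫ t, m t ^ p ∂μ) ^ (θ / 2) := by
  have hm0 : ∀ t, 0 < m t := fun t => hs.trans_le (hms t)
  have hFm : ∀ t, ‖F θ t‖ ≤ m t := fun t =>
    abs_le_of_sq_le_sq' (by rw [hm]; nlinarith) (hm0 t).le |>.2
  -- With this logarithm $e^{zW}=m^{pz/2}$. The lower bound $s$ on $m$ keeps it continuous.
  set W : C(X, ℝ) := ⟨fun t => p / 2 * Real.log (m t),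
    continuous_const.mul (m.continuous.log fun t => (hm0 t).ne')⟩ with hW
  set Wc : C(X, ℂ) := (⟨(↑), Complex.continuous_ofReal⟩ : C(ℝ, ℂ)).comp W with hWc
  have hexp : ∀ a t, Real.exp (a * W t) = m t ^ (p / 2 * a) := fun a t => by
    rw [Real.rpow_def_of_pos (hm0 t)]
    congr 1
    simp only [hW, ContinuousMap.coe_mk]
    ring
  -- A regularised phase of $F(\theta)$: continuous even at the zeros of $F(\theta)$, and of modulus
  -- at most 1.
  set u : X → ℂ := fun t => (starRingEnd ℂ) (F θ t) / (m t : ℂ) with hu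
  have huc : Continuous u := by
    refine Continuous.div ?_ (by fun_prop) fun t => by exact_mod_cast (hm0 t).ne'
    exact Complex.continuous_conj.comp (F θ).continuous
  have hu1 : ∀ t, ‖u t‖ ≤ 1 := fun t => by
    rw [hu, norm_div, RCLike.norm_conj, Complex.norm_real, Real.norm_of_nonneg (hm0 t).le]
    exact (div_le_one (hm0 t)).2 (hFm t)
  have hui : Integrable u μ := ContinuousMap.integrable_of_compact μ huc
  set G : ℂ → ℂ := fun z => integralMulCLM u hui (F z * NormedSpace.exp (z • Wc)) with hG
  have hint : ∀ f : X → ℝ, Continuous f → Integrable f μ := fun f hf =>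
    hf.integrable_of_hasCompactSupport (HasCompactSupport.of_compactSpace f)
  have hbound : ∀ z, ‖G z‖ ≤ ∫ t, ‖F z t‖ * m t ^ (p / 2 * z.re) ∂μ := fun z => by
    refine norm_integral_le_of_norm_le (hint _ ?_) (Filter.Eventually.of_forall fun t => ?_)
    · exact (F z).continuous.norm.mul (m.continuous.rpow_const fun t => .inl (hm0 t).ne')
    · rw [norm_mul, ContinuousMap.mul_apply, norm_mul, ContinuousMap.norm_exp_smul_apply, hexp]
      exact mul_le_of_le_one_left (by have := hm0 t; positivity) (hu1 t)
  set J := ∫ t, m t ^ p ∂μ with hJ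
  have hJ0 : 0 ≤ J := integral_nonneg fun t => Real.rpow_nonneg (hm0 t).le _
  have hGd : DiffContOnCl ℂ G (verticalStrip 0 1) := by
    have hE : Differentiable ℂ fun z : ℂ => NormedSpace.exp (z • Wc) := fun z =>
      differentiableAt_exp_smul_const Wc z
    refine (integralMulCLM u hui).differentiable.comp_diffContOnCl ⟨?_, ?_⟩
    · exact hd.1.mul hE.differentiableOn
    · exact hd.2.mul hE.continuous.continuousOn
  have hGB : BddAbove ((norm ∘ G) '' verticalClosedStrip 0 1) := by
    obtain ⟨B, hB⟩ := hB
    refine ⟨‖integralMulCLM u hui‖ * (B * Real.exp ‖W‖), ?_⟩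
    rintro _ ⟨z, hz, rfl⟩
    refine ((integralMulCLM u hui).le_opNorm _).trans
      (mul_le_mul_of_nonneg_left ?_ (norm_nonneg _))
    have hB0 := hB (mem_image_of_mem _ hz)
    refine (norm_mul_le _ _).trans (mul_le_mul hB0 ?_ (norm_nonneg _)
      ((norm_nonneg _).trans hB0))
    rw [ContinuousMap.norm_le _ (Real.exp_nonneg _)]
    intro t
    rw [ContinuousMap.norm_exp_smul_apply]
    refine Real.exp_le_exp.2 ((le_abs_self _).trans ?_)
    rw [abs_mul, abs_of_nonneg hz.1]
    exact (mul_le_of_le_one_left (abs_nonneg _) hz.2).trans (W.norm_coe_le_norm t)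
  -- Here $p\theta/2=p-1$, and the division by $m$ in `u` lowers the exponent to $p-2$.
  have hθ : G θ = ((∫ t, ‖F θ t‖ ^ 2 * m t ^ (p - 2) ∂μ : ℝ) : ℂ) := by
    rw [← integral_complex_ofReal, hG]
    refine integral_congr_ae (Filter.Eventually.of_forall fun t => ?_)
    have e1 : Complex.exp (θ * Wc t) = ((m t ^ (p - 1) : ℝ) : ℂ) := by
      have : p / 2 * θ = p - 1 := by linarith
      rw [← this, ← hexp]
      push_cast
      rfl
    have e2 : m t ^ (p - 1) = m t ^ (p - 2) * m t := by
      rw [← Real.rpow_add_one (hm0 t).ne']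
      congr 1
      ring
    have hmc : (m t : ℂ) ≠ 0 := by exact_mod_cast (hm0 t).ne'
    simp only [hu, ContinuousMap.mul_apply, ContinuousMap.exp_smul_apply, e1, e2]
    push_cast
    rw [← Complex.conj_mul']
    field_simp
  -- On the left edge the power of $m$ has modulus 1, which leaves the $L^1$ bound; on the right
  -- edge it has modulus $m^{p/2}$, and Cauchy–Schwarz gives $M\sqrt J$.
  have key := norm_le_interp_of_mem_verticalClosedStrip₀₁' G (z := θ) (a := M) (b := M * √J)
    ⟨by simpa using hθ0.le, by simpa using hθ1.le⟩ hGd hGB (fun z hz => ?_) (fun z hz => ?_)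
  · rw [hθ, Complex.norm_real, Complex.ofReal_re] at key
    have e1 : M ^ (1 - θ) * (M * √J) ^ θ = M * J ^ (θ / 2) := by
      rw [Real.mul_rpow hM (Real.sqrt_nonneg _), ← mul_assoc,
        ← Real.rpow_add' hM (by simp), sub_add_cancel, Real.rpow_one, Real.sqrt_eq_rpow,
        ← Real.rpow_mul hJ0]
      congr 2
      ring
    rw [e1] at key
    refine le_trans ?_ ((le_abs_self _).trans key)
    have hconst : s ^ p = ∫ _, s ^ p ∂μ := by simp
    have hcp : ∀ a : ℝ, Continuous fun t => m t ^ a := fun a =>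
      m.continuous.rpow_const fun t => .inl (hm0 t).ne'
    rw [hconst, hJ, ← integral_sub (hint _ (hcp p)) (integrable_const _)]
    refine integral_mono ((hint _ (hcp p)).sub (integrable_const _))
      (hint _ ((F θ).continuous.norm.pow 2 |>.mul (hcp _))) fun t => ?_
    have e2 : m t ^ p = m t ^ (p - 2) * m t ^ 2 := by
      rw [← Real.rpow_natCast, ← Real.rpow_add (hm0 t)]
      congr 1
      push_cast
      ring
    have e3 : s ^ p = s ^ (p - 2) * s ^ 2 := by
      rw [← Real.rpow_natCast, ← Real.rpow_add hs]
      congr 1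
      push_cast
      ring
    -- As $p\le2$, this yields $s^2m^{p-2}\le s^p$, so replacing $m^2$ by $|F(\theta)|^2=m^2-s^2$
    -- costs at most $s^p$.
    have e4 : m t ^ (p - 2) ≤ s ^ (p - 2) :=
      Real.rpow_le_rpow_of_nonpos hs (hms t) (by linarith)
    change m t ^ p - s ^ p ≤ ‖F θ t‖ ^ 2 * m t ^ (p - 2)
    rw [show ‖F θ t‖ ^ 2 = m t ^ 2 - s ^ 2 by rw [hm]; ring, e2, e3]
    nlinarith [mul_le_mul_of_nonneg_right e4 (sq_nonneg s)]
  · have hz' : z.re = 0 := hz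
    have h := hbound z
    simp only [hz', mul_zero, Real.rpow_zero, mul_one] at h
    exact h.trans (h0 z hz')
  · have hz' : z.re = 1 := hz
    have h := hbound z
    simp only [hz', mul_one] at h
    have hcs := integral_mul_le_sqrt_mul_sqrt (μ := μ) (f := ⟨fun t => ‖F z t‖, (F z).continuous.norm⟩)
      (g := ⟨fun t => m t ^ (p / 2), m.continuous.rpow_const fun t => .inl (hm0 t).ne'⟩)
      (fun t => norm_nonneg _) fun t => Real.rpow_nonneg (hm0 t).le _
    simp only [ContinuousMap.coe_mk] at hcs
    refine h.trans (hcs.trans (mul_le_mul (h1 z hz') (Real.sqrt_le_sqrt ?_) (Real.sqrt_nonneg _) hM))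
    rw [hJ]
    refine (integral_congr_ae (Filter.Eventually.of_forall fun t => ?_)).le
    rw [← Real.rpow_natCast, ← Real.rpow_mul (hm0 t).le]
    congr 1
    push_cast
    ring

/-- The three lines theorem for `L^1` and `L^2` bounds of a family of continuous functions. -/
lemma integral_rpow_le_of_strip {F : ℂ → C(X, ℂ)}
    (hd : DiffContOnCl ℂ F (verticalStrip 0 1))
    (hB : BddAbove ((norm ∘ F) '' verticalClosedStrip 0 1)) {θ p M : ℝ} (hθ0 : 0 < θ)
    (hθ1 : θ < 1) (hp0 : 0 < p) (hp2 : p ≤ 2) (hpθ : p * (1 - θ / 2) = 1) (hM : 0 ≤ M)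
    (h0 : ∀ z : ℂ, z.re = 0 → ∫ t, ‖F z t‖ ∂μ ≤ M)
    (h1 : ∀ z : ℂ, z.re = 1 → √(∫ t, ‖F z t‖ ^ 2 ∂μ) ≤ M) :
    (∫ t, ‖F θ t‖ ^ p ∂μ) ^ (1 / p) ≤ M := by
  set J₀ := ∫ t, ‖F θ t‖ ^ p ∂μ with hJ₀
  have hnn : 0 ≤ J₀ := integral_nonneg fun t => Real.rpow_nonneg (norm_nonneg _) _
  have hpe : 1 / p = 1 - θ / 2 := by
    field_simp
    linarith
  -- The choice of $s$ below needs a positive integral.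
  rcases hnn.eq_or_lt with hz | hpos
  · rw [← hz, Real.zero_rpow (by positivity)]
    exact hM
  refine le_of_forall_pos_le_add fun δ hδ => ?_
  have hc : 0 < δ * J₀ ^ (θ / 2) := by positivity
  -- Chosen so that the error $s^p=\delta J_0^{\theta/2}\le\delta J^{\theta/2}$ is absorbed into the
  -- right side. Dividing $J\le(M+\delta)J^{\theta/2}$ by $J^{\theta/2}$ leaves the power
  -- $1-\theta/2=1/p$.
  obtain ⟨s, hs, hsp⟩ : ∃ s : ℝ, 0 < s ∧ s ^ p = δ * J₀ ^ (θ / 2) :=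
    ⟨_, Real.rpow_pos_of_pos hc (1 / p), by
      rw [← Real.rpow_mul hc.le, one_div_mul_cancel hp0.ne', Real.rpow_one]⟩
  set m : C(X, ℝ) := ⟨fun t => √(‖F θ t‖ ^ 2 + s ^ 2),
    (((F θ).continuous.norm.pow 2).add continuous_const).sqrt⟩ with hm
  have hm2 : ∀ t, m t ^ 2 = ‖F θ t‖ ^ 2 + s ^ 2 := fun t => Real.sq_sqrt (by positivity)
  have hms : ∀ t, s ≤ m t := fun t => Real.le_sqrt_of_sq_le (by nlinarith [sq_nonneg ‖F θ t‖])
  have hFm : ∀ t, ‖F θ t‖ ≤ m t := fun t => Real.le_sqrt_of_sq_le (by nlinarith)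
  have h := integral_rpow_sub_le_of_strip (μ := μ) hd hB hθ0 hθ1 hp2 hpθ hM h0 h1 hs hm2 hms
  set J := ∫ t, m t ^ p ∂μ with hJ
  have hint : ∀ f : X → ℝ, Continuous f → Integrable f μ := fun f hf =>
    hf.integrable_of_hasCompactSupport (HasCompactSupport.of_compactSpace f)
  have hJJ : J₀ ≤ J :=
    integral_mono (hint _ ((F θ).continuous.norm.rpow_const fun t => .inr hp0.le))
      (hint _ (m.continuous.rpow_const fun t => .inr hp0.le))
      fun t => Real.rpow_le_rpow (norm_nonneg _) (hFm t) hp0.le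
  have hJpos := hpos.trans_le hJJ
  have h2 : J ≤ (M + δ) * J ^ (θ / 2) := by
    have := Real.rpow_le_rpow hnn hJJ (by positivity : 0 ≤ θ / 2)
    rw [hsp] at h
    nlinarith
  rw [hpe]
  refine (Real.rpow_le_rpow hnn hJJ (by linarith)).trans ?_
  rw [Real.rpow_sub hJpos, Real.rpow_one]
  exact (div_le_iff₀ (by positivity)).2 h2

end Strip

/-! ## The interpolation space is contained in `H^p` -/

section Slices

open Complex.HadamardThreeLines

/-- Restriction of the elements of `H^1 + H^2` to the torus of radius `r`. -/
def sumSpaceSliceCLM (n : ℕ) {r : ℝ} (hr : r ∈ Ico (0 : ℝ) 1) :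
    SumSpace (hardyIncl n 1) (hardyIncl n 2) →L[ℂ] C(UnitAddTorus (Fin n), ℂ) :=
  Submodule.liftQL _
    (((HardyType.sliceCLM n 1 hr).coprod (HardyType.sliceCLM n 2 hr)) ∘L
      (WithLp.prodContinuousLinearEquiv 1 ℂ (HardyType n 1) (HardyType n 2)).toContinuousLinearMap)
    fun x hx => by
      ext t
      exact congrFun (LinearMap.mem_ker.1 hx) (torusPoint r t)

lemma sumSpaceSliceCLM_apply {n : ℕ} {r : ℝ} (hr : r ∈ Ico (0 : ℝ) 1)
    (x : SumSpace (hardyIncl n 1) (hardyIncl n 2)) (t : UnitAddTorus (Fin n)) :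
    sumSpaceSliceCLM n hr x t = SumSpace.val (hardyIncl n 1) (hardyIncl n 2) x (torusPoint r t) := by
  obtain ⟨x, rfl⟩ := Submodule.mkQ_surjective _ x
  rfl

lemma isHolomorphicOnPolydisc_val {n : ℕ} (x : SumSpace (hardyIncl n 1) (hardyIncl n 2)) :
    IsHolomorphicOnPolydisc n (SumSpace.val (hardyIncl n 1) (hardyIncl n 2) x) := by
  obtain ⟨x, rfl⟩ := Submodule.mkQ_surjective _ x
  exact (hardyIncl_mem x.fst).1.add (hardyIncl_mem x.snd).1

lemma eLpNorm_eq_ofReal_integral {n : ℕ} {p : ℝ} (hp : 0 < p) (f : C(UnitAddTorus (Fin n), ℂ)) :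
    eLpNorm f (ENNReal.ofReal p) (torusMeasure n) =
      ENNReal.ofReal ((∫ t, ‖f t‖ ^ p ∂(torusMeasure n)) ^ (1 / p)) := by
  have hmem : MemLp f (ENNReal.ofReal p) (torusMeasure n) :=
    MemLp.of_bound f.continuous.aestronglyMeasurable ‖f‖
      (Filter.Eventually.of_forall f.norm_coe_le_norm)
  rw [hmem.eLpNorm_eq_integral_rpow_norm (by simpa using hp) ENNReal.ofReal_ne_top,
    ENNReal.toReal_ofReal hp.le, one_div]

lemma HardyType.integral_rpow_slice_le {n : ℕ} {q : ℝ≥0∞} [Fact (1 ≤ q)] {p : ℝ} (hp : 0 < p)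
    (hpq : ENNReal.ofReal p = q) {r : ℝ} (hr : r ∈ Ico (0 : ℝ) 1) (f : HardyType n q) :
    (∫ t, ‖HardyType.sliceCLM n q hr f t‖ ^ p ∂(torusMeasure n)) ^ (1 / p) ≤ ‖f‖ := by
  rw [← ENNReal.ofReal_le_ofReal_iff (norm_nonneg f), ← eLpNorm_eq_ofReal_integral hp, hpq,
    ofReal_norm, HardyType.enorm_eq]
  exact eLpNorm_slice_le_hardyNorm q _ hr

/-- On a torus of radius $r<1$ both boundary spaces map into $C(\mathbb T^n)$, where the three lines
estimate applies. Its constant is independent of $r$, so the supremum over $r$ can be taken. -/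
lemma CalderonFunction.hardyNorm_le {n : ℕ} (F : CalderonFunction (hardyIncl n 1) (hardyIncl n 2))
    {θ p : ℝ} (hθ0 : 0 < θ) (hθ1 : θ < 1) (hp0 : 0 < p) (hp2 : p ≤ 2) (hpθ : p * (1 - θ / 2) = 1) :
    hardyNorm n (ENNReal.ofReal p) (SumSpace.val _ _ (F.toFun θ)) ≤ F.norm := by
  have hM : F.norm = ENNReal.ofReal (max ‖F.left‖ ‖F.right‖) := by
    rw [CalderonFunction.norm, ENNReal.ofReal_max, ofReal_norm, ofReal_norm]
  rw [hM]
  refine iSup₂_le fun r hr => ?_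
  have hsl : (fun t => SumSpace.val _ _ (F.toFun θ) (torusPoint r t)) =
      sumSpaceSliceCLM n hr (F.toFun θ) := funext fun t => (sumSpaceSliceCLM_apply hr _ t).symm
  rw [hsl, eLpNorm_eq_ofReal_integral hp0]
  refine ENNReal.ofReal_le_ofReal ?_
  have hline : ∀ z : ℂ, z = z.re + z.im * Complex.I := fun z => (Complex.re_add_im z).symm
  refine integral_rpow_le_of_strip (F := fun z => sumSpaceSliceCLM n hr (F.toFun z))
    ⟨?_, ?_⟩ ?_ hθ0 hθ1 hp0 hp2 hpθ (le_max_of_le_left (norm_nonneg _)) (fun z hz => ?_)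
    fun z hz => ?_
  · exact (sumSpaceSliceCLM n hr).differentiable.comp_differentiableOn F.holomorphic
  · rw [closure_verticalStrip]
    exact (sumSpaceSliceCLM n hr).continuous.comp_continuousOn F.continuousOn
  · obtain ⟨B, hB⟩ := F.bounded
    refine ⟨‖sumSpaceSliceCLM n hr‖ * B, ?_⟩
    rintro _ ⟨z, hz, rfl⟩
    exact ((sumSpaceSliceCLM n hr).le_opNorm _).trans
      (mul_le_mul_of_nonneg_left (hB z hz.1 hz.2) (norm_nonneg _))
  · have h : sumSpaceSliceCLM n hr (F.toFun z) = HardyType.sliceCLM n 1 hr (F.left z.im) := by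
      ext t
      rw [sumSpaceSliceCLM_apply, hline z, hz, Complex.ofReal_zero, zero_add, F.left_eq,
        HardyType.sliceCLM_apply]
      simp
    rw [h]
    have h1 := HardyType.integral_rpow_slice_le one_pos ENNReal.ofReal_one hr (F.left z.im)
    simp only [Real.rpow_one, div_one] at h1
    exact h1.trans ((F.left.toBCF.norm_coe_le_norm z.im).trans (le_max_left _ _))
  · have h : sumSpaceSliceCLM n hr (F.toFun z) = HardyType.sliceCLM n 2 hr (F.right z.im) := by
      ext t
      rw [sumSpaceSliceCLM_apply, hline z, hz, Complex.ofReal_one, F.right_eq,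
        HardyType.sliceCLM_apply]
      simp
    rw [h]
    have h1 := HardyType.integral_rpow_slice_le two_pos (ENNReal.ofReal_ofNat 2) hr (F.right z.im)
    simp only [Real.rpow_ofNat, ← Real.sqrt_eq_rpow] at h1
    exact h1.trans ((F.right.toBCF.norm_coe_le_norm z.im).trans (le_max_right _ _))

end Slices

end

/-! ### The interpolation theorem. -/

theorem mainTheorem5 (n : ℕ) (C : ℝ≥0) (hC : 0 < C)
    (hEWF : ∀ q : ℝ, 1 ≤ q → q ≤ 2 → HasEWF n q C)
    (θ p : ℝ) (hθ0 : 0 < θ) (hθ1 : θ < 1) (hp : 1 / p = 1 - θ / 2) :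
    complexInterp (hardyIncl n 1) (hardyIncl n 2) θ
        = (hardySpace n (ENNReal.ofReal p) : Set ((Fin n → ℂ) → ℂ)) ∧
      ∃ c K : ℝ≥0, 0 < c ∧ 0 < K ∧ ∀ f ∈ hardySpace n (ENNReal.ofReal p),
        c * hardyNorm n (ENNReal.ofReal p) f
            ≤ complexInterpNorm (hardyIncl n 1) (hardyIncl n 2) θ f ∧
          complexInterpNorm (hardyIncl n 1) (hardyIncl n 2) θ f
            ≤ K * hardyNorm n (ENNReal.ofReal p) f := by
  have hp0 : 0 < p := one_div_pos.1 (by rw [hp]; linarith)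
  have hpθ : p * (1 - θ / 2) = 1 := by rw [← hp, mul_one_div_cancel hp0.ne']
  have hp1 : 1 ≤ p := by nlinarith
  have hp2 : p ≤ 2 := by nlinarith
  obtain ⟨K, hK⟩ := exists_hasRep_of_hasEWF hθ0.le hθ1.le hp1 hpθ (hEWF p hp1 hp2)
  -- The three lines estimate is contractive, which gives the lower constant 1; `K + 1` replaces `K`
  -- to make the upper constant positive.
  refine ⟨Subset.antisymm ?_ ?_, 1, K + 1, one_pos, by positivity, fun f hf => ⟨?_, ?_⟩⟩
  · rintro _ ⟨F, rfl⟩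
    exact ⟨isHolomorphicOnPolydisc_val _,
      (F.hardyNorm_le hθ0 hθ1 hp0 hp2 hpθ).trans_lt (max_lt enorm_lt_top enorm_lt_top)⟩
  · intro f hf
    obtain ⟨A, hA, -⟩ := hK f hf
    exact hA.mem_complexInterp
  · rw [ENNReal.coe_one, one_mul]
    refine le_iInf₂ fun F hF => ?_
    rw [← hF]
    exact F.hardyNorm_le hθ0 hθ1 hp0 hp2 hpθ
  · obtain ⟨A, hA, hle⟩ := hK f hf
    refine hA.complexInterpNorm_le.trans (hle.trans (mul_le_mul' ?_ le_rfl))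
    exact_mod_cast le_self_add
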